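/- Fix integers $k,r,m\ge 1$ and $h_0\ge1$, and let $p,q,T\to\infty$ jointly, along an arbitrary sequence $(p_n,q_n,T_n)$. For each $n$ let $$Y_t=AX_t+RF_tC'+E_t\in\mathbb R^{p\times q},\qquad t=1,\dots,T,$$ where $A\in\mathbb R^{p\times m}$, $R\in\mathbb R^{p\times k}$, $C\in\mathbb R^{q\times r}$ are deterministic and $X_t$ ($m\times q$, observed), $F_t$ ($k\times r$) and $E_t$ ($p\times q$) are random; all of these, and the probability space, may depend on $n$, while constants and $\asymp$ below are uniform in $n$. Assume that $\mathbb E F_t=0$; that $\mathrm{vec}(E_t)$ is white noise (mean zero, covariance matrix $\Sigma_e$ independent of $t$, no serial correlation), uncorrelated with $\mathrm{vec}(F_s)$ for all $s,t$ and with $\mathrm{vec}(X_t)$ for every $t$; and that $\mathrm{vec}(F_t)$ and $\mathrm{vec}(X_t)$ are uncorrelated for every $t$. **Estimators.** Let $\widehat A=(\frac1T\sum_tY_tX_t')(\frac1T\sum_tX_tX_t')^{-1}$, $W_t=RF_tC'+E_t$ and $\widehat W_t=Y_t-\widehat AX_t$. For a matrix process $V_t$ with columns $v_{t,i}$ put $\mathsf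 M(V)=\sum_{h=1}^{h_0}\sum_{i,j}\Omega_{ij}(h)\Omega_{ij}(h)'$ with $\Omega_{ij}(h)=\frac1{T-h}\sum_{t=1}^{T-h}\mathrm{Cov}(v_{t,i},v_{t+h,j})$, and let $\widehat{\mathsf M}(V)$ be the same expression with $v_{t,i}v_{t+h,j}'$ in place of $\mathrm{Cov}(v_{t,i},v_{t+h,j})$. Let $M_1=\mathsf M(W)$, $M_2=\mathsf M(W')$, $\widehat M_1=\widehat{\mathsf M}(\widehat W)$, $\widehat M_2=\widehat{\mathsf M}(\widehat W')$. The columns of $Q_1$ (of $\widehat Q_1$) are orthonormal eigenvectors of $M_1$ (of $\widehat M_1$) for its $k$ largest eigenvalues, in decreasing order; those of $Q_2$ (of $\widehat Q_2$) are orthonormal eigenvectors of $M_2$ (of $\widehat M_2$) for its $r$ largest eigenvalues, in decreasing order. **Conditions.** Write $\Sigma_f(h)=\frac1{T-h}\sum_{t=1}^{T-h}\mathrm{Cov}(\mathrm{vec}F_t,\mathrm{vec}F_{t+h})$; $\sigma_j$ and $\lambda_j$ denote the $j$-th largest singular value and eigenvalue. 1. For some $\gamma>2$ the $\alpha$-mixing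 coefficients $\alpha(l)$ of $(\mathrm{vec}Y_t,\mathrm{vec}X_t,\mathrm{vec}F_t)_{t\in\mathbb Z}$ satisfy $\sum_{l\ge1}\alpha(l)^{1-2/\gamma}\le B$, with $B$ independent of $n$. 2. The absolute moments of order $2\gamma$ of all entries of $F_t,X_t,E_t$, $1\le t\le T$, are at most a constant. 3. There is $1\le h\le h_0$ such that, with $k^*=\max(k,r)$, $\mathrm{rank}\,\Sigma_f(h)\ge k^*$ for large $n$ and $\|\Sigma_f(h)\|_2\asymp1\asymp\sigma_{k^*}(\Sigma_f(h))$, and, for large $n$, $\frac1{T-h}\sum_{t=1}^{T-h}\mathrm{Cov}(F_{t,i\cdot},F_{t+h,i\cdot})\ne0$ and $\frac1{T-h}\sum_{t=1}^{T-h}\mathrm{Cov}(F_{t,\cdot j},F_{t+h,\cdot j})\neq0$ for every row index $i$ and column index $j$. Moreover the lagged autocovariances of $F_t$ have full row rank and full column rank uniformly: for some $c>0$ and all large $n$, $\lambda_k(\mathsf M(F))\ge c$ and $\lambda_r(\mathsf M(F'))\ge c$. 4. $P_t=\mathbb E(X_tX_t')$, $1\le t\le T$, is positive definite, and $\frac1T\sum_{t=1}^TP_t-P\to0$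 for positive definite matrices $P=P_n$ with $\lambda_{\min}(P)\asymp q$. 5. The entries of $\Sigma_e$ are bounded. 6. For constants $\delta_1,\delta_2\in[0,1]$: $\|R\|_2^2\asymp p^{1-\delta_1}\asymp\sigma_k(R)^2$ and $\|C\|_2^2\asymp q^{1-\delta_2}\asymp\sigma_r(C)^2$. 7. For large $n$ the $k$ largest eigenvalues of $M_1$ are positive and distinct, and so are the $r$ largest eigenvalues of $M_2$. **Theorem 5.** Under these conditions, if $p^{\delta_1}q^{\delta_2}T^{-1/2}=o(1)$, then $$\mathcal D(\widehat Q_i,Q_i)=O_p\bigl(p^{\delta_1}q^{\delta_2}T^{-1/2}\bigr),\qquad i=1,2,$$ where $\mathcal D(O_1,O_2)=\bigl(1-\tfrac1{\max(q_1,q_2)}\mathrm{Tr}(O_1O_1'O_2O_2')\bigr)^{1/2}$ for matrices $O_1,O_2$ with $q_1$ and $q_2$ orthonormal columns. -/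

import Mathlib

open MeasureTheory ProbabilityTheory Filter Topology Asymptotics Matrix

noncomputable section

namespace MatFactor

/-! ### Linear algebra -/

/-- The eigenvalues of a real symmetric matrix in decreasing order, numbered from `0` and repeated
with multiplicity (`0` from the size of the matrix on, and for non-symmetric matrices). -/
def nthEig {ι : Type*} [Fintype ι] [DecidableEq ι] (M : Matrix ι ι ℝ) (j : ℕ) : ℝ :=
  open Classical in
  if h : M.IsHermitian ∧ j < Fintype.card ι then h.1.eigenvalues₀ ⟨j, h.2⟩ else 0

/-- The singular values of a matrix in decreasing order, numbered from `0`. -/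
def singVal {ι κ : Type*} [Fintype ι] [Fintype κ] [DecidableEq κ] (M : Matrix ι κ ℝ) (j : ℕ) :
    ℝ :=
  (Matrix.toEuclideanLin M).singularValues j

open scoped Matrix.Norms.L2Operator in
/-- The spectral norm. -/
def specNorm {ι κ : Type*} [Fintype ι] [Fintype κ] [DecidableEq κ] (M : Matrix ι κ ℝ) : ℝ := ‖M‖

/-- The columns of `Q` are orthonormal, and the `j`-th one is an eigenvector of `M` for the `j`-th
largest eigenvalue of `M`. -/
def IsLeadingEigenvectors {a k : ℕ} (M : Matrix (Fin a) (Fin a) ℝ) (Q : Matrix (Fin a) (Fin k) ℝ) :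
    Prop :=
  Qᵀ * Q = 1 ∧ ∀ j : Fin k, M *ᵥ (fun i => Q i j) = nthEig M j • (fun i => Q i j)

/-- `M` has `k` distinct positive eigenvalues: the `k` largest ones are positive and pairwise
distinct. -/
def HasDistinctPosEig {a : ℕ} (M : Matrix (Fin a) (Fin a) ℝ) (k : ℕ) : Prop :=
  (∀ j < k, 0 < nthEig M j) ∧ ∀ i j, i < j → j < k → nthEig M j < nthEig M i

/-- The distance of the column spaces of two matrices with orthonormal columns. -/
def subspaceDist {a q₁ q₂ : ℕ} (O₁ : Matrix (Fin a) (Fin q₁) ℝ) (O₂ : Matrix (Fin a) (Fin q₂) ℝ) :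
    ℝ :=
  √(1 - 1 / ((max q₁ q₂ : ℕ) : ℝ) * (O₁ * O₁ᵀ * (O₂ * O₂ᵀ)).trace)

/-! ### Probability -/

/-- `Z n = O_p(a n)`. The probability is read as an outer measure, so that `Z n` need not be
measurable. -/
def IsBigOInProb {Ω : ℕ → Type*} [∀ n, MeasurableSpace (Ω n)] (μ : ∀ n, Measure (Ω n))
    (Z : ∀ n, Ω n → ℝ) (a : ℕ → ℝ) : Prop :=
  ∀ ε : ℝ, 0 < ε → ∃ B : ℝ, ∀ᶠ n in atTop, μ n {ω | B * a n < |Z n ω|} ≤ ENNReal.ofReal ε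

/-- The `α`-mixing coefficient at lag `l` of a process on `ℤ` for which `𝓖 t` is the `σ`-field
generated by the observation at time `t`. -/
def alphaMixing {Ω : Type*} [MeasurableSpace Ω] (μ : Measure Ω) (𝓖 : ℤ → MeasurableSpace Ω)
    (l : ℕ) : ℝ :=
  sSup {x : ℝ | ∃ (i : ℤ) (A B : Set Ω),
    MeasurableSet[⨆ t ∈ Set.Iic i, 𝓖 t] A ∧ MeasurableSet[⨆ t ∈ Set.Ici (i + (l : ℤ)), 𝓖 t] B ∧
      x = |μ.real A * μ.real B - μ.real (A ∩ B)|}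

/-- `(T - h)⁻¹ ∑_{t=1}^{T-h} Cov(U_t, V_{t+h})` for vector-valued processes `U` and `V`. -/
def avgLagCov {Ω α β : Type*} [MeasurableSpace Ω] (μ : Measure Ω) (T h : ℕ)
    (U : ℤ → Ω → α → ℝ) (V : ℤ → Ω → β → ℝ) : Matrix α β ℝ :=
  Matrix.of fun a b => ((T : ℝ) - (h : ℝ))⁻¹ *
    ∑ t ∈ Finset.Icc (1 : ℤ) ((T : ℤ) - (h : ℤ)),
      cov[fun ω => U t ω a, fun ω => V (t + (h : ℤ)) ω b; μ]

/-- `(T - h)⁻¹ ∑_{t=1}^{T-h} u_t v_{t+h}'` for sequences of vectors `u` and `v`. -/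
def avgLagProd {α β : Type*} (T h : ℕ) (u : ℤ → α → ℝ) (v : ℤ → β → ℝ) : Matrix α β ℝ :=
  Matrix.of fun a b => ((T : ℝ) - (h : ℝ))⁻¹ *
    ∑ t ∈ Finset.Icc (1 : ℤ) ((T : ℤ) - (h : ℤ)), u t a * v (t + (h : ℤ)) b

/-- `∑_{h=1}^{h₀} ∑_i ∑_j Ω_{ij}(h) Ω_{ij}(h)'`, where `Ω_{ij}(h)` is the averaged lag-`h`
covariance of the columns `i` and `j` of the matrix process `W`. -/
def popM {Ω : Type*} [MeasurableSpace Ω] (μ : Measure Ω) {a b : ℕ} (T h₀ : ℕ)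
    (W : ℤ → Ω → Matrix (Fin a) (Fin b) ℝ) : Matrix (Fin a) (Fin a) ℝ :=
  ∑ h ∈ Finset.Icc 1 h₀, ∑ i : Fin b, ∑ j : Fin b,
    avgLagCov μ T h (fun t ω x => W t ω x i) (fun t ω x => W t ω x j) *
      (avgLagCov μ T h (fun t ω x => W t ω x i) (fun t ω x => W t ω x j))ᵀ

/-- The sample version of `popM`. -/
def sampleM {a b : ℕ} (T h₀ : ℕ) (w : ℤ → Matrix (Fin a) (Fin b) ℝ) :
    Matrix (Fin a) (Fin a) ℝ :=
  ∑ h ∈ Finset.Icc 1 h₀, ∑ i : Fin b, ∑ j : Fin b,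
    avgLagProd T h (fun t x => w t x i) (fun t x => w t x j) *
      (avgLagProd T h (fun t x => w t x i) (fun t x => w t x j))ᵀ

/-- Both matrices are symmetric, so that `nthEig` is never the default value at them. -/
theorem popM_isHermitian {Ω : Type*} [MeasurableSpace Ω] (μ : Measure Ω) {a b : ℕ} (T h₀ : ℕ)
    (W : ℤ → Ω → Matrix (Fin a) (Fin b) ℝ) : (popM μ T h₀ W).IsHermitian := by
  simp [popM, Matrix.IsHermitian, Matrix.conjTranspose_eq_transpose_of_trivial,
    Matrix.transpose_sum, Matrix.transpose_mul]

theorem sampleM_isHermitian {a b : ℕ} (T h₀ : ℕ) (w : ℤ → Matrix (Fin a) (Fin b) ℝ) :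
    (sampleM T h₀ w).IsHermitian := by
  simp [sampleM, Matrix.IsHermitian, Matrix.conjTranspose_eq_transpose_of_trivial,
    Matrix.transpose_sum, Matrix.transpose_mul]

/-! ### The model and the estimators -/

/-- The data of the model `Y_t = A X_t + R F_t C' + E_t`, `t = 1, …, T`: the dimensions, the
probability, the deterministic coefficients, and the random processes (extended to all of `ℤ`). -/
structure Model (k r m : ℕ) (Ω : Type*) [MeasurableSpace Ω] where
  p : ℕ
  q : ℕ
  T : ℕ
  μ : Measure Ω
  isProb : IsProbabilityMeasure μ
  A : Matrix (Fin p) (Fin m) ℝ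
  R : Matrix (Fin p) (Fin k) ℝ
  C : Matrix (Fin q) (Fin r) ℝ
  X : ℤ → Ω → Matrix (Fin m) (Fin q) ℝ
  F : ℤ → Ω → Matrix (Fin k) (Fin r) ℝ
  E : ℤ → Ω → Matrix (Fin p) (Fin q) ℝ
  measurable_X : ∀ t i j, Measurable fun ω => X t ω i j
  measurable_F : ∀ t i j, Measurable fun ω => F t ω i j
  measurable_E : ∀ t i j, Measurable fun ω => E t ω i j

namespace Model

variable {k r m : ℕ} {Ω : Type*} [MeasurableSpace Ω] (S : Model k r m Ω)

/-- `W_t = R F_t C' + E_t`. -/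
def W (t : ℤ) (ω : Ω) : Matrix (Fin S.p) (Fin S.q) ℝ := S.R * S.F t ω * S.Cᵀ + S.E t ω

/-- The observations. -/
def Y (t : ℤ) (ω : Ω) : Matrix (Fin S.p) (Fin S.q) ℝ :=
  S.A * S.X t ω + S.R * S.F t ω * S.Cᵀ + S.E t ω

/-- The times `1, …, T`. -/
def times : Finset ℤ := Finset.Icc (1 : ℤ) (S.T : ℤ)

/-- The least squares estimator of `A`. -/
def Ahat (ω : Ω) : Matrix (Fin S.p) (Fin m) ℝ :=
  ((S.T : ℝ)⁻¹ • ∑ t ∈ S.times, S.Y t ω * (S.X t ω)ᵀ) *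
    ((S.T : ℝ)⁻¹ • ∑ t ∈ S.times, S.X t ω * (S.X t ω)ᵀ)⁻¹

/-- `Ŵ_t = Y_t - Â X_t`. -/
def What (ω : Ω) (t : ℤ) : Matrix (Fin S.p) (Fin S.q) ℝ := S.Y t ω - S.Ahat ω * S.X t ω

/-- The matrices `M₁` and `M₂`, and their estimators. -/
def M₁ (h₀ : ℕ) : Matrix (Fin S.p) (Fin S.p) ℝ := popM S.μ S.T h₀ S.W

def M₂ (h₀ : ℕ) : Matrix (Fin S.q) (Fin S.q) ℝ := popM S.μ S.T h₀ fun t ω => (S.W t ω)ᵀ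

def M₁hat (h₀ : ℕ) (ω : Ω) : Matrix (Fin S.p) (Fin S.p) ℝ := sampleM S.T h₀ (S.What ω)

def M₂hat (h₀ : ℕ) (ω : Ω) : Matrix (Fin S.q) (Fin S.q) ℝ :=
  sampleM S.T h₀ fun t => (S.What ω t)ᵀ

/-- The `σ`-field generated by `(vec Y_t, vec X_t, vec F_t)`. -/
abbrev obsSigma (t : ℤ) : MeasurableSpace Ω :=
  (⨆ i, ⨆ j, MeasurableSpace.comap (fun ω => S.Y t ω i j) inferInstance) ⊔
    (⨆ i, ⨆ j, MeasurableSpace.comap (fun ω => S.X t ω i j) inferInstance) ⊔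
      (⨆ i, ⨆ j, MeasurableSpace.comap (fun ω => S.F t ω i j) inferInstance)

/-- `Σ_f(h) = (T - h)⁻¹ ∑_{t=1}^{T-h} Cov(vec F_t, vec F_{t+h})`. -/
def Sigmaf (h : ℕ) : Matrix (Fin k × Fin r) (Fin k × Fin r) ℝ :=
  avgLagCov S.μ S.T h (fun t ω x => S.F t ω x.1 x.2) (fun t ω x => S.F t ω x.1 x.2)

/-- The entries of `Σ_e = Var(vec E_t)`. -/
def errCov (t : ℤ) (a b : Fin S.p × Fin S.q) : ℝ :=
  cov[fun ω => S.E t ω a.1 a.2, fun ω => S.E t ω b.1 b.2; S.μ]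

/-- `P_t = E(X_t X_t')`. -/
def P (t : ℤ) : Matrix (Fin m) (Fin m) ℝ :=
  Matrix.of fun l l' => ∫ ω, (S.X t ω * (S.X t ω)ᵀ) l l' ∂S.μ

/-- The standing assumptions of the model: the factors have mean zero and are uncorrelated with the
regressors of the same time; the errors are white noise, uncorrelated with the factors (at all
leads and lags) and with the regressors of the same time. -/
structure Standing : Prop where
  mean_F : ∀ t ∈ S.times, ∀ i j, ∫ ω, S.F t ω i j ∂S.μ = 0
  mean_E : ∀ t ∈ S.times, ∀ i j, ∫ ω, S.E t ω i j ∂S.μ = 0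
  var_E : ∀ s ∈ S.times, ∀ t ∈ S.times, ∀ a b, S.errCov s a b = S.errCov t a b
  white_E : ∀ s ∈ S.times, ∀ t ∈ S.times, s ≠ t → ∀ i j i' j',
    cov[fun ω => S.E s ω i j, fun ω => S.E t ω i' j'; S.μ] = 0
  cov_E_F : ∀ s ∈ S.times, ∀ t ∈ S.times, ∀ i j i' j',
    cov[fun ω => S.E s ω i j, fun ω => S.F t ω i' j'; S.μ] = 0
  cov_E_X : ∀ t ∈ S.times, ∀ i j i' j',
    cov[fun ω => S.E t ω i j, fun ω => S.X t ω i' j'; S.μ] = 0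
  cov_F_X : ∀ t ∈ S.times, ∀ i j i' j',
    cov[fun ω => S.F t ω i j, fun ω => S.X t ω i' j'; S.μ] = 0

end Model

/-! ### The conditions, for a sequence of models with fixed `k`, `r`, `m` -/

section Conditions

variable {k r m : ℕ} {Ω : ℕ → Type*} [∀ n, MeasurableSpace (Ω n)]
  (S : ∀ n, Model k r m (Ω n))

/-- Summable mixing coefficients, uniformly along the sequence. -/
def Condition1 (γ : ℝ) : Prop :=
  2 < γ ∧ ∃ B : ℝ, ∀ n,
    Summable (fun l : ℕ => alphaMixing (S n).μ (S n).obsSigma (l + 1) ^ (1 - 2 / γ)) ∧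
      ∑' l : ℕ, alphaMixing (S n).μ (S n).obsSigma (l + 1) ^ (1 - 2 / γ) ≤ B

/-- `E |z|^s ≤ B`. -/
def MomentLe {Ω' : Type*} [MeasurableSpace Ω'] (μ : Measure Ω') (z : Ω' → ℝ) (s B : ℝ) : Prop :=
  Integrable (fun ω => |z ω| ^ s) μ ∧ ∫ ω, |z ω| ^ s ∂μ ≤ B

/-- Uniformly bounded moments of order `2γ`. -/
def Condition2 (γ : ℝ) : Prop :=
  ∃ B : ℝ, ∀ n, ∀ t ∈ (S n).times,
    (∀ i j, MomentLe (S n).μ (fun ω => (S n).F t ω i j) (2 * γ) B) ∧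
    (∀ l g, MomentLe (S n).μ (fun ω => (S n).X t ω l g) (2 * γ) B) ∧
    (∀ u g, MomentLe (S n).μ (fun ω => (S n).E t ω u g) (2 * γ) B)

/-- Serial dependence of the factors. The last two clauses say that the lagged autocovariances of
`F_t` have full row rank and full column rank uniformly: they bound
`∑_{h ≤ h₀} ‖(T - h)⁻¹ ∑_t Cov(F_t'v, vec F_{t+h})‖²` (Frobenius norm) from below over all unit vectors `v ∈ ℝ^k`, and
likewise for `F_t v` and unit vectors `v ∈ ℝ^r`. -/
def Condition3 (h₀ : ℕ) : Prop :=
  (∃ h : ℕ, 1 ≤ h ∧ h ≤ h₀ ∧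
    (∀ᶠ n in atTop, max k r ≤ ((S n).Sigmaf h).rank) ∧
    (fun n => specNorm ((S n).Sigmaf h)) =Θ[atTop] (fun _ => (1 : ℝ)) ∧
    (fun n => singVal ((S n).Sigmaf h) (max k r - 1)) =Θ[atTop] (fun _ => (1 : ℝ)) ∧
    (∀ᶠ n in atTop, ∀ i : Fin k, avgLagCov (S n).μ (S n).T h
      (fun t ω (x : Fin r) => (S n).F t ω i x) (fun t ω (x : Fin r) => (S n).F t ω i x) ≠ 0) ∧
    (∀ᶠ n in atTop, ∀ j : Fin r, avgLagCov (S n).μ (S n).T h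
      (fun t ω (x : Fin k) => (S n).F t ω x j) (fun t ω (x : Fin k) => (S n).F t ω x j) ≠ 0)) ∧
  ∃ c : ℝ, 0 < c ∧ ∀ᶠ n in atTop,
    c ≤ nthEig (popM (S n).μ (S n).T h₀ (S n).F) (k - 1) ∧
      c ≤ nthEig (popM (S n).μ (S n).T h₀ fun t ω => ((S n).F t ω)ᵀ) (r - 1)

/-- Second moments of the regressors. -/
def Condition4 : Prop :=
  (∀ n, ∀ t ∈ (S n).times, ((S n).P t).PosDef) ∧
  ∃ P : ℕ → Matrix (Fin m) (Fin m) ℝ, (∀ n, (P n).PosDef) ∧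
    (∀ l l', Tendsto (fun n => (((S n).T : ℝ)⁻¹ • ∑ t ∈ (S n).times, (S n).P t) l l' - P n l l')
      atTop (𝓝 0)) ∧
    (fun n => nthEig (P n) (m - 1)) =Θ[atTop] (fun n => ((S n).q : ℝ))

/-- Bounded error covariances. -/
def Condition5 : Prop :=
  ∃ B : ℝ, ∀ n, ∀ t ∈ (S n).times, ∀ a b, |(S n).errCov t a b| ≤ B

/-- Strength of the row factors and of the column factors. -/
def Condition6 (δ₁ δ₂ : ℝ) : Prop :=
  0 ≤ δ₁ ∧ δ₁ ≤ 1 ∧ 0 ≤ δ₂ ∧ δ₂ ≤ 1 ∧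
    (fun n => specNorm (S n).R ^ 2) =Θ[atTop] (fun n => ((S n).p : ℝ) ^ (1 - δ₁)) ∧
    (fun n => singVal (S n).R (k - 1) ^ 2) =Θ[atTop] (fun n => ((S n).p : ℝ) ^ (1 - δ₁)) ∧
    (fun n => specNorm (S n).C ^ 2) =Θ[atTop] (fun n => ((S n).q : ℝ) ^ (1 - δ₂)) ∧
    (fun n => singVal (S n).C (r - 1) ^ 2) =Θ[atTop] (fun n => ((S n).q : ℝ) ^ (1 - δ₂))

/-- `M₁` and `M₂` have `k` and `r` distinct positive eigenvalues. -/
def Condition7 (h₀ : ℕ) : Prop :=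
  ∀ᶠ n in atTop, HasDistinctPosEig ((S n).M₁ h₀) k ∧ HasDistinctPosEig ((S n).M₂ h₀) r

end Conditions

end MatFactor

end

/-!
The residual `Ŵ_t - W_t = (A - Â) X_t` is small because every sample second moment involved is an
average of products of `α`-mixing variables: by Davydov's inequality its variance is `O(1 / T)`,
uniformly over entries. The white noise `E_t` drops out of the lagged autocovariances, so `M₁` has
rank at most `k`, the `k`-th eigenvalue is at least a multiple of the squared strength
`(p ^ (1 - δ₁) q ^ (1 - δ₂))²`, and the others vanish. A perturbation bound of Davis–Kahan type
then turns the error `‖M̂₁ - M₁‖` into a bound for the distance of the eigenspaces. All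
probabilistic input enters through one random variable with bounded mean; on the event that it is
at most `K`, the argument is deterministic. Transposing the process gives the result for `M₂`.
-/

noncomputable section

namespace MatFactor

/-! ### Eigenvalues and quadratic forms -/

section Spectral

variable {E : Type*} [NormedAddCommGroup E] [InnerProductSpace ℝ E] [FiniteDimensional ℝ E]
  {n k : ℕ} {T : E →ₗ[ℝ] E}

theorem inner_map_self_eq_sum_eigenvalues (hT : T.IsSymmetric)
    (hn : Module.finrank ℝ E = n) (x : E) :
    inner ℝ x (T x) = ∑ i, hT.eigenvalues hn i * inner ℝ (hT.eigenvectorBasis hn i) x ^ 2 := by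
  rw [← (hT.eigenvectorBasis hn).sum_inner_mul_inner x (T x)]
  refine Finset.sum_congr rfl fun i _ => ?_
  rw [← hT, hT.apply_eigenvectorBasis, real_inner_comm]
  simp only [RCLike.ofReal_real_eq_id, id, real_inner_smul_left]
  ring

theorem mul_norm_sq_le_inner_map_self (hT : T.IsSymmetric) (hn : Module.finrank ℝ E = n) {c : ℝ}
    (hc : ∀ i, c ≤ hT.eigenvalues hn i) (x : E) : c * ‖x‖ ^ 2 ≤ inner ℝ x (T x) := by
  rw [inner_map_self_eq_sum_eigenvalues hT hn,
    ← (hT.eigenvectorBasis hn).sum_sq_inner_right x, Finset.mul_sum]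
  exact Finset.sum_le_sum fun i _ => mul_le_mul_of_nonneg_right (hc i) (sq_nonneg _)

theorem le_eigenvalues_of_le_inner_map_self (hT : T.IsSymmetric) (hn : Module.finrank ℝ E = n)
    (L : (Fin k → ℝ) →ₗ[ℝ] E) (hL : Function.Injective L) {s : ℝ}
    (hs : ∀ z, s * ‖L z‖ ^ 2 ≤ inner ℝ (L z) (T (L z))) (j : Fin n) (hj : (j : ℕ) < k) :
    s ≤ hT.eigenvalues hn j := by
  let b := hT.eigenvectorBasis hn
  let φ : (Fin k → ℝ) →ₗ[ℝ] (Fin j → ℝ) :=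
    LinearMap.pi fun i => (innerSL ℝ (b (Fin.castLE j.2.le i))).toLinearMap ∘ₗ L
  have hker : LinearMap.ker φ ≠ ⊥ := LinearMap.ker_ne_bot_of_finrank_lt (by simpa using hj)
  obtain ⟨z, hz, hz0⟩ := (Submodule.ne_bot_iff _).1 hker
  have hLz : 0 < ‖L z‖ ^ 2 := by
    have : L z ≠ 0 := fun h => hz0 (hL (by simpa using h))
    positivity
  have horth : ∀ i : Fin n, i < j → inner ℝ (b i) (L z) = 0 := fun i hi =>
    congrFun (LinearMap.mem_ker.1 hz) ⟨i, hi⟩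
  refine le_of_mul_le_mul_right ((hs z).trans ?_) hLz
  rw [inner_map_self_eq_sum_eigenvalues hT hn, ← b.sum_sq_inner_right (L z), Finset.mul_sum]
  refine Finset.sum_le_sum fun i _ => ?_
  rcases lt_or_ge i j with hi | hi
  · have hi0 : inner ℝ (hT.eigenvectorBasis hn i) (L z) = 0 := horth i hi
    simp [b, hi0]
  · exact mul_le_mul_of_nonneg_right (hT.eigenvalues_antitone hn hi) (sq_nonneg _)

theorem sum_mul_le_sum_of_antitone {n k : ℕ} (hk : k ≤ n) {x w : Fin n → ℝ} (hx : Antitone x)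
    (hw_nonneg : ∀ i, 0 ≤ w i) (hw_le : ∀ i, w i ≤ 1) (hw_sum : ∑ i, w i = k) :
    ∑ i, x i * w i ≤ ∑ j : Fin k, x (Fin.castLE hk j) := by
  rcases Nat.eq_zero_or_pos k with rfl | hk0
  · have hw : w = 0 := by
      simpa [Finset.sum_eq_zero_iff_of_nonneg, hw_nonneg, funext_iff] using hw_sum
    simp [hw]
  let top : Fin n := ⟨k - 1, by lia⟩
  let u : Fin n → ℝ := fun i => if (i : ℕ) < k then 1 else 0
  have hu : ∀ f : Fin n → ℝ, ∑ j : Fin k, f (Fin.castLE hk j) = ∑ i, f i * u i := fun f => by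
    simp only [u, mul_ite, mul_one, mul_zero, ← Finset.sum_filter]
    refine Finset.sum_bij (fun j _ => Fin.castLE hk j) (by simp) (by simp) (fun i hi => ?_)
      (by simp)
    exact ⟨⟨i, by simpa using hi⟩, by simp, rfl⟩
  have hu_sum : ∑ i, u i = k := by simpa using (hu fun _ => 1).symm
  have hterm : ∀ i, 0 ≤ (x i - x top) * (u i - w i) := fun i => by
    rcases lt_or_ge (i : ℕ) k with hi | hi
    · have hit : x top ≤ x i := hx (Fin.le_def.2 (by simp only [top]; lia))
      exact mul_nonneg (sub_nonneg.2 hit) (by simpa [u, hi] using hw_le i)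
    · have hit : x i ≤ x top := hx (Fin.le_def.2 (by simp only [top]; lia))
      exact mul_nonneg_of_nonpos_of_nonpos (sub_nonpos.2 hit)
        (by simpa [u, hi.not_gt] using hw_nonneg i)
  have hsum := Finset.sum_nonneg fun i (_ : i ∈ Finset.univ) => hterm i
  simp only [sub_mul, mul_sub, Finset.sum_sub_distrib, ← Finset.mul_sum, hw_sum, hu_sum] at hsum
  rw [hu]
  linarith

-- Ky Fan's inequality: the squared coordinates of the `v j` give each eigenvalue a weight in
-- `[0, 1]`, with total weight `k`.
theorem sum_inner_map_self_le_sum_eigenvalues (hT : T.IsSymmetric)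
    (hn : Module.finrank ℝ E = n) (hk : k ≤ n) {v : Fin k → E} (hv : Orthonormal ℝ v) :
    ∑ j, inner ℝ (v j) (T (v j)) ≤ ∑ j : Fin k, hT.eigenvalues hn (Fin.castLE hk j) := by
  let b := hT.eigenvectorBasis hn
  have hw_le : ∀ i, ∑ j, inner ℝ (b i) (v j) ^ 2 ≤ 1 := fun i => by
    simpa [real_inner_comm] using hv.sum_inner_products_le (b i) (s := Finset.univ)
  have hw_sum : ∑ i, ∑ j, inner ℝ (b i) (v j) ^ 2 = k := by
    rw [Finset.sum_comm]
    simp [b.sum_sq_inner_right, hv.1]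
  have hleft : ∑ j, inner ℝ (v j) (T (v j)) =
      ∑ i, hT.eigenvalues hn i * ∑ j, inner ℝ (b i) (v j) ^ 2 := by
    simp only [inner_map_self_eq_sum_eigenvalues hT hn, Finset.mul_sum, b]
    exact Finset.sum_comm
  rw [hleft]
  exact sum_mul_le_sum_of_antitone hk (hT.eigenvalues_antitone hn)
    (fun _ => Finset.sum_nonneg fun _ _ => sq_nonneg _) hw_le hw_sum

end Spectral

section Matrix

variable {ι κ α : Type*} [Fintype ι] [Fintype κ] [Fintype α] {a k : ℕ}

theorem inner_toLp (x y : ι → ℝ) : inner ℝ (WithLp.toLp 2 x) (WithLp.toLp 2 y) = x ⬝ᵥ y := by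
  simp [EuclideanSpace.inner_eq_star_dotProduct, dotProduct_comm]

theorem norm_toLp_sq (x : ι → ℝ) : ‖WithLp.toLp 2 x‖ ^ 2 = x ⬝ᵥ x := by
  rw [← inner_toLp, real_inner_self_eq_norm_sq]

theorem nthEig_eq_eigenvalues {M : Matrix (Fin a) (Fin a) ℝ} (hM : M.IsHermitian) {j : ℕ}
    (hj : j < Fintype.card (Fin a)) :
    nthEig M j = (Matrix.isSymmetric_toEuclideanLin_iff.mpr hM).eigenvalues
      finrank_euclideanSpace ⟨j, hj⟩ := by
  rw [nthEig, dif_pos ⟨hM, hj⟩]; rfl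

theorem le_nthEig {M : Matrix (Fin a) (Fin a) ℝ} (hM : M.IsHermitian)
    {L : Matrix (Fin a) (Fin k) ℝ} (hL : Function.Injective L.mulVec) {s : ℝ}
    (hs : ∀ z, s * ((L *ᵥ z) ⬝ᵥ (L *ᵥ z)) ≤ (L *ᵥ z) ⬝ᵥ (M *ᵥ (L *ᵥ z))) {j : ℕ} (hj : j < k) :
    s ≤ nthEig M j := by
  have hka : k ≤ a := by
    simpa using LinearMap.finrank_le_finrank_of_injective (f := L.mulVecLin) hL
  have hj' : j < Fintype.card (Fin a) := by simpa using hj.trans_le hka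
  rw [nthEig_eq_eigenvalues hM hj']
  refine le_eigenvalues_of_le_inner_map_self _ _
    ((WithLp.linearEquiv 2 ℝ (Fin a → ℝ)).symm.toLinearMap ∘ₗ L.mulVecLin) ?_ ?_ ⟨j, hj'⟩ hj
  · exact (WithLp.linearEquiv 2 ℝ (Fin a → ℝ)).symm.injective.comp hL
  · intro z
    have := hs z
    rwa [← norm_toLp_sq, ← inner_toLp] at this

theorem nthEig_mul_dotProduct_self_le {M : Matrix (Fin k) (Fin k) ℝ} (hM : M.IsHermitian)
    (z : Fin k → ℝ) : nthEig M (k - 1) * (z ⬝ᵥ z) ≤ z ⬝ᵥ (M *ᵥ z) := by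
  rcases Nat.eq_zero_or_pos k with rfl | hk
  · simp [dotProduct]
  have hj : k - 1 < Fintype.card (Fin k) := by rw [Fintype.card_fin]; lia
  have := mul_norm_sq_le_inner_map_self (Matrix.isSymmetric_toEuclideanLin_iff.mpr hM)
    finrank_euclideanSpace (c := nthEig M (k - 1)) (fun i => ?_) (WithLp.toLp 2 z)
  · rwa [norm_toLp_sq, Matrix.toLpLin_toLp, Matrix.toLin'_apply, inner_toLp] at this
  · rw [nthEig_eq_eigenvalues hM hj]
    exact LinearMap.IsSymmetric.eigenvalues_antitone _ _
      (Fin.le_def.2 (Nat.le_sub_one_of_lt (i.2.trans_eq (Fintype.card_fin k))))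

theorem singVal_sq_mul_dotProduct_self_le (M : Matrix ι (Fin k) ℝ) (z : Fin k → ℝ) :
    singVal M (k - 1) ^ 2 * (z ⬝ᵥ z) ≤ (M *ᵥ z) ⬝ᵥ (M *ᵥ z) := by
  rcases Nat.eq_zero_or_pos k with rfl | hk
  · simp [dotProduct, Matrix.mulVec]
  rw [singVal, LinearMap.sq_singularValues_of_lt _ (n := k) (by simp) (Nat.sub_one_lt hk.ne')]
  have := mul_norm_sq_le_inner_map_self
    (Matrix.toEuclideanLin M).isSymmetric_adjoint_comp_self (n := k) (by simp)
    (fun i => LinearMap.IsSymmetric.eigenvalues_antitone _ _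
      (Fin.le_def.2 (Nat.le_sub_one_of_lt i.2) :
        i ≤ ⟨k - 1, Nat.sub_one_lt hk.ne'⟩)) (WithLp.toLp 2 z)
  rwa [norm_toLp_sq, LinearMap.comp_apply, LinearMap.adjoint_inner_right,
    Matrix.toLpLin_toLp, Matrix.toLin'_apply, inner_toLp] at this

theorem mulVec_injective_of_singVal_pos {M : Matrix ι (Fin k) ℝ} (hM : 0 < singVal M (k - 1)) :
    Function.Injective M.mulVec := by
  refine (injective_iff_map_eq_zero M.mulVecLin).2 fun z hz => ?_
  have h := singVal_sq_mul_dotProduct_self_le M z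
  rw [show M *ᵥ z = 0 from hz, dotProduct_zero, ← norm_toLp_sq] at h
  have : ‖WithLp.toLp 2 z‖ ^ 2 ≤ 0 := nonpos_of_mul_nonpos_right h (by positivity)
  simpa using this

/-! ### The Frobenius norm -/

open scoped Matrix.Norms.L2Operator in
theorem sum_sq_le_specNorm_sq (M : Matrix ι (Fin k) ℝ) :
    ∑ i, ∑ j, M i j ^ 2 ≤ k * specNorm M ^ 2 := by
  rw [Finset.sum_comm]
  calc _ ≤ ∑ j : Fin k, specNorm M ^ 2 := Finset.sum_le_sum fun j _ => by
        have h := pow_le_pow_left₀ (norm_nonneg _)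
          (Matrix.l2_opNorm_mulVec M (EuclideanSpace.single j (1 : ℝ))) 2
        rw [EuclideanSpace.norm_sq_eq] at h
        simpa [specNorm] using h
    _ = _ := by simp

open scoped Matrix.Norms.Frobenius

theorem frobenius_norm_sq (M : Matrix ι κ ℝ) : ‖M‖ ^ 2 = ∑ i, ∑ j, M i j ^ 2 := by
  rw [Matrix.frobenius_norm_def, ← Real.sqrt_eq_rpow, Real.sq_sqrt (by positivity)]
  simp

theorem frobenius_norm_sq_le_specNorm_sq (M : Matrix ι (Fin k) ℝ) :
    ‖M‖ ^ 2 ≤ k * specNorm M ^ 2 :=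
  (frobenius_norm_sq M).trans_le (sum_sq_le_specNorm_sq M)

theorem frobenius_norm_sq_eq_trace (M : Matrix ι κ ℝ) : ‖M‖ ^ 2 = (Mᵀ * M).trace := by
  rw [frobenius_norm_sq, Finset.sum_comm]
  simp [Matrix.trace, Matrix.mul_apply, sq]

theorem trace_transpose_mul_le (M N : Matrix ι κ ℝ) : (Mᵀ * N).trace ≤ ‖M‖ * ‖N‖ := by
  have h := Real.sum_mul_le_sqrt_mul_sqrt Finset.univ (fun e : ι × κ => M e.1 e.2)
    fun e => N e.1 e.2
  simp only [Fintype.sum_prod_type, ← frobenius_norm_sq, Real.sqrt_sq (norm_nonneg _)] at h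
  rw [Finset.sum_comm] at h
  simpa [Matrix.trace, Matrix.mul_apply] using h

theorem norm_sum_mul_transpose_sub_le {σ : Type*} (s : Finset σ) (G H : σ → Matrix ι κ ℝ) {a b : ℝ}
    (ha : 0 ≤ a) (hb : 0 ≤ b) (hG : ∑ e ∈ s, ‖G e‖ ^ 2 ≤ b ^ 2)
    (hH : ∑ e ∈ s, ‖H e - G e‖ ^ 2 ≤ a ^ 2) :
    ‖∑ e ∈ s, H e * (H e)ᵀ - ∑ e ∈ s, G e * (G e)ᵀ‖ ≤ a ^ 2 + 2 * a * b := by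
  have hterm : ∀ e, ‖H e * (H e)ᵀ - G e * (G e)ᵀ‖ ≤
      ‖H e - G e‖ ^ 2 + 2 * (‖H e - G e‖ * ‖G e‖) := fun e => by
    have hsplit : H e * (H e)ᵀ - G e * (G e)ᵀ = (H e - G e) * (H e - G e)ᵀ +
        ((H e - G e) * (G e)ᵀ + G e * (H e - G e)ᵀ) := by
      simp only [Matrix.transpose_sub, Matrix.sub_mul, Matrix.mul_sub]
      abel
    have h₁ := Matrix.frobenius_norm_mul (H e - G e) (H e - G e)ᵀ
    have h₂ := Matrix.frobenius_norm_mul (H e - G e) (G e)ᵀ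
    have h₃ := Matrix.frobenius_norm_mul (G e) (H e - G e)ᵀ
    rw [Matrix.frobenius_norm_transpose] at h₁ h₂ h₃
    rw [hsplit]
    refine (norm_add_le _ _).trans ((add_le_add_right (norm_add_le _ _) _).trans ?_)
    linarith
  have hcross : ∑ e ∈ s, ‖H e - G e‖ * ‖G e‖ ≤ a * b :=
    (Real.sum_mul_le_sqrt_mul_sqrt s _ _).trans <| mul_le_mul (Real.sqrt_le_iff.2 ⟨ha, hH⟩)
      (Real.sqrt_le_iff.2 ⟨hb, hG⟩) (Real.sqrt_nonneg _) ha
  rw [← Finset.sum_sub_distrib]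
  refine (norm_sum_le_of_le s fun e _ => hterm e).trans ?_
  rw [Finset.sum_add_distrib, ← Finset.mul_sum]
  linarith

end Matrix

/-! ### Perturbation of leading eigenvectors -/

section Perturbation

open scoped Matrix.Norms.Frobenius

variable {a k : ℕ} {M M' : Matrix (Fin a) (Fin a) ℝ} {Q Q' : Matrix (Fin a) (Fin k) ℝ}

theorem dotProduct_transpose_mulVec_self_le {ι : Type*} [Fintype ι] {Q : Matrix ι (Fin k) ℝ}
    (hQ : Qᵀ * Q = 1) (x : ι → ℝ) : (Qᵀ *ᵥ x) ⬝ᵥ (Qᵀ *ᵥ x) ≤ x ⬝ᵥ x := by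
  have hproj : (Q *ᵥ (Qᵀ *ᵥ x)) ⬝ᵥ x = (Qᵀ *ᵥ x) ⬝ᵥ (Qᵀ *ᵥ x) := by
    rw [← Matrix.vecMul_transpose, ← Matrix.dotProduct_mulVec]
  have hnorm : (Q *ᵥ (Qᵀ *ᵥ x)) ⬝ᵥ (Q *ᵥ (Qᵀ *ᵥ x)) = (Qᵀ *ᵥ x) ⬝ᵥ (Qᵀ *ᵥ x) := by
    rw [Matrix.dotProduct_mulVec, Matrix.vecMul_mulVec, ← Matrix.dotProduct_mulVec, hQ,
      Matrix.one_mulVec]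
  have h : 0 ≤ (x - Q *ᵥ (Qᵀ *ᵥ x)) ⬝ᵥ (x - Q *ᵥ (Qᵀ *ᵥ x)) := by
    rw [← norm_toLp_sq]; positivity
  rw [sub_dotProduct, dotProduct_sub, dotProduct_sub, hnorm, dotProduct_comm x (Q *ᵥ _), hproj] at h
  linarith

theorem orthonormal_toLp_transpose (hQ : Qᵀ * Q = 1) :
    Orthonormal ℝ fun j => WithLp.toLp 2 (Qᵀ j) := by
  rw [orthonormal_iff_ite]
  intro i j
  rw [inner_toLp, ← Matrix.one_apply, ← hQ]
  rfl

theorem card_le_of_transpose_mul_self (hQ : Qᵀ * Q = 1) : k ≤ a := by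
  simpa using (orthonormal_toLp_transpose hQ).linearIndependent.fintype_card_le_finrank

theorem trace_transpose_mul_mul_le_sum_nthEig (hM : M.IsHermitian) (hQ : Qᵀ * Q = 1) :
    (Qᵀ * M * Q).trace ≤ ∑ j : Fin k, nthEig M j := by
  have hka := card_le_of_transpose_mul_self hQ
  have h := sum_inner_map_self_le_sum_eigenvalues (Matrix.isSymmetric_toEuclideanLin_iff.mpr hM)
    finrank_euclideanSpace (hka.trans_eq (Fintype.card_fin a).symm) (orthonormal_toLp_transpose hQ)
  simp only [Matrix.toLpLin_toLp, Matrix.toLin'_apply, inner_toLp] at h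
  refine (h.trans_eq (Finset.sum_congr rfl fun j _ => ?_)).trans' (le_of_eq ?_)
  · exact (nthEig_eq_eigenvalues hM _).symm
  · simp only [Matrix.trace, Matrix.diag_apply, Matrix.mul_assoc]
    rfl

theorem IsLeadingEigenvectors.mul_eq (h : IsLeadingEigenvectors M Q) :
    M * Q = Q * Matrix.diagonal fun j : Fin k => nthEig M j := by
  ext i j
  rw [Matrix.mul_diagonal, mul_comm]
  exact congrFun (h.2 j) i

theorem IsLeadingEigenvectors.trace_eq (h : IsLeadingEigenvectors M Q) :
    (Qᵀ * M * Q).trace = ∑ j : Fin k, nthEig M j := by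
  rw [Matrix.mul_assoc, h.mul_eq, ← Matrix.mul_assoc, h.1, Matrix.one_mul, Matrix.trace_diagonal]

theorem IsLeadingEigenvectors.mul_transpose_mul_eq (h : IsLeadingEigenvectors M Q)
    (hM : M.rank ≤ k) (hpos : ∀ j : Fin k, nthEig M j ≠ 0) : Q * Qᵀ * M = M := by
  have hQM : Q = M * (Q * Matrix.diagonal fun j : Fin k => (nthEig M j)⁻¹) := by
    rw [← Matrix.mul_assoc, h.mul_eq, Matrix.mul_assoc, Matrix.diagonal_mul_diagonal]
    simp [hpos]
  have hle : LinearMap.range Q.mulVecLin ≤ LinearMap.range M.mulVecLin := by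
    conv_lhs => rw [hQM, Matrix.mulVecLin_mul]
    exact LinearMap.range_comp_le_range _ _
  have hQrank : k ≤ Module.finrank ℝ (LinearMap.range Q.mulVecLin) := by
    have := (Matrix.rank_mul_le_right Qᵀ Q).trans_eq rfl
    rwa [h.1, Matrix.rank_one, Fintype.card_fin] at this
  have hrange := Submodule.eq_of_le_of_finrank_le hle (hM.trans hQrank)
  refine Matrix.ext_of_mulVec_single fun i => ?_
  have hmem : M *ᵥ Pi.single i 1 ∈ LinearMap.range Q.mulVecLin :=
    hrange ▸ LinearMap.mem_range_self M.mulVecLin _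
  obtain ⟨z, hz⟩ := hmem
  rw [← Matrix.mulVec_mulVec, ← hz, Matrix.mulVecLin_apply, Matrix.mulVec_mulVec,
    Matrix.mul_assoc, h.1, Matrix.mul_one]

theorem IsLeadingEigenvectors.eq_mul_diagonal_mul_transpose (h : IsLeadingEigenvectors M Q)
    (hM : M.IsHermitian) (hrank : M.rank ≤ k) (hpos : ∀ j : Fin k, nthEig M j ≠ 0) :
    M = Q * Matrix.diagonal (fun j : Fin k => nthEig M j) * Qᵀ := by
  have hMT : Mᵀ = M := hM
  have := congrArg Matrix.transpose (h.mul_transpose_mul_eq hrank hpos)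
  rw [Matrix.transpose_mul, Matrix.transpose_mul, Matrix.transpose_transpose, hMT] at this
  rw [← h.mul_eq, Matrix.mul_assoc, this]

theorem norm_projection_sub_sq (hQ : Qᵀ * Q = 1) (hQ' : Q'ᵀ * Q' = 1) :
    ‖Q * Qᵀ - Q' * Q'ᵀ‖ ^ 2 = 2 * (k - (Q' * Q'ᵀ * (Q * Qᵀ)).trace) := by
  have hidem : ∀ {V : Matrix (Fin a) (Fin k) ℝ}, Vᵀ * V = 1 →
      (V * Vᵀ * (V * Vᵀ)).trace = k := fun {V} hV => by
    rw [Matrix.mul_assoc, ← Matrix.mul_assoc Vᵀ, hV, Matrix.one_mul, Matrix.trace_mul_comm, hV]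
    simp
  rw [frobenius_norm_sq_eq_trace]
  simp only [Matrix.transpose_sub, Matrix.transpose_mul, Matrix.transpose_transpose,
    Matrix.sub_mul, Matrix.mul_sub, Matrix.trace_sub, hidem hQ, hidem hQ']
  rw [Matrix.trace_mul_comm (Q * Qᵀ)]
  ring

theorem mul_sub_trace_projections_le (hM : M.IsHermitian) (hrank : M.rank ≤ k) {s : ℝ} (hs : 0 < s)
    (hsM : ∀ j < k, s ≤ nthEig M j) (hQ : IsLeadingEigenvectors M Q) (hQ' : Q'ᵀ * Q' = 1) :
    s * (k - (Q' * Q'ᵀ * (Q * Qᵀ)).trace) ≤ ((Q * Qᵀ - Q' * Q'ᵀ) * M).trace := by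
  let g : Fin k → ℝ := fun j => ((Q'ᵀ * Q)ᵀ * (Q'ᵀ * Q)) j j
  have hg : ∀ j, g j ≤ 1 := fun j => by
    have hone : Qᵀ j ⬝ᵥ Qᵀ j = 1 := by
      simpa [Matrix.mul_apply, dotProduct] using congrFun₂ hQ.1 j j
    exact (dotProduct_transpose_mulVec_self_le hQ' (Qᵀ j)).trans_eq hone
  have hG : (Q'ᵀ * Q)ᵀ * (Q'ᵀ * Q) = Qᵀ * (Q' * Q'ᵀ * Q) := by
    simp only [Matrix.transpose_mul, Matrix.transpose_transpose, Matrix.mul_assoc]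
  have htrace : (Q' * Q'ᵀ * (Q * Qᵀ)).trace = ∑ j, g j := by
    rw [← Matrix.mul_assoc, Matrix.trace_mul_comm, ← hG]
    rfl
  have htraceM : (Q' * Q'ᵀ * M).trace = ∑ j, g j * nthEig M j := by
    have hdecomp := hQ.eq_mul_diagonal_mul_transpose hM hrank fun j =>
      (hs.trans_le (hsM j j.2)).ne'
    conv_lhs => rw [hdecomp, ← Matrix.mul_assoc, Matrix.trace_mul_comm,
      ← Matrix.mul_assoc (Q' * Q'ᵀ), ← Matrix.mul_assoc, ← hG]
    simp only [Matrix.trace, Matrix.diag_apply, Matrix.mul_diagonal, g]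
  have hQM : (Q * Qᵀ * M).trace = ∑ j : Fin k, nthEig M j := by
    rw [Matrix.mul_assoc, Matrix.trace_mul_comm, hQ.trace_eq]
  rw [Matrix.sub_mul, Matrix.trace_sub, hQM, htraceM, htrace, ← Finset.sum_sub_distrib]
  have hcard : (k : ℝ) - ∑ j, g j = ∑ j, (1 - g j) := by simp
  rw [hcard, Finset.mul_sum]
  refine Finset.sum_le_sum fun j _ => ?_
  have := mul_le_mul_of_nonneg_right (hsM j j.2) (sub_nonneg.2 (hg j))
  linarith

theorem trace_projection_sub_mul_nonpos (hM' : M'.IsHermitian) (hQ : Qᵀ * Q = 1)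
    (hQ' : IsLeadingEigenvectors M' Q') : ((Q * Qᵀ - Q' * Q'ᵀ) * M').trace ≤ 0 := by
  have hcyc : ∀ V : Matrix (Fin a) (Fin k) ℝ, (V * Vᵀ * M').trace = (Vᵀ * M' * V).trace :=
    fun V => by rw [Matrix.mul_assoc, Matrix.trace_mul_comm]
  rw [Matrix.sub_mul, Matrix.trace_sub, hcyc, hcyc, hQ'.trace_eq]
  exact sub_nonpos.2 (trace_transpose_mul_mul_le_sum_nthEig hM' hQ)

-- A version of the Davis–Kahan theorem, after Yu, Wang and Samworth: with `P`, `P'` the two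
-- projections and `x = k - tr (P' P)`, both `s x ≤ tr ((P - P') (M - M'))` and
-- `‖P - P'‖² = 2 x` hold, so Cauchy–Schwarz needs no smallness of `M' - M`.
theorem subspaceDist_le (hk : 1 ≤ k) (hM : M.IsHermitian) (hrank : M.rank ≤ k) {s : ℝ}
    (hs : 0 < s) (hsM : ∀ j < k, s ≤ nthEig M j) (hM' : M'.IsHermitian)
    (hQ : IsLeadingEigenvectors M Q) (hQ' : IsLeadingEigenvectors M' Q') :
    subspaceDist Q' Q ≤ 2 / s * ‖M' - M‖ := by
  set x : ℝ := k - (Q' * Q'ᵀ * (Q * Qᵀ)).trace with hx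
  have hnorm : ‖Q * Qᵀ - Q' * Q'ᵀ‖ ^ 2 = 2 * x := norm_projection_sub_sq hQ.1 hQ'.1
  have hx0 : 0 ≤ x := by nlinarith [sq_nonneg ‖Q * Qᵀ - Q' * Q'ᵀ‖]
  have hgap : s * x ≤ ‖Q * Qᵀ - Q' * Q'ᵀ‖ * ‖M' - M‖ := calc
    s * x ≤ ((Q * Qᵀ - Q' * Q'ᵀ) * M).trace :=
      mul_sub_trace_projections_le hM hrank hs hsM hQ hQ'.1
    _ ≤ ((Q * Qᵀ - Q' * Q'ᵀ)ᵀ * (M - M')).trace := by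
      have := trace_projection_sub_mul_nonpos hM' hQ.1 hQ'
      simp only [Matrix.transpose_sub, Matrix.transpose_mul, Matrix.transpose_transpose,
        Matrix.mul_sub _ M, Matrix.trace_sub]
      linarith
    _ ≤ _ := by
      rw [norm_sub_rev M']
      exact trace_transpose_mul_le _ _
  have hsqrt : s * √x ≤ 2 * ‖M' - M‖ := by
    have hroot : ‖Q * Qᵀ - Q' * Q'ᵀ‖ ≤ 2 * √x := by
      refine abs_le_of_sq_le_sq' ?_ (by positivity) |>.2
      rw [hnorm, mul_pow, Real.sq_sqrt hx0]
      linarith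
    rcases hx0.eq_or_lt with h0 | h0
    · rw [← h0, Real.sqrt_zero, mul_zero]; positivity
    · refine le_of_mul_le_mul_right ?_ (Real.sqrt_pos.2 h0)
      calc s * √x * √x = s * x := by rw [mul_assoc, Real.mul_self_sqrt hx0]
        _ ≤ 2 * √x * ‖M' - M‖ := hgap.trans (mul_le_mul_of_nonneg_right hroot (norm_nonneg _))
        _ = _ := by ring
  have hk' : (1 : ℝ) ≤ k := by exact_mod_cast hk
  have hdist : subspaceDist Q' Q ≤ √x := by
    refine Real.sqrt_le_sqrt ?_
    have : 1 - 1 / ((max k k : ℕ) : ℝ) * (Q' * Q'ᵀ * (Q * Qᵀ)).trace = x / k := by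
      rw [max_self, hx]
      field_simp
    rw [this]
    exact div_le_self hx0 hk'
  rw [div_mul_eq_mul_div, le_div_iff₀ hs, mul_comm]
  exact (mul_le_mul_of_nonneg_left hdist hs.le).trans hsqrt

end Perturbation

/-! ### Bounds in mean and bounds on moments -/

/-- `f` is integrable with integral at most `c`: the form in which the estimation errors are
bounded, chosen so that integrability is carried along with the bound. -/
def MeanLe {Ω : Type*} [MeasurableSpace Ω] (μ : Measure Ω) (f : Ω → ℝ) (c : ℝ) : Prop :=
  Integrable f μ ∧ ∫ ω, f ω ∂μ ≤ c

namespace MeanLe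

variable {Ω ι : Type*} [MeasurableSpace Ω] {μ : Measure Ω} {f g : Ω → ℝ} {c d a : ℝ}

theorem mono (hf : MeanLe μ f c) (hcd : c ≤ d) : MeanLe μ f d :=
  ⟨hf.1, hf.2.trans hcd⟩

theorem of_abs_le (hg : MeanLe μ g c) (hf : AEStronglyMeasurable f μ) (h : ∀ ω, |f ω| ≤ g ω) :
    MeanLe μ f c := by
  have hfi : Integrable f μ := Integrable.mono' hg.1 hf (Eventually.of_forall h)
  exact ⟨hfi, (integral_mono hfi hg.1 fun ω => (le_abs_self _).trans (h ω)).trans hg.2⟩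

theorem one [IsProbabilityMeasure μ] : MeanLe μ (fun _ => 1) 1 :=
  ⟨integrable_const 1, by simp⟩

theorem add (hf : MeanLe μ f c) (hg : MeanLe μ g d) : MeanLe μ (fun ω => f ω + g ω) (c + d) :=
  ⟨hf.1.add hg.1, (integral_add hf.1 hg.1).trans_le (add_le_add hf.2 hg.2)⟩

theorem const_mul (hf : MeanLe μ f c) (ha : 0 ≤ a) : MeanLe μ (fun ω => a * f ω) (a * c) :=
  ⟨hf.1.const_mul a,
    (integral_const_mul a f).trans_le (mul_le_mul_of_nonneg_left hf.2 ha)⟩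

theorem sum {s : Finset ι} {f : ι → Ω → ℝ} {c : ι → ℝ} (hf : ∀ i ∈ s, MeanLe μ (f i) (c i)) :
    MeanLe μ (fun ω => ∑ i ∈ s, f i ω) (∑ i ∈ s, c i) :=
  ⟨integrable_finsetSum _ fun i hi => (hf i hi).1,
    (integral_finsetSum _ fun i hi => (hf i hi).1).trans_le
      (Finset.sum_le_sum fun i hi => (hf i hi).2)⟩

theorem measure_lt_le [IsFiniteMeasure μ] (hf : MeanLe μ f c) (hf₀ : ∀ ω, 0 ≤ f ω) (hc : 0 < c)
    {ε : ℝ} (hε : 0 < ε) : μ {ω | c / ε < f ω} ≤ ENNReal.ofReal ε := by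
  have hmarkov : c / ε * μ.real {ω | c / ε ≤ f ω} ≤ c / ε * ε := by
    rw [div_mul_cancel₀ _ hε.ne']
    exact (mul_meas_ge_le_integral_of_nonneg (Eventually.of_forall hf₀) hf.1 (c / ε)).trans hf.2
  calc μ {ω | c / ε < f ω} ≤ μ {ω | c / ε ≤ f ω} :=
      measure_mono fun ω (hω : c / ε < f ω) => hω.le
    _ = ENNReal.ofReal (μ.real {ω | c / ε ≤ f ω}) := by simp
    _ ≤ ENNReal.ofReal ε :=
      ENNReal.ofReal_le_ofReal (le_of_mul_le_mul_left hmarkov (by positivity))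

end MeanLe

theorem isBigOInProb_of_meanLe {Ω : ℕ → Type*} [∀ n, MeasurableSpace (Ω n)]
    {μ : ∀ n, Measure (Ω n)} [∀ n, IsFiniteMeasure (μ n)] {Z U : ∀ n, Ω n → ℝ} {a : ℕ → ℝ}
    {C : ℝ} (hU₀ : ∀ n ω, 0 ≤ U n ω) (hU : ∀ᶠ n in atTop, MeanLe (μ n) (U n) C)
    (hZ : ∀ K : ℝ, ∃ B : ℝ, ∀ᶠ n in atTop, ∀ ω, U n ω ≤ K → |Z n ω| ≤ B * a n) :
    IsBigOInProb μ Z a := by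
  intro ε hε
  obtain ⟨B, hB⟩ := hZ (max C 1 / ε)
  refine ⟨B, ?_⟩
  filter_upwards [hU, hB] with n hUn hBn
  refine (measure_mono fun ω hω => ?_).trans
    ((hUn.mono (le_max_left C 1)).measure_lt_le (hU₀ n) (by positivity) hε)
  by_contra hle
  exact (hBn ω (not_lt.1 hle)).not_gt hω

namespace MomentLe

variable {Ω : Type*} [MeasurableSpace Ω] {μ : Measure Ω} {U V : Ω → ℝ} {s γ D D' : ℝ}

theorem mono (h : MomentLe μ U γ D) (hD : D ≤ D') : MomentLe μ U γ D' :=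
  ⟨h.1, h.2.trans hD⟩

theorem nonneg (h : MomentLe μ U γ D) : 0 ≤ D :=
  (integral_nonneg fun _ => Real.rpow_nonneg (abs_nonneg _) _).trans h.2

theorem meanLe (h : MomentLe μ U γ D) : MeanLe μ (fun ω => |U ω| ^ γ) D := h

theorem memLp (h : MomentLe μ U γ D) (hγ : 0 < γ) (hU : Measurable U) :
    MemLp U (ENNReal.ofReal γ) μ := by
  rw [← integrable_norm_rpow_iff hU.aestronglyMeasurable (by simpa using hγ) ENNReal.ofReal_ne_top,
    ENNReal.toReal_ofReal hγ.le]
  exact h.1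

theorem mul (hU : MomentLe μ U (2 * γ) D) (hV : MomentLe μ V (2 * γ) D)
    (hUm : Measurable U) (hVm : Measurable V) : MomentLe μ (fun ω => U ω * V ω) γ (2 * D) := by
  have hsq : ∀ x : ℝ, |x| ^ (2 * γ) = (|x| ^ γ) ^ 2 := fun x => by
    rw [mul_comm, Real.rpow_mul (abs_nonneg _), Real.rpow_two]
  refine ((hU.meanLe.add hV.meanLe).mono (two_mul D).ge).of_abs_le
    ((hUm.mul hVm).abs.pow_const γ).aestronglyMeasurable fun ω => ?_
  rw [abs_of_nonneg (by positivity), abs_mul, Real.mul_rpow (abs_nonneg _) (abs_nonneg _), hsq,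
    hsq]
  nlinarith [two_mul_le_add_sq (|U ω| ^ γ) (|V ω| ^ γ), sq_nonneg (|U ω| ^ γ),
    sq_nonneg (|V ω| ^ γ)]

theorem sum_mul {ι : Type*} {I : Finset ι} {w : ι → ℝ} {z : ι → Ω → ℝ} (hγ : 1 ≤ γ)
    (hw : ∑ i ∈ I, |w i| = 1) (hz : ∀ i ∈ I, MomentLe μ (z i) γ D) (hzm : ∀ i, Measurable (z i)) :
    MomentLe μ (fun ω => ∑ i ∈ I, w i * z i ω) γ D := by
  have hmean : MeanLe μ (fun ω => ∑ i ∈ I, |w i| * |z i ω| ^ γ) D :=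
    (MeanLe.sum fun i hi => (hz i hi).meanLe.const_mul (abs_nonneg (w i))).mono
      (by rw [← Finset.sum_mul, hw, one_mul])
  have hzm' : Measurable fun ω => ∑ i ∈ I, w i * z i ω :=
    Finset.measurable_sum _ fun i _ => (hzm i).const_mul (w i)
  refine hmean.of_abs_le (hzm'.abs.pow_const γ).aestronglyMeasurable fun ω => ?_
  calc |(|∑ i ∈ I, w i * z i ω| ^ γ)| = |∑ i ∈ I, w i * z i ω| ^ γ := abs_of_nonneg (by positivity)
    _ ≤ (∑ i ∈ I, |w i| * |z i ω|) ^ γ := by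
      gcongr
      simpa only [abs_mul] using Finset.abs_sum_le_sum_abs (fun i => w i * z i ω) I
    _ ≤ ∑ i ∈ I, |w i| * |z i ω| ^ γ :=
      Real.rpow_arith_mean_le_arith_mean_rpow I _ _ (fun i _ => abs_nonneg _) hw
        (fun i _ => abs_nonneg _) hγ

variable [IsProbabilityMeasure μ]

theorem of_exponent_le (h : MomentLe μ U γ D) (hs : 0 ≤ s) (hsγ : s ≤ γ) (hU : Measurable U) :
    MomentLe μ U s (1 + D) := by
  refine (MeanLe.one.add h.meanLe).of_abs_le (hU.abs.pow_const s).aestronglyMeasurable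
    fun ω => ?_
  have hU₀ := Real.rpow_nonneg (abs_nonneg (U ω)) γ
  rw [abs_of_nonneg (by positivity)]
  rcases le_total |U ω| 1 with hU₁ | hU₁
  · linarith [Real.rpow_le_one (abs_nonneg _) hU₁ hs]
  · linarith [Real.rpow_le_rpow_of_exponent_le hU₁ hsγ]

theorem memLp_two (h : MomentLe μ U γ D) (hγ : 2 ≤ γ) (hU : Measurable U) : MemLp U 2 μ :=
  (h.memLp (by linarith) hU).mono_exponent (by simpa using ENNReal.ofReal_le_ofReal hγ)

theorem integrable (h : MomentLe μ U γ D) (hγ : 1 ≤ γ) (hU : Measurable U) : Integrable U μ :=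
  (h.memLp (by linarith) hU).integrable (by simpa using hγ)

theorem integral_abs_le (h : MomentLe μ U γ D) (hγ : 1 ≤ γ) (hU : Measurable U) :
    ∫ ω, |U ω| ∂μ ≤ 1 + D := by
  simpa only [Real.rpow_one] using (h.of_exponent_le zero_le_one hγ hU).2

theorem meanLe_sq (h : MomentLe μ U γ D) (hγ : 2 ≤ γ) (hU : Measurable U) :
    MeanLe μ (fun ω => U ω ^ 2) (1 + D) := by
  simpa only [Real.rpow_two, sq_abs] using (h.of_exponent_le zero_le_two hγ hU).meanLe

theorem integrable_mul (hU : MomentLe μ U γ D) (hV : MomentLe μ V γ D) (hγ : 2 ≤ γ)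
    (hUm : Measurable U) (hVm : Measurable V) : Integrable (fun ω => U ω * V ω) μ :=
  (hU.memLp_two hγ hUm).integrable_mul (hV.memLp_two hγ hVm)

theorem abs_cov_le (hU : MomentLe μ U γ D) (hV : MomentLe μ V γ D) (hγ : 2 ≤ γ)
    (hUm : Measurable U) (hVm : Measurable V) : |cov[U, V; μ]| ≤ 1 + D := by
  have hU₂ := hU.memLp_two hγ hUm
  have hV₂ := hV.memLp_two hγ hVm
  have hadd := variance_add hU₂ hV₂ ▸ variance_nonneg (U + V) μ
  have hsub := variance_sub hU₂ hV₂ ▸ variance_nonneg (U - V) μ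
  have hVarU : Var[U; μ] ≤ 1 + D :=
    (variance_le_expectation_sq hUm.aestronglyMeasurable).trans (hU.meanLe_sq hγ hUm).2
  have hVarV : Var[V; μ] ≤ 1 + D :=
    (variance_le_expectation_sq hVm.aestronglyMeasurable).trans (hV.meanLe_sq hγ hVm).2
  rw [abs_le]
  constructor <;> linarith

end MomentLe

/-! ### Davydov's covariance inequality -/

section Mixing

variable {Ω : Type*} {m m₁ m₂ m₀ : MeasurableSpace Ω} {μ : Measure[m₀] Ω} [IsProbabilityMeasure μ]
  {U V : Ω → ℝ}

theorem integral_abs_condExp_sub_integral_le {K : ℝ} (hm : m ≤ m₀) (hV : Integrable V μ)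
    (hK : ∀ A, MeasurableSet[m] A → |∫ ω in A, V ω ∂μ - μ.real A * ∫ ω, V ω ∂μ| ≤ K) :
    ∫ ω, |(μ[V | m]) ω - ∫ ω, V ω ∂μ| ∂μ ≤ 2 * K := by
  set g : Ω → ℝ := fun ω => (μ[V | m]) ω - ∫ ω, V ω ∂μ
  have hg : Integrable g μ := integrable_condExp.sub (integrable_const _)
  have hset : ∀ A, MeasurableSet[m] A → |∫ ω in A, g ω ∂μ| ≤ K := by
    intro A hA
    rw [integral_sub integrable_condExp.integrableOn (integrable_const _).integrableOn,
      setIntegral_condExp hm hV hA, setIntegral_const, smul_eq_mul]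
    exact hK A hA
  have hpos : MeasurableSet[m] {ω | 0 ≤ g ω} :=
    measurableSet_le measurable_const (stronglyMeasurable_condExp.measurable.sub_const _)
  have hint_pos : ∫ ω in {ω | 0 ≤ g ω}, |g ω| ∂μ = ∫ ω in {ω | 0 ≤ g ω}, g ω ∂μ :=
    setIntegral_congr_fun (hm _ hpos) fun ω hω => abs_of_nonneg hω
  have hint_neg : ∫ ω in {ω | 0 ≤ g ω}ᶜ, |g ω| ∂μ = -∫ ω in {ω | 0 ≤ g ω}ᶜ, g ω ∂μ := by
    rw [← integral_neg]
    exact setIntegral_congr_fun (hm _ hpos.compl) fun ω hω => abs_of_neg (not_le.1 hω)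
  rw [← integral_add_compl (hm _ hpos) hg.abs, hint_pos, hint_neg]
  linarith [(abs_le.1 (hset _ hpos)).2, (abs_le.1 (hset _ hpos.compl)).1]

theorem abs_integral_mul_sub_le_of_setIntegral {a K : ℝ} (hm : m ≤ m₀) (hU : Measurable[m] U)
    (hUa : ∀ ω, |U ω| ≤ a) (hV : Integrable V μ)
    (hK : ∀ A, MeasurableSet[m] A → |∫ ω in A, V ω ∂μ - μ.real A * ∫ ω, V ω ∂μ| ≤ K) :
    |∫ ω, U ω * V ω ∂μ - (∫ ω, U ω ∂μ) * ∫ ω, V ω ∂μ| ≤ 2 * a * K := by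
  obtain ⟨ω₀⟩ : Nonempty Ω := nonempty_of_isProbabilityMeasure μ
  have ha : 0 ≤ a := (abs_nonneg _).trans (hUa ω₀)
  have hUm : AEStronglyMeasurable U μ := (hU.mono hm le_rfl).aestronglyMeasurable
  have hUb : ∀ᵐ ω ∂μ, ‖U ω‖ ≤ a := Eventually.of_forall hUa
  have hUi : Integrable U μ := Integrable.of_bound hUm a hUb
  have hg : Integrable (fun ω => (μ[V | m]) ω - ∫ ω, V ω ∂μ) μ :=
    integrable_condExp.sub (integrable_const _)
  have hpull : ∫ ω, U ω * V ω ∂μ = ∫ ω, U ω * (μ[V | m]) ω ∂μ := by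
    rw [← integral_condExp hm (f := fun ω => U ω * V ω)]
    exact integral_congr_ae
      (condExp_mul_of_stronglyMeasurable_left hU.stronglyMeasurable (hV.bdd_mul hUm hUb) hV)
  have hcenter : ∫ ω, U ω * V ω ∂μ - (∫ ω, U ω ∂μ) * ∫ ω, V ω ∂μ =
      ∫ ω, U ω * ((μ[V | m]) ω - ∫ ω, V ω ∂μ) ∂μ := by
    simp only [mul_sub]
    rw [hpull, integral_sub (integrable_condExp.bdd_mul hUm hUb) (hUi.mul_const _),
      integral_mul_const]
  calc _ ≤ ∫ ω, |U ω * ((μ[V | m]) ω - ∫ ω, V ω ∂μ)| ∂μ :=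
        hcenter ▸ abs_integral_le_integral_abs
    _ ≤ ∫ ω, a * |(μ[V | m]) ω - ∫ ω, V ω ∂μ| ∂μ := by
      refine integral_mono (hg.bdd_mul hUm hUb).abs (hg.abs.const_mul a) fun ω => ?_
      rw [abs_mul]
      exact mul_le_mul_of_nonneg_right (hUa ω) (abs_nonneg _)
    _ ≤ a * (2 * K) := by
      rw [integral_const_mul]
      exact mul_le_mul_of_nonneg_left (integral_abs_condExp_sub_integral_le hm hV hK) ha
    _ = 2 * a * K := by ring

theorem abs_integral_mul_sub_le_of_bounded {a b α : ℝ} (hm₁ : m₁ ≤ m₀) (hm₂ : m₂ ≤ m₀)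
    (hU : Measurable[m₁] U) (hUa : ∀ ω, |U ω| ≤ a) (hV : Measurable[m₂] V)
    (hVb : ∀ ω, |V ω| ≤ b)
    (hα : ∀ A B, MeasurableSet[m₁] A → MeasurableSet[m₂] B →
      |μ.real A * μ.real B - μ.real (A ∩ B)| ≤ α) :
    |∫ ω, U ω * V ω ∂μ - (∫ ω, U ω ∂μ) * ∫ ω, V ω ∂μ| ≤ 4 * a * b * α := by
  have hVi : Integrable V μ := Integrable.of_bound (hV.mono hm₂ le_rfl).aestronglyMeasurable b
    (Eventually.of_forall hVb)
  suffices hK : ∀ A, MeasurableSet[m₁] A →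
      |∫ ω in A, V ω ∂μ - μ.real A * ∫ ω, V ω ∂μ| ≤ 2 * b * α by
    linarith [abs_integral_mul_sub_le_of_setIntegral hm₁ hU hUa hVi hK]
  intro A hA
  have hA₀ := hm₁ _ hA
  have hind : ∫ ω, V ω * A.indicator 1 ω ∂μ = ∫ ω in A, V ω ∂μ := by
    rw [← integral_indicator hA₀]
    refine integral_congr_ae (Eventually.of_forall fun ω => ?_)
    by_cases h : ω ∈ A <;> simp [h]
  rw [← hind, mul_comm, ← integral_indicator_one hA₀]
  refine abs_integral_mul_sub_le_of_setIntegral hm₂ hV hVb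
    ((integrable_const (1 : ℝ)).indicator hA₀) fun B hB => ?_
  rw [setIntegral_indicator hA₀, integral_indicator_one hA₀]
  simp only [Pi.one_apply, setIntegral_const, smul_eq_mul, mul_one]
  rw [abs_sub_comm, mul_comm, Set.inter_comm]
  exact hα A B hA hB

end Mixing

section Cutoff

variable {M γ : ℝ}

/-- `x` cut off at level `M`: the truncation used to reduce unbounded variables to bounded ones. -/
def cutoff (M x : ℝ) : ℝ := if |x| ≤ M then x else 0

theorem measurable_cutoff (M : ℝ) : Measurable (cutoff M) :=
  Measurable.ite (measurableSet_le measurable_id.abs measurable_const) measurable_id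
    measurable_const

theorem abs_cutoff_le (hM : 0 ≤ M) (x : ℝ) : |cutoff M x| ≤ M := by
  unfold cutoff
  split_ifs with h
  · exact h
  · simpa using hM

theorem abs_cutoff_le_abs (M x : ℝ) : |cutoff M x| ≤ |x| := by
  unfold cutoff
  split_ifs with h
  · exact le_rfl
  · simp

theorem rpow_le_rpow_sub_mul_rpow_of_lt {x s : ℝ} (hM : 0 < M) (hx : M < x) (hs : s ≤ γ) :
    x ^ s ≤ M ^ (s - γ) * x ^ γ := by
  have hx₀ : 0 < x := hM.trans hx
  calc x ^ s = x ^ (s - γ) * x ^ γ := by rw [← Real.rpow_add hx₀]; ring_nf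
    _ ≤ _ := mul_le_mul_of_nonneg_right
      (Real.rpow_le_rpow_of_nonpos hM hx.le (by linarith)) (Real.rpow_nonneg hx₀.le _)

theorem abs_sub_cutoff_le (hM : 0 < M) (hγ : 1 ≤ γ) (x : ℝ) :
    |x - cutoff M x| ≤ M ^ (1 - γ) * |x| ^ γ := by
  unfold cutoff
  split_ifs with h
  · simp only [sub_self, abs_zero]; positivity
  · simpa only [Real.rpow_one, sub_zero] using
      rpow_le_rpow_sub_mul_rpow_of_lt hM (not_le.1 h) hγ

theorem abs_mul_sub_cutoff_mul_cutoff_le (hM : 0 < M) (hγ : 2 ≤ γ) (x y : ℝ) :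
    |x * y - cutoff M x * cutoff M y| ≤ M ^ (2 - γ) * (|x| ^ γ + |y| ^ γ) := by
  wlog hxy : |x| ≤ |y| generalizing x y
  · simpa only [mul_comm, add_comm] using this y x (le_of_not_ge hxy)
  rcases le_or_gt |y| M with hy | hy
  · simp only [cutoff, hxy.trans hy, hy, if_true, sub_self, abs_zero]
    positivity
  · calc |x * y - cutoff M x * cutoff M y| = |x| * |y| := by
          simp [cutoff, not_le.2 hy, abs_mul]
      _ ≤ |y| ^ (2 : ℝ) := by
        rw [Real.rpow_two, sq]
        exact mul_le_mul_of_nonneg_right hxy (abs_nonneg y)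
      _ ≤ M ^ (2 - γ) * |y| ^ γ := rpow_le_rpow_sub_mul_rpow_of_lt hM hy hγ
      _ ≤ _ := by gcongr; exact le_add_of_nonneg_left (by positivity)

end Cutoff

section Davydov

variable {Ω : Type*} {m₁ m₂ m₀ : MeasurableSpace Ω} {μ : Measure[m₀] Ω} [IsProbabilityMeasure μ]
  {U V : Ω → ℝ} {γ D M α : ℝ}

theorem integrable_cutoff_comp (hM : 0 ≤ M) (hU : Measurable U) :
    Integrable (fun ω => cutoff M (U ω)) μ :=
  Integrable.of_bound ((measurable_cutoff M).comp hU).aestronglyMeasurable M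
    (Eventually.of_forall fun _ => abs_cutoff_le hM _)

theorem abs_integral_sub_integral_cutoff_le (hγ : 1 ≤ γ) (hM : 1 ≤ M) (hU : Measurable U)
    (hUD : MomentLe μ U γ D) :
    |∫ ω, U ω ∂μ - ∫ ω, cutoff M (U ω) ∂μ| ≤ M ^ (2 - γ) * D := by
  have hM₀ : 0 < M := by linarith
  have hUi := hUD.integrable hγ hU
  have hUM := integrable_cutoff_comp (μ := μ) hM₀.le hU
  calc _ ≤ ∫ ω, |U ω - cutoff M (U ω)| ∂μ := by
        rw [← integral_sub hUi hUM]; exact abs_integral_le_integral_abs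
    _ ≤ ∫ ω, M ^ (1 - γ) * |U ω| ^ γ ∂μ :=
        integral_mono (hUi.sub hUM).abs (hUD.1.const_mul _) fun _ => abs_sub_cutoff_le hM₀ hγ _
    _ = M ^ (1 - γ) * ∫ ω, |U ω| ^ γ ∂μ := integral_const_mul _ _
    _ ≤ M ^ (2 - γ) * D := by
        gcongr
        · linarith
        · exact hUD.2

theorem abs_integral_mul_sub_integral_cutoff_mul_cutoff_le (hγ : 2 ≤ γ) (hM : 0 < M)
    (hU : Measurable U) (hV : Measurable V) (hUD : MomentLe μ U γ D) (hVD : MomentLe μ V γ D) :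
    |∫ ω, U ω * V ω ∂μ - ∫ ω, cutoff M (U ω) * cutoff M (V ω) ∂μ| ≤ M ^ (2 - γ) * (2 * D) := by
  have hUV := hUD.integrable_mul hVD hγ hU hV
  have hUVM : Integrable (fun ω => cutoff M (U ω) * cutoff M (V ω)) μ :=
    (integrable_cutoff_comp hM.le hV).bdd_mul
      ((measurable_cutoff M).comp hU).aestronglyMeasurable
      (Eventually.of_forall fun _ => abs_cutoff_le hM.le _)
  calc _ ≤ ∫ ω, |U ω * V ω - cutoff M (U ω) * cutoff M (V ω)| ∂μ := by
        rw [← integral_sub hUV hUVM]; exact abs_integral_le_integral_abs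
    _ ≤ ∫ ω, M ^ (2 - γ) * (|U ω| ^ γ + |V ω| ^ γ) ∂μ :=
        integral_mono (hUV.sub hUVM).abs ((hUD.1.add hVD.1).const_mul _)
          fun _ => abs_mul_sub_cutoff_mul_cutoff_le hM hγ _ _
    _ = M ^ (2 - γ) * (∫ ω, |U ω| ^ γ ∂μ + ∫ ω, |V ω| ^ γ ∂μ) := by
        rw [integral_const_mul, integral_add hUD.1 hVD.1]
    _ ≤ M ^ (2 - γ) * (2 * D) := by gcongr; linarith [hUD.2, hVD.2]

theorem abs_integral_mul_integral_sub_cutoff_le (hγ : 1 ≤ γ) (hM : 1 ≤ M) (hU : Measurable U)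
    (hV : Measurable V) (hUD : MomentLe μ U γ D) (hVD : MomentLe μ V γ D) :
    |(∫ ω, U ω ∂μ) * ∫ ω, V ω ∂μ - (∫ ω, cutoff M (U ω) ∂μ) * ∫ ω, cutoff M (V ω) ∂μ| ≤
      2 * (1 + D) * (M ^ (2 - γ) * D) := by
  have hD := hUD.nonneg
  have hVint : |∫ ω, V ω ∂μ| ≤ 1 + D :=
    abs_integral_le_integral_abs.trans (hVD.integral_abs_le hγ hV)
  have hUMint : |∫ ω, cutoff M (U ω) ∂μ| ≤ 1 + D :=
    (abs_integral_le_integral_abs.trans (integral_mono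
      (integrable_cutoff_comp (by linarith) hU).abs (hUD.integrable hγ hU).abs
        fun ω => abs_cutoff_le_abs M (U ω))).trans (hUD.integral_abs_le hγ hU)
  calc _ = |(∫ ω, U ω ∂μ - ∫ ω, cutoff M (U ω) ∂μ) * ∫ ω, V ω ∂μ +
          (∫ ω, cutoff M (U ω) ∂μ) * (∫ ω, V ω ∂μ - ∫ ω, cutoff M (V ω) ∂μ)| := by ring_nf
    _ ≤ |∫ ω, U ω ∂μ - ∫ ω, cutoff M (U ω) ∂μ| * |∫ ω, V ω ∂μ| +
          |∫ ω, cutoff M (U ω) ∂μ| * |∫ ω, V ω ∂μ - ∫ ω, cutoff M (V ω) ∂μ| := by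
        exact (abs_add_le _ _).trans_eq (by rw [abs_mul, abs_mul])
    _ ≤ M ^ (2 - γ) * D * (1 + D) + (1 + D) * (M ^ (2 - γ) * D) := by
        gcongr
        · exact abs_integral_sub_integral_cutoff_le hγ hM hU hUD
        · exact abs_integral_sub_integral_cutoff_le hγ hM hV hVD
    _ = 2 * (1 + D) * (M ^ (2 - γ) * D) := by ring

theorem abs_cov_le_of_truncation (hm₁ : m₁ ≤ m₀) (hm₂ : m₂ ≤ m₀) (hγ : 2 ≤ γ) (hM : 1 ≤ M)
    (hU : Measurable[m₁] U) (hV : Measurable[m₂] V) (hUD : MomentLe μ U γ D)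
    (hVD : MomentLe μ V γ D)
    (hα : ∀ A B, MeasurableSet[m₁] A → MeasurableSet[m₂] B →
      |μ.real A * μ.real B - μ.real (A ∩ B)| ≤ α) :
    |cov[U, V; μ]| ≤ 4 * M ^ 2 * α + (4 * D + 2 * D ^ 2) * M ^ (2 - γ) := by
  have hM₀ : 0 < M := by linarith
  have hU₀ := hU.mono hm₁ le_rfl
  have hV₀ := hV.mono hm₂ le_rfl
  rw [covariance_eq_sub (hUD.memLp_two hγ hU₀) (hVD.memLp_two hγ hV₀)]
  simp only [Pi.mul_apply]
  have hbounded := abs_le.1 <| abs_integral_mul_sub_le_of_bounded hm₁ hm₂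
    ((measurable_cutoff M).comp hU) (fun ω => abs_cutoff_le hM₀.le _)
    ((measurable_cutoff M).comp hV) (fun ω => abs_cutoff_le hM₀.le _) hα
  have hprod := abs_le.1 <|
    abs_integral_mul_sub_integral_cutoff_mul_cutoff_le hγ hM₀ hU₀ hV₀ hUD hVD
  have hmean := abs_le.1 <|
    abs_integral_mul_integral_sub_cutoff_le (by linarith) hM hU₀ hV₀ hUD hVD
  simp only [Function.comp_apply] at hbounded
  rw [abs_le]
  constructor <;> nlinarith

theorem abs_cov_le_mul_rpow (hm₁ : m₁ ≤ m₀) (hm₂ : m₂ ≤ m₀) (hγ : 2 < γ) (hα₀ : 0 ≤ α)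
    (hα₁ : α < 1) (hU : Measurable[m₁] U) (hV : Measurable[m₂] V) (hUD : MomentLe μ U γ D)
    (hVD : MomentLe μ V γ D)
    (hα : ∀ A B, MeasurableSet[m₁] A → MeasurableSet[m₂] B →
      |μ.real A * μ.real B - μ.real (A ∩ B)| ≤ α) :
    |cov[U, V; μ]| ≤ (4 + 4 * D + 2 * D ^ 2) * α ^ (1 - 2 / γ) := by
  have hγ₀ : 0 < γ := by linarith
  -- The level `β ^ (-1/γ)` balances the two terms of the truncation bound; `β > α` avoids `0⁻¹`.
  have hbound : ∀ β, α < β → β < 1 →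
      |cov[U, V; μ]| ≤ (4 + 4 * D + 2 * D ^ 2) * β ^ (1 - 2 / γ) := by
    intro β hαβ hβ₁
    have hβ₀ : 0 < β := hα₀.trans_lt hαβ
    have hM : 1 ≤ β ^ (-(1 / γ)) :=
      Real.one_le_rpow_of_pos_of_le_one_of_nonpos hβ₀ hβ₁.le
        (neg_nonpos.2 (by positivity))
    have hmain : (β ^ (-(1 / γ))) ^ 2 * β = β ^ (1 - 2 / γ) := by
      rw [← Real.rpow_natCast, ← Real.rpow_mul hβ₀.le]
      nth_rewrite 2 [← Real.rpow_one β]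
      rw [← Real.rpow_add hβ₀]
      congr 1; push_cast; ring
    have htail : (β ^ (-(1 / γ))) ^ (2 - γ) = β ^ (1 - 2 / γ) := by
      rw [← Real.rpow_mul hβ₀.le]
      congr 1; field_simp; ring
    have htrunc := abs_cov_le_of_truncation hm₁ hm₂ hγ.le hM hU hV hUD hVD
      fun A B hA hB => (hα A B hA hB).trans hαβ.le
    rw [mul_assoc, hmain, htail] at htrunc
    linarith
  have hcont : Tendsto (fun β => (4 + 4 * D + 2 * D ^ 2) * β ^ (1 - 2 / γ)) (𝓝[>] α)
      (𝓝 ((4 + 4 * D + 2 * D ^ 2) * α ^ (1 - 2 / γ))) := by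
    refine Tendsto.mono_left ?_ nhdsWithin_le_nhds
    refine ((Real.continuous_rpow_const ?_).tendsto α).const_mul _
    rw [sub_nonneg, div_le_one hγ₀]
    exact hγ.le
  refine ge_of_tendsto hcont ?_
  filter_upwards [Ioo_mem_nhdsGT hα₁] with β hβ using hbound β hβ.1 hβ.2

end Davydov

/-! ### Averages of lagged products of mixing processes -/

theorem abs_real_mul_sub_real_inter_le {Ω : Type*} [MeasurableSpace Ω] (μ : Measure Ω)
    [IsProbabilityMeasure μ] (A : Set Ω) {B : Set Ω} (hB : MeasurableSet B) :
    |μ.real A * μ.real B - μ.real (A ∩ B)| ≤ 1 / 4 := by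
  have hinter : 0 ≤ μ.real (A ∩ B) := measureReal_nonneg
  have hA : μ.real (A ∩ B) ≤ μ.real A := measureReal_mono Set.inter_subset_left
  have hB' : μ.real (A ∩ B) ≤ μ.real B := measureReal_mono Set.inter_subset_right
  have hunion : μ.real A + μ.real B - μ.real (A ∩ B) ≤ 1 := by
    rw [← measureReal_union_add_inter (μ := μ) (s := A) hB, add_sub_cancel_right]
    exact measureReal_le_one
  have hfour : μ.real A * μ.real B - μ.real (A ∩ B) =
      (μ.real A - μ.real (A ∩ B)) * (μ.real B - μ.real (A ∩ B)) -
        μ.real (A ∩ B) * (1 - (μ.real A + μ.real B - μ.real (A ∩ B))) := by ring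
  have hquarter : ∀ x y : ℝ, 0 ≤ x → 0 ≤ y → x + y ≤ 1 → x * y ≤ 1 / 4 := fun x y hx hy hxy => by
    nlinarith [sq_nonneg (x - y)]
  rw [hfour]
  refine abs_sub_le_of_nonneg_of_le (mul_nonneg (by linarith) (by linarith))
    (hquarter _ _ ?_ ?_ ?_) (mul_nonneg hinter (by linarith)) (hquarter _ _ hinter ?_ ?_) <;>
    linarith

/-- The mixing coefficients `α(1), α(2), …` of the process with `σ`-fields `𝓖 t`, raised to the
power `1 - 2 / γ`, have a sum at most `B`. -/
def MixingSumLe {Ω : Type*} [MeasurableSpace Ω] (μ : Measure Ω) (𝓖 : ℤ → MeasurableSpace Ω)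
    (γ B : ℝ) : Prop :=
  Summable (fun l : ℕ => alphaMixing μ 𝓖 (l + 1) ^ (1 - 2 / γ)) ∧
    ∑' l : ℕ, alphaMixing μ 𝓖 (l + 1) ^ (1 - 2 / γ) ≤ B

/-- The bound `2 ∑_d |Cov(U_0, U_d)|` for a process `U` with moments at most `D` whose value at
time `t` depends on the times `t` and `t + h` of a process whose mixing coefficients sum up to `B`:
the lags `d ≤ h` are bounded by second moments, the others by Davydov's inequality. -/
def varConst (D : ℝ) (h : ℕ) (B : ℝ) : ℝ :=
  2 * ((h + 1) * (1 + D) + (4 + 4 * D + 2 * D ^ 2) * B)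

theorem varConst_nonneg {D B : ℝ} (hD : 0 ≤ D) (h : ℕ) (hB : 0 ≤ B) : 0 ≤ varConst D h B := by
  unfold varConst
  positivity

theorem sum_natAbs_sub_le {b : ℕ → ℝ} {B : ℝ} (hB : ∀ F : Finset ℕ, ∑ d ∈ F, b d ≤ B) (s : ℤ)
    (F : Finset ℤ) : ∑ t ∈ F, b (s - t).natAbs ≤ 2 * B := by
  have hinj : ∀ G : Finset ℤ, Set.InjOn (fun t => (s - t).natAbs) G →
      ∑ t ∈ G, b (s - t).natAbs ≤ B := fun G hG => by
    rw [← Finset.sum_image hG]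
    exact hB _
  rw [← Finset.sum_filter_add_sum_filter_not F (· ≤ s), two_mul]
  refine add_le_add (hinj _ ?_) (hinj _ ?_) <;>
  · intro x hx y hy hxy
    simp only [Finset.coe_filter, Set.mem_ofPred_eq] at hx hy hxy
    omega

section Alpha

variable {Ω : Type*} [m₀ : MeasurableSpace Ω] {μ : Measure Ω} {𝓖 : ℤ → MeasurableSpace Ω}
  {γ D B : ℝ} {h : ℕ}

theorem alphaMixing_nonneg (l : ℕ) : 0 ≤ alphaMixing μ 𝓖 l :=
  Real.sSup_nonneg (by rintro x ⟨i, A, B, -, -, rfl⟩; exact abs_nonneg _)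

theorem MixingSumLe.nonneg (h : MixingSumLe μ 𝓖 γ B) : 0 ≤ B :=
  (tsum_nonneg fun _ => Real.rpow_nonneg (alphaMixing_nonneg _) _).trans h.2

/-- The bound for the covariance at lag `d` behind `varConst`. -/
def covBound (D : ℝ) (h : ℕ) (a : ℕ → ℝ) (d : ℕ) : ℝ :=
  if d ≤ h then 1 + D else (4 + 4 * D + 2 * D ^ 2) * a (d - h - 1)

theorem sum_covBound_le (hD : 0 ≤ D) {a : ℕ → ℝ} (ha : ∀ l, 0 ≤ a l) (has : Summable a)
    (hB : ∑' l, a l ≤ B) (F : Finset ℕ) :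
    ∑ d ∈ F, covBound D h a d ≤ (h + 1) * (1 + D) + (4 + 4 * D + 2 * D ^ 2) * B := by
  unfold covBound
  rw [Finset.sum_ite]
  refine add_le_add ?_ ?_
  · rw [Finset.sum_const, nsmul_eq_mul]
    gcongr
    have hsub : F.filter (· ≤ h) ⊆ Finset.range (h + 1) := fun d hd => by
      rw [Finset.mem_filter] at hd
      exact Finset.mem_range_succ_iff.2 hd.2
    exact_mod_cast (Finset.card_le_card hsub).trans_eq (Finset.card_range _)
  · rw [← Finset.mul_sum]
    gcongr
    rw [← Finset.sum_image (g := fun d => d - h - 1) (f := a)]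
    · exact (has.sum_le_tsum _ fun l _ => ha l).trans hB
    · intro x hx y hy hxy
      simp only [Finset.coe_filter, Set.mem_ofPred_eq] at hx hy hxy
      omega

variable [IsProbabilityMeasure μ]

theorem le_alphaMixing (h𝓖 : ∀ t, 𝓖 t ≤ m₀) (l : ℕ) (i : ℤ) {A B : Set Ω}
    (hA : MeasurableSet[⨆ t ∈ Set.Iic i, 𝓖 t] A)
    (hB : MeasurableSet[⨆ t ∈ Set.Ici (i + (l : ℤ)), 𝓖 t] B) :
    |μ.real A * μ.real B - μ.real (A ∩ B)| ≤ alphaMixing μ 𝓖 l := by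
  refine le_csSup ⟨1 / 4, ?_⟩ ⟨i, A, B, hA, hB, rfl⟩
  rintro x ⟨i, A, B, -, hB, rfl⟩
  exact abs_real_mul_sub_real_inter_le μ A ((iSup₂_le fun t _ => h𝓖 t) _ hB)

theorem alphaMixing_lt_one (h𝓖 : ∀ t, 𝓖 t ≤ m₀) (l : ℕ) : alphaMixing μ 𝓖 l < 1 := by
  refine lt_of_le_of_lt (Real.sSup_le ?_ (by norm_num : (0 : ℝ) ≤ 1 / 4)) (by norm_num)
  rintro x ⟨i, A, B, -, hB, rfl⟩
  exact abs_real_mul_sub_real_inter_le μ A ((iSup₂_le fun t _ => h𝓖 t) _ hB)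

theorem abs_cov_le_covBound (h𝓖 : ∀ t, 𝓖 t ≤ m₀) (hγ : 2 < γ) {U : ℤ → Ω → ℝ}
    (hU : ∀ t, Measurable[𝓖 t ⊔ 𝓖 (t + h)] (U t)) {s t : ℤ} (hst : s ≤ t)
    (hs : MomentLe μ (U s) γ D) (ht : MomentLe μ (U t) γ D) :
    |cov[U s, U t; μ]| ≤
      covBound D h (fun l => alphaMixing μ 𝓖 (l + 1) ^ (1 - 2 / γ)) (s - t).natAbs := by
  have hU₀ : ∀ t, Measurable (U t) := fun t => (hU t).mono (sup_le (h𝓖 _) (h𝓖 _)) le_rfl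
  unfold covBound
  split_ifs with hd
  · exact hs.abs_cov_le ht hγ.le (hU₀ s) (hU₀ t)
  · set l := (s - t).natAbs - h - 1
    have hpast : 𝓖 s ⊔ 𝓖 (s + h) ≤ ⨆ r ∈ Set.Iic (s + (h : ℤ)), 𝓖 r :=
      sup_le (le_biSup 𝓖 (Set.mem_Iic.2 (by omega))) (le_biSup 𝓖 (Set.mem_Iic.2 le_rfl))
    have hfuture : 𝓖 t ⊔ 𝓖 (t + h) ≤ ⨆ r ∈ Set.Ici (s + (h : ℤ) + ((l + 1 : ℕ) : ℤ)), 𝓖 r :=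
      sup_le (le_biSup 𝓖 (Set.mem_Ici.2 (by omega))) (le_biSup 𝓖 (Set.mem_Ici.2 (by omega)))
    exact abs_cov_le_mul_rpow (iSup₂_le fun t _ => h𝓖 t) (iSup₂_le fun t _ => h𝓖 t) hγ
      (alphaMixing_nonneg _) (alphaMixing_lt_one h𝓖 _) ((hU s).mono hpast le_rfl)
      ((hU t).mono hfuture le_rfl) hs ht fun A B hA hB => le_alphaMixing h𝓖 _ _ hA hB

theorem variance_sum_le (h𝓖 : ∀ t, 𝓖 t ≤ m₀) (hγ : 2 < γ) (hα : MixingSumLe μ 𝓖 γ B)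
    {U : ℤ → Ω → ℝ} (hU : ∀ t, Measurable[𝓖 t ⊔ 𝓖 (t + h)] (U t)) {F : Finset ℤ}
    (hUD : ∀ t ∈ F, MomentLe μ (U t) γ D) :
    Var[fun ω => ∑ t ∈ F, U t ω; μ] ≤ F.card * varConst D h B := by
  have hU₀ : ∀ t, Measurable (U t) := fun t => (hU t).mono (sup_le (h𝓖 _) (h𝓖 _)) le_rfl
  rw [variance_fun_sum' fun t ht => (hUD t ht).memLp_two hγ.le (hU₀ t), ← nsmul_eq_mul]
  refine Finset.sum_le_card_nsmul _ _ _ fun s hs => ?_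
  calc ∑ t ∈ F, cov[U s, U t; μ]
      ≤ ∑ t ∈ F, covBound D h (fun l => alphaMixing μ 𝓖 (l + 1) ^ (1 - 2 / γ)) (s - t).natAbs := by
        refine Finset.sum_le_sum fun t ht => (le_abs_self _).trans ?_
        rcases le_total s t with hst | hst
        · exact abs_cov_le_covBound h𝓖 hγ hU hst (hUD s hs) (hUD t ht)
        · rw [covariance_comm, ← Int.natAbs_neg, neg_sub]
          exact abs_cov_le_covBound h𝓖 hγ hU hst (hUD t ht) (hUD s hs)
    _ ≤ varConst D h B := sum_natAbs_sub_le (fun G => sum_covBound_le (hUD s hs).nonneg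
        (fun l => Real.rpow_nonneg (alphaMixing_nonneg _) _) hα.1 hα.2 G) s F

theorem meanLe_sq_sum_sub_sum_integral (h𝓖 : ∀ t, 𝓖 t ≤ m₀) (hγ : 2 < γ)
    (hα : MixingSumLe μ 𝓖 γ B) {U : ℤ → Ω → ℝ} (hU : ∀ t, Measurable[𝓖 t ⊔ 𝓖 (t + h)] (U t))
    {F : Finset ℤ} (hUD : ∀ t ∈ F, MomentLe μ (U t) γ D) :
    MeanLe μ (fun ω => (∑ t ∈ F, U t ω - ∑ t ∈ F, ∫ ω, U t ω ∂μ) ^ 2)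
      (F.card * varConst D h B) := by
  have hU₀ : ∀ t, Measurable (U t) := fun t => (hU t).mono (sup_le (h𝓖 _) (h𝓖 _)) le_rfl
  have hL : MemLp (fun ω => ∑ t ∈ F, U t ω) 2 μ :=
    memLp_finsetSum _ fun t ht => (hUD t ht).memLp_two hγ.le (hU₀ t)
  have hint : ∫ ω, ∑ t ∈ F, U t ω ∂μ = ∑ t ∈ F, ∫ ω, U t ω ∂μ :=
    integral_finsetSum _ fun t ht => (hUD t ht).integrable (by linarith) (hU₀ t)
  refine ⟨(hL.sub (memLp_const _)).integrable_sq, ?_⟩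
  rw [← hint, ← variance_eq_integral hL.aemeasurable]
  exact variance_sum_le h𝓖 hγ hα hU hUD

theorem meanLe_sq_avg_mul_sub_avg_integral_mul (h𝓖 : ∀ t, 𝓖 t ≤ m₀) (hγ : 2 < γ)
    (hα : MixingSumLe μ 𝓖 γ B) {T : ℕ} (hT : 1 ≤ T) (hhT : 2 * h ≤ T) {u v : ℤ → Ω → ℝ}
    (hu : ∀ t, Measurable[𝓖 t] (u t)) (hv : ∀ t, Measurable[𝓖 t] (v t)) {a b : ℝ} (ha : 0 < a)
    (hb : 0 < b) (hua : ∀ t ∈ Finset.Icc (1 : ℤ) T, MomentLe μ (fun ω => u t ω / a) (2 * γ) D)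
    (hvb : ∀ t ∈ Finset.Icc (1 : ℤ) T, MomentLe μ (fun ω => v t ω / b) (2 * γ) D) :
    MeanLe μ (fun ω => (((T : ℝ) - h)⁻¹ * ∑ t ∈ Finset.Icc (1 : ℤ) (T - h), u t ω * v (t + h) ω -
        ((T : ℝ) - h)⁻¹ * ∑ t ∈ Finset.Icc (1 : ℤ) (T - h), ∫ ω, u t ω * v (t + h) ω ∂μ) ^ 2)
      (a ^ 2 * b ^ 2 * (2 * varConst (2 * D) h B / T)) := by
  set F := Finset.Icc (1 : ℤ) (T - h) with hF
  set U : ℤ → Ω → ℝ := fun t ω => (u t ω / a) * (v (t + h) ω / b) with hUdef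
  have hUm : ∀ t, Measurable[𝓖 t ⊔ 𝓖 (t + h)] (U t) := fun t =>
    (((hu t).mono le_sup_left le_rfl).div_const a).mul
      (((hv (t + h)).mono le_sup_right le_rfl).div_const b)
  have hUD : ∀ t ∈ F, MomentLe μ (U t) γ (2 * D) := fun t ht => by
    rw [hF, Finset.mem_Icc] at ht
    exact (hua t (by rw [Finset.mem_Icc]; omega)).mul (hvb (t + h) (by rw [Finset.mem_Icc]; omega))
      (((hu t).mono (h𝓖 _) le_rfl).div_const a) (((hv (t + h)).mono (h𝓖 _) le_rfl).div_const b)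
  have hsum := meanLe_sq_sum_sub_sum_integral h𝓖 hγ hα hUm hUD
  have hcard : (F.card : ℝ) = T - h := by
    rw [hF, Int.card_Icc, show (T : ℤ) - h + 1 - 1 = ((T - h : ℕ) : ℤ) by omega, Int.toNat_natCast,
      Nat.cast_sub (by omega)]
  have hT₀ : (0 : ℝ) < T := by exact_mod_cast hT
  have hTh : (T : ℝ) / 2 ≤ T - h := by
    have : (2 * h : ℝ) ≤ T := by exact_mod_cast hhT
    linarith
  have hN : (0 : ℝ) < T - h := by linarith
  have hK : 0 ≤ varConst (2 * D) h B := by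
    rw [hcard] at hsum
    exact nonneg_of_mul_nonneg_right ((integral_nonneg fun ω => sq_nonneg _).trans hsum.2) hN
  convert (hsum.const_mul (sq_nonneg (a * b / ((T : ℝ) - h)))).mono ?_ using 2 with ω
  · have huv : ∀ t ω, u t ω * v (t + h) ω = a * b * U t ω := fun t ω => by
      simp only [hUdef]; field_simp
    simp only [huv, integral_const_mul, ← Finset.mul_sum, ← mul_sub, ← mul_pow]
    congr 1; ring
  · calc _ = a ^ 2 * b ^ 2 * (varConst (2 * D) h B / ((T : ℝ) - h)) := by
          rw [hcard]; field_simp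
      _ ≤ a ^ 2 * b ^ 2 * (varConst (2 * D) h B / (T / 2)) := by gcongr
      _ = _ := by field_simp

end Alpha

/-! ### Low-rank autocovariances -/

section Loaded

/-- The averaged covariance `Ω_{ij}(h)` of the column `i` of `W_t` and the column `j` of `W_{t+h}`,
for a matrix process `W`. -/
def colLagCov {Ω : Type*} [MeasurableSpace Ω] (μ : Measure Ω) {a b : ℕ} (T h : ℕ)
    (W : ℤ → Ω → Matrix (Fin a) (Fin b) ℝ) (i j : Fin b) : Matrix (Fin a) (Fin a) ℝ :=
  avgLagCov μ T h (fun t ω x => W t ω x i) (fun t ω x => W t ω x j)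

variable {a b k r : ℕ} (L : Matrix (Fin a) (Fin k) ℝ) (N : Matrix (Fin b) (Fin r) ℝ)

/-- The covariance of the columns `i` and `j` of `L F N'`, where `Γ c d` is that of the columns
`c` and `d` of `F`. -/
def loadedCov (Γ : Fin r → Fin r → Matrix (Fin k) (Fin k) ℝ) (i j : Fin b) :
    Matrix (Fin a) (Fin a) ℝ :=
  L * (∑ c, ∑ d, (N i c * N j d) • Γ c d) * Lᵀ

theorem loadedCov_apply (Γ : Fin r → Fin r → Matrix (Fin k) (Fin k) ℝ) (i j : Fin b)
    (x y : Fin a) : loadedCov L N Γ i j x y =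
      ∑ e : Fin k × Fin r, ∑ f : Fin k × Fin r,
        (L x e.1 * N i e.2) * (L y f.1 * N j f.2) * Γ e.2 f.2 e.1 f.1 := by
  simp only [loadedCov, Matrix.mul_apply, Matrix.sum_apply, Matrix.smul_apply, smul_eq_mul,
    Matrix.transpose_apply, Fintype.sum_prod_type, Finset.mul_sum, Finset.sum_mul]
  rw [Finset.sum_comm]
  refine Finset.sum_congr rfl fun e₁ _ => ?_
  rw [Finset.sum_comm]
  refine Finset.sum_congr rfl fun e₂ _ => Finset.sum_congr rfl fun f₁ _ =>
    Finset.sum_congr rfl fun f₂ _ => ?_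
  ring

variable {L N}

theorem sq_mul_sum_sq_le_sum_sq_bilin {σ : ℝ} (hσ : 0 ≤ σ)
    (hN : ∀ z, σ * (z ⬝ᵥ z) ≤ (N *ᵥ z) ⬝ᵥ (N *ᵥ z)) (g : Fin r → Fin r → ℝ) :
    σ ^ 2 * ∑ c, ∑ d, g c d ^ 2 ≤ ∑ i, ∑ j, (∑ c, ∑ d, N i c * N j d * g c d) ^ 2 := by
  have hsum : ∀ z : Fin r → ℝ, σ * ∑ c, z c ^ 2 ≤ ∑ i, (∑ c, N i c * z c) ^ 2 := fun z => by
    simpa [dotProduct, Matrix.mulVec, sq] using hN z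
  calc σ ^ 2 * ∑ c, ∑ d, g c d ^ 2 = σ * ∑ c, σ * ∑ d, g c d ^ 2 := by
        rw [← Finset.mul_sum]; ring
    _ ≤ σ * ∑ c, ∑ j, (∑ d, N j d * g c d) ^ 2 :=
      mul_le_mul_of_nonneg_left (Finset.sum_le_sum fun c _ => hsum (g c)) hσ
    _ = ∑ j, σ * ∑ c, (∑ d, N j d * g c d) ^ 2 := by rw [Finset.sum_comm, Finset.mul_sum]
    _ ≤ ∑ j, ∑ i, (∑ c, N i c * ∑ d, N j d * g c d) ^ 2 :=
      Finset.sum_le_sum fun j _ => hsum fun c => ∑ d, N j d * g c d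
    _ = ∑ i, ∑ j, (∑ c, ∑ d, N i c * N j d * g c d) ^ 2 := by
      rw [Finset.sum_comm]
      simp only [Finset.mul_sum, mul_assoc]

theorem sq_mul_sum_dotProduct_self_le {κ : Type*} [Fintype κ] {σ : ℝ} (hσ : 0 ≤ σ)
    (hN : ∀ z, σ * (z ⬝ᵥ z) ≤ (N *ᵥ z) ⬝ᵥ (N *ᵥ z)) (g : Fin r → Fin r → κ → ℝ) :
    σ ^ 2 * ∑ c, ∑ d, g c d ⬝ᵥ g c d ≤ ∑ i, ∑ j,
      (∑ c, ∑ d, (N i c * N j d) • g c d) ⬝ᵥ (∑ c, ∑ d, (N i c * N j d) • g c d) := by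
  have hswap : ∀ {n : ℕ} (f : Fin n → Fin n → κ → ℝ),
      ∑ i, ∑ j, f i j ⬝ᵥ f i j = ∑ x, ∑ i, ∑ j, f i j x ^ 2 := fun f => by
    simp only [dotProduct, ← sq]
    exact Finset.sum_comm_cycle
  rw [hswap, hswap, Finset.mul_sum]
  refine Finset.sum_le_sum fun x _ => ?_
  simpa only [Finset.sum_apply, Pi.smul_apply, smul_eq_mul] using
    sq_mul_sum_sq_le_sum_sq_bilin hσ hN fun c d => g c d x

theorem mul_sum_dotProduct_self_le_loadedCov {σL σN : ℝ} (hσL : 0 ≤ σL) (hσN : 0 ≤ σN)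
    (hL : ∀ z, σL * (z ⬝ᵥ z) ≤ (L *ᵥ z) ⬝ᵥ (L *ᵥ z))
    (hN : ∀ z, σN * (z ⬝ᵥ z) ≤ (N *ᵥ z) ⬝ᵥ (N *ᵥ z))
    (Γ : Fin r → Fin r → Matrix (Fin k) (Fin k) ℝ) (v : Fin a → ℝ) :
    σL * (σN ^ 2 * ∑ c, ∑ d, ((Γ c d)ᵀ *ᵥ (Lᵀ *ᵥ v)) ⬝ᵥ ((Γ c d)ᵀ *ᵥ (Lᵀ *ᵥ v))) ≤
      ∑ i, ∑ j, ((loadedCov L N Γ i j)ᵀ *ᵥ v) ⬝ᵥ ((loadedCov L N Γ i j)ᵀ *ᵥ v) := by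
  have hmulVec : ∀ i j, (loadedCov L N Γ i j)ᵀ *ᵥ v =
      L *ᵥ (∑ c, ∑ d, (N i c * N j d) • ((Γ c d)ᵀ *ᵥ (Lᵀ *ᵥ v))) := fun i j => by
    simp only [loadedCov, Matrix.transpose_mul, Matrix.transpose_transpose, Matrix.transpose_sum,
      Matrix.transpose_smul, ← Matrix.mulVec_mulVec, Matrix.sum_mulVec, Matrix.smul_mulVec]
  refine (mul_le_mul_of_nonneg_left (sq_mul_sum_dotProduct_self_le hσN hN _) hσL).trans ?_
  simp only [Finset.mul_sum, hmulVec]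
  exact Finset.sum_le_sum fun i _ => Finset.sum_le_sum fun j _ => hL _

theorem mul_dotProduct_mulVec_self_le {ι κ : Type*} [Fintype ι] [Fintype κ] {L : Matrix ι κ ℝ}
    {σ : ℝ} (hσ : 0 ≤ σ) (hL : ∀ z, σ * (z ⬝ᵥ z) ≤ (L *ᵥ z) ⬝ᵥ (L *ᵥ z)) (z : κ → ℝ) :
    σ * ((L *ᵥ z) ⬝ᵥ (L *ᵥ z)) ≤ (Lᵀ *ᵥ (L *ᵥ z)) ⬝ᵥ (Lᵀ *ᵥ (L *ᵥ z)) := by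
  set x := (L *ᵥ z) ⬝ᵥ (L *ᵥ z)
  set y := (Lᵀ *ᵥ (L *ᵥ z)) ⬝ᵥ (Lᵀ *ᵥ (L *ᵥ z)) with hy
  have hx₀ : 0 ≤ x := Finset.sum_nonneg fun i _ => mul_self_nonneg _
  have hy₀ : 0 ≤ y := Finset.sum_nonneg fun i _ => mul_self_nonneg _
  have hcs : x ^ 2 ≤ (z ⬝ᵥ z) * y := by
    have hinner : z ⬝ᵥ (Lᵀ *ᵥ (L *ᵥ z)) = x := by
      rw [Matrix.dotProduct_mulVec, Matrix.vecMul_transpose]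
    rw [← hinner]
    simpa only [hy, dotProduct, ← sq] using
      Finset.sum_mul_sq_le_sq_mul_sq Finset.univ z (Lᵀ *ᵥ (L *ᵥ z))
  rcases hx₀.eq_or_lt with h₀ | hpos
  · rwa [← h₀, mul_zero]
  · refine le_of_mul_le_mul_right ?_ hpos
    calc σ * x * x = σ * x ^ 2 := by ring
      _ ≤ σ * ((z ⬝ᵥ z) * y) := mul_le_mul_of_nonneg_left hcs hσ
      _ = σ * (z ⬝ᵥ z) * y := by ring
      _ ≤ x * y := mul_le_mul_of_nonneg_right (hL z) hy₀
      _ = y * x := mul_comm x y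

variable {Ω : Type*} [MeasurableSpace Ω] {μ : Measure Ω} {T h₀ : ℕ}
  {W : ℤ → Ω → Matrix (Fin a) (Fin b) ℝ} {Φ : ℤ → Ω → Matrix (Fin k) (Fin r) ℝ}

theorem dotProduct_popM_mulVec (μ : Measure Ω) (T h₀ : ℕ)
    (W : ℤ → Ω → Matrix (Fin a) (Fin b) ℝ) (v : Fin a → ℝ) :
    v ⬝ᵥ (popM μ T h₀ W *ᵥ v) = ∑ h ∈ Finset.Icc 1 h₀, ∑ i, ∑ j,
      ((colLagCov μ T h W i j)ᵀ *ᵥ v) ⬝ᵥ ((colLagCov μ T h W i j)ᵀ *ᵥ v) := by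
  have hgram : ∀ A : Matrix (Fin a) (Fin a) ℝ,
      v ⬝ᵥ ((A * Aᵀ) *ᵥ v) = (Aᵀ *ᵥ v) ⬝ᵥ (Aᵀ *ᵥ v) := fun A => by
    rw [← Matrix.mulVec_mulVec, Matrix.dotProduct_mulVec, ← Matrix.mulVec_transpose]
  simp only [popM, Matrix.sum_mulVec, dotProduct_sum, hgram, colLagCov]

theorem rank_popM_le (hW : ∀ h ∈ Finset.Icc 1 h₀, ∀ i j,
    colLagCov μ T h W i j = loadedCov L N (colLagCov μ T h Φ) i j) :
    (popM μ T h₀ W).rank ≤ k := by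
  have hfactor : popM μ T h₀ W = L * ∑ h ∈ Finset.Icc 1 h₀, ∑ i, ∑ j,
      (∑ c, ∑ d, (N i c * N j d) • colLagCov μ T h Φ c d) * Lᵀ *
        (loadedCov L N (colLagCov μ T h Φ) i j)ᵀ := by
    simp only [Matrix.mul_sum]
    refine Finset.sum_congr rfl fun h hh => Finset.sum_congr rfl fun i _ =>
      Finset.sum_congr rfl fun j _ => ?_
    rw [← Matrix.mul_assoc, ← Matrix.mul_assoc]
    exact congrArg (fun M => M * Mᵀ) (hW h hh i j)
  rw [hfactor]
  exact (Matrix.rank_mul_le_left _ _).trans (Matrix.rank_le_width L)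

theorem mul_dotProduct_le_dotProduct_popM_mulVec (hW : ∀ h ∈ Finset.Icc 1 h₀, ∀ i j,
      colLagCov μ T h W i j = loadedCov L N (colLagCov μ T h Φ) i j)
    {c : ℝ} (hc₀ : 0 ≤ c) (hc : c ≤ nthEig (popM μ T h₀ Φ) (k - 1)) (z : Fin k → ℝ) :
    c * (singVal L (k - 1) ^ 2) ^ 2 * (singVal N (r - 1) ^ 2) ^ 2 * ((L *ᵥ z) ⬝ᵥ (L *ᵥ z)) ≤
      (L *ᵥ z) ⬝ᵥ (popM μ T h₀ W *ᵥ (L *ᵥ z)) := by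
  set σL := singVal L (k - 1) ^ 2
  set σN := singVal N (r - 1) ^ 2
  set u := Lᵀ *ᵥ (L *ᵥ z)
  have hL : 0 ≤ σL := sq_nonneg _
  have hN : 0 ≤ σN := sq_nonneg _
  have hu₀ : 0 ≤ u ⬝ᵥ u := Finset.sum_nonneg fun i _ => mul_self_nonneg _
  calc c * σL ^ 2 * σN ^ 2 * ((L *ᵥ z) ⬝ᵥ (L *ᵥ z))
      = σL * (σN ^ 2 * (c * (σL * ((L *ᵥ z) ⬝ᵥ (L *ᵥ z))))) := by ring
    _ ≤ σL * (σN ^ 2 * (c * (u ⬝ᵥ u))) := by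
      gcongr
      exact mul_dotProduct_mulVec_self_le hL (singVal_sq_mul_dotProduct_self_le L) z
    _ ≤ σL * (σN ^ 2 * (u ⬝ᵥ (popM μ T h₀ Φ *ᵥ u))) := by
      gcongr
      exact (mul_le_mul_of_nonneg_right hc hu₀).trans
        (nthEig_mul_dotProduct_self_le (popM_isHermitian μ T h₀ Φ) u)
    _ ≤ (L *ᵥ z) ⬝ᵥ (popM μ T h₀ W *ᵥ (L *ᵥ z)) := by
      rw [dotProduct_popM_mulVec, dotProduct_popM_mulVec, Finset.mul_sum, Finset.mul_sum]
      refine Finset.sum_le_sum fun h hh => ?_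
      simp only [hW h hh]
      exact mul_sum_dotProduct_self_le_loadedCov hL hN (singVal_sq_mul_dotProduct_self_le L)
        (singVal_sq_mul_dotProduct_self_le N) _ _

theorem le_nthEig_popM (hW : ∀ h ∈ Finset.Icc 1 h₀, ∀ i j,
      colLagCov μ T h W i j = loadedCov L N (colLagCov μ T h Φ) i j)
    (hL : 0 < singVal L (k - 1)) {c : ℝ} (hc₀ : 0 ≤ c)
    (hc : c ≤ nthEig (popM μ T h₀ Φ) (k - 1)) {j : ℕ} (hj : j < k) :
    c * (singVal L (k - 1) ^ 2) ^ 2 * (singVal N (r - 1) ^ 2) ^ 2 ≤ nthEig (popM μ T h₀ W) j :=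
  le_nthEig (popM_isHermitian μ T h₀ W) (mulVec_injective_of_singVal_pos hL)
    (mul_dotProduct_le_dotProduct_popM_mulVec hW hc₀ hc) hj

end Loaded

/-! ### The common component and its moments -/

namespace Model

variable {k r m : ℕ} {Ω : Type*} [mΩ : MeasurableSpace Ω] (S : Model k r m Ω)

instance : IsProbabilityMeasure S.μ := S.isProb

theorem W_apply (t : ℤ) (ω : Ω) (x : Fin S.p) (i : Fin S.q) :
    S.W t ω x i = ∑ e : Fin k × Fin r, S.R x e.1 * S.C i e.2 * S.F t ω e.1 e.2 + S.E t ω x i := by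
  simp only [W, Matrix.add_apply, Matrix.mul_apply, Fintype.sum_prod_type, Finset.sum_mul,
    Matrix.transpose_apply]
  rw [Finset.sum_comm]
  congr 1
  exact Finset.sum_congr rfl fun a _ => Finset.sum_congr rfl fun b _ => by ring

theorem Y_eq (t : ℤ) (ω : Ω) : S.Y t ω = S.A * S.X t ω + S.W t ω := by
  rw [Y, W, add_assoc]

theorem measurable_W (t : ℤ) (x : Fin S.p) (i : Fin S.q) : Measurable fun ω => S.W t ω x i := by
  simp only [W_apply]
  exact (Finset.measurable_sum _ fun e _ => (S.measurable_F t _ _).const_mul _).add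
    (S.measurable_E t x i)

theorem measurable_Y (t : ℤ) (x : Fin S.p) (i : Fin S.q) : Measurable fun ω => S.Y t ω x i := by
  simp only [Y_eq, Matrix.add_apply, Matrix.mul_apply]
  exact (Finset.measurable_sum _ fun e _ => (S.measurable_X t _ _).const_mul _).add
    (S.measurable_W t x i)

theorem obsSigma_le (t : ℤ) : S.obsSigma t ≤ mΩ :=
  sup_le (sup_le (iSup₂_le fun i j => (S.measurable_Y t i j).comap_le)
    (iSup₂_le fun i j => (S.measurable_X t i j).comap_le))
    (iSup₂_le fun i j => (S.measurable_F t i j).comap_le)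

theorem measurable_obsSigma_Y (t : ℤ) (i : Fin S.p) (j : Fin S.q) :
    Measurable[S.obsSigma t] fun ω => S.Y t ω i j :=
  (comap_measurable _).mono
    ((le_iSup₂ (f := fun i j => MeasurableSpace.comap (fun ω => S.Y t ω i j) inferInstance)
      i j).trans (le_sup_left.trans le_sup_left)) le_rfl

theorem measurable_obsSigma_X (t : ℤ) (i : Fin m) (j : Fin S.q) :
    Measurable[S.obsSigma t] fun ω => S.X t ω i j :=
  (comap_measurable _).mono
    ((le_iSup₂ (f := fun i j => MeasurableSpace.comap (fun ω => S.X t ω i j) inferInstance)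
      i j).trans (le_sup_right.trans le_sup_left)) le_rfl

theorem measurable_obsSigma_W (t : ℤ) (x : Fin S.p) (i : Fin S.q) :
    Measurable[S.obsSigma t] fun ω => S.W t ω x i := by
  have : (fun ω => S.W t ω x i) = fun ω => S.Y t ω x i - ∑ l, S.A x l * S.X t ω l i := by
    ext ω
    rw [Y_eq, Matrix.add_apply, Matrix.mul_apply, add_sub_cancel_left]
  rw [this]
  exact (S.measurable_obsSigma_Y t x i).sub
    (Finset.measurable_sum _ fun l _ => (S.measurable_obsSigma_X t l i).const_mul _)

/-- The entries of `F_t`, `X_t` and `E_t`, `t = 1, …, T`, have absolute moments of order `s` at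
most `D`. -/
def MomentsLe (s D : ℝ) : Prop :=
  ∀ t ∈ S.times,
    (∀ i j, MomentLe S.μ (fun ω => S.F t ω i j) s D) ∧
    (∀ l g, MomentLe S.μ (fun ω => S.X t ω l g) s D) ∧
    (∀ u g, MomentLe S.μ (fun ω => S.E t ω u g) s D)

/-- The scale of the entry `(x, i)` of `W_t`: the sum of the absolute values of the coefficients
of the entries of `F_t` and `E_t` in it, so that the entry divided by its scale has moments as
small as theirs. -/
def scale (x : Fin S.p) (i : Fin S.q) : ℝ := 1 + ∑ e : Fin k × Fin r, |S.R x e.1 * S.C i e.2|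

theorem scale_pos (x : Fin S.p) (i : Fin S.q) : 0 < S.scale x i := by
  unfold scale
  positivity

open scoped Matrix.Norms.Frobenius in
theorem sum_scale_sq_le :
    ∑ x, ∑ i, S.scale x i ^ 2 ≤ 2 * (S.p * S.q + k * r * (‖S.R‖ ^ 2 * ‖S.C‖ ^ 2)) := by
  have hsq : ∀ x i, S.scale x i ^ 2 ≤
      2 * (1 + k * r * ∑ e : Fin k × Fin r, S.R x e.1 ^ 2 * S.C i e.2 ^ 2) := fun x i => by
    have hcs := sq_sum_le_card_mul_sum_sq (s := Finset.univ)
      (f := fun e : Fin k × Fin r => |S.R x e.1 * S.C i e.2|)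
    simp only [sq_abs, mul_pow, Finset.card_univ, Fintype.card_prod, Fintype.card_fin,
      Nat.cast_mul] at hcs
    have hadd := add_sq_le (a := 1) (b := ∑ e : Fin k × Fin r, |S.R x e.1 * S.C i e.2|)
    unfold scale
    linarith
  have hRC : ∑ x, ∑ i, ∑ e : Fin k × Fin r, S.R x e.1 ^ 2 * S.C i e.2 ^ 2 =
      ‖S.R‖ ^ 2 * ‖S.C‖ ^ 2 := by
    simp only [frobenius_norm_sq, Finset.sum_mul_sum, Fintype.sum_prod_type]
  calc _ ≤ ∑ x, ∑ i, 2 * (1 + k * r * ∑ e : Fin k × Fin r, S.R x e.1 ^ 2 * S.C i e.2 ^ 2) :=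
        Finset.sum_le_sum fun x _ => Finset.sum_le_sum fun i _ => hsq x i
    _ = _ := by
      simp only [← Finset.mul_sum, Finset.sum_add_distrib, hRC, Finset.sum_const,
        Finset.card_univ, Fintype.card_fin, nsmul_eq_mul, mul_one]

variable {S}

theorem MomentsLe.W {s D : ℝ} (hs : 1 ≤ s) (hM : S.MomentsLe s D) {t : ℤ} (ht : t ∈ S.times)
    (x : Fin S.p) (i : Fin S.q) :
    MomentLe S.μ (fun ω => S.W t ω x i / S.scale x i) s D := by
  obtain ⟨hF, -, hE⟩ := hM t ht
  have hpos := S.scale_pos x i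
  set w : Option (Fin k × Fin r) → ℝ := fun o =>
    o.elim (S.scale x i)⁻¹ fun e => S.R x e.1 * S.C i e.2 / S.scale x i with hw
  set z : Option (Fin k × Fin r) → Ω → ℝ := fun o ω =>
    o.elim (S.E t ω x i) fun e => S.F t ω e.1 e.2 with hz
  have hwz : (fun ω => S.W t ω x i / S.scale x i) = fun ω => ∑ o, w o * z o ω := by
    ext ω
    simp only [hw, hz, Fintype.sum_option, Option.elim, W_apply, add_div, Finset.sum_div]
    rw [add_comm]
    congr 1
    · ring
    · exact Finset.sum_congr rfl fun e _ => by ring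
  rw [hwz]
  refine MomentLe.sum_mul hs ?_ (fun o _ => ?_) fun o => ?_
  · simp only [hw, Fintype.sum_option, Option.elim, abs_div, abs_inv, abs_of_pos hpos,
      ← Finset.sum_div]
    rw [← one_div, ← add_div]
    exact div_self hpos.ne'
  · cases o with
    | none => exact hE x i
    | some e => exact hF e.1 e.2
  · cases o with
    | none => exact S.measurable_E t x i
    | some e => exact S.measurable_F t e.1 e.2

variable (S) in
theorem W_eq_add (t : ℤ) (x : Fin S.p) (i : Fin S.q) : (fun ω => S.W t ω x i) =
    (fun ω => ∑ e : Fin k × Fin r, S.R x e.1 * S.C i e.2 * S.F t ω e.1 e.2) +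
      fun ω => S.E t ω x i := by
  ext ω
  rw [W_apply, Pi.add_apply]

section Covariances

variable {s D : ℝ} (hs : 2 ≤ s) (hM : S.MomentsLe s D) (hS : S.Standing)
include hs hM

theorem MomentsLe.memLp_F {t : ℤ} (ht : t ∈ S.times) (i : Fin k) (j : Fin r) :
    MemLp (fun ω => S.F t ω i j) 2 S.μ :=
  ((hM t ht).1 i j).memLp_two hs (S.measurable_F t i j)

theorem MomentsLe.memLp_X {t : ℤ} (ht : t ∈ S.times) (i : Fin m) (j : Fin S.q) :
    MemLp (fun ω => S.X t ω i j) 2 S.μ :=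
  ((hM t ht).2.1 i j).memLp_two hs (S.measurable_X t i j)

theorem MomentsLe.memLp_E {t : ℤ} (ht : t ∈ S.times) (i : Fin S.p) (j : Fin S.q) :
    MemLp (fun ω => S.E t ω i j) 2 S.μ :=
  ((hM t ht).2.2 i j).memLp_two hs (S.measurable_E t i j)

theorem MomentsLe.memLp_common {t : ℤ} (ht : t ∈ S.times) (c : Fin k × Fin r → ℝ) :
    MemLp (fun ω => ∑ e : Fin k × Fin r, c e * S.F t ω e.1 e.2) 2 S.μ :=
  memLp_finsetSum _ fun e _ => (hM.memLp_F hs ht e.1 e.2).const_mul _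

theorem MomentsLe.memLp_W {t : ℤ} (ht : t ∈ S.times) (x : Fin S.p) (i : Fin S.q) :
    MemLp (fun ω => S.W t ω x i) 2 S.μ := by
  rw [S.W_eq_add]
  exact (hM.memLp_common hs ht _).add (hM.memLp_E hs ht x i)

include hS

theorem MomentsLe.integral_W {t : ℤ} (ht : t ∈ S.times) (x : Fin S.p) (i : Fin S.q) :
    ∫ ω, S.W t ω x i ∂S.μ = 0 := by
  simp only [W_apply]
  rw [integral_add ((hM.memLp_common hs ht _).integrable one_le_two)
    ((hM.memLp_E hs ht x i).integrable one_le_two), hS.mean_E t ht, add_zero,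
    integral_finsetSum _ fun e _ =>
      ((hM.memLp_F hs ht e.1 e.2).integrable one_le_two).const_mul _]
  refine Finset.sum_eq_zero fun e _ => ?_
  rw [integral_const_mul, hS.mean_F t ht, mul_zero]

theorem MomentsLe.cov_W_X {t : ℤ} (ht : t ∈ S.times) (x : Fin S.p) (i : Fin S.q) (l : Fin m) :
    cov[fun ω => S.W t ω x i, fun ω => S.X t ω l i; S.μ] = 0 := by
  rw [S.W_eq_add, covariance_add_left (hM.memLp_common hs ht _) (hM.memLp_E hs ht x i)
    (hM.memLp_X hs ht l i), hS.cov_E_X t ht, add_zero,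
    covariance_fun_sum_left
      (X := fun (e : Fin k × Fin r) ω => S.R x e.1 * S.C i e.2 * S.F t ω e.1 e.2)
      (fun e => (hM.memLp_F hs ht e.1 e.2).const_mul _) (hM.memLp_X hs ht l i)]
  refine Finset.sum_eq_zero fun e _ => ?_
  rw [covariance_const_mul_left, hS.cov_F_X t ht, mul_zero]

theorem MomentsLe.cov_W_W {t u : ℤ} (ht : t ∈ S.times) (hu : u ∈ S.times) (htu : t ≠ u)
    (x y : Fin S.p) (i j : Fin S.q) :
    cov[fun ω => S.W t ω x i, fun ω => S.W u ω y j; S.μ] =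
      ∑ e : Fin k × Fin r, ∑ f : Fin k × Fin r, (S.R x e.1 * S.C i e.2) * (S.R y f.1 * S.C j f.2) *
        cov[fun ω => S.F t ω e.1 e.2, fun ω => S.F u ω f.1 f.2; S.μ] := by
  have hFt := hM.memLp_common hs ht fun e => S.R x e.1 * S.C i e.2
  have hFu := hM.memLp_common hs hu fun e => S.R y e.1 * S.C j e.2
  have hEt := hM.memLp_E hs ht x i
  have hEu := hM.memLp_E hs hu y j
  set U : Fin k × Fin r → Ω → ℝ := fun e ω => S.R x e.1 * S.C i e.2 * S.F t ω e.1 e.2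
  set U' : Fin k × Fin r → Ω → ℝ := fun e ω => S.R y e.1 * S.C j e.2 * S.F u ω e.1 e.2
  have hU : ∀ e, MemLp (U e) 2 S.μ := fun e => (hM.memLp_F hs ht e.1 e.2).const_mul _
  have hU' : ∀ e, MemLp (U' e) 2 S.μ := fun e => (hM.memLp_F hs hu e.1 e.2).const_mul _
  rw [S.W_eq_add, S.W_eq_add, covariance_add_left hFt hEt (hFu.add hEu),
    covariance_add_right hFt hFu hEu, covariance_add_right hEt hFu hEu, hS.white_E t ht u hu htu,
    covariance_fun_sum_right (X := U') hU' hEt, covariance_fun_sum_left (X := U) hU hEu,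
    covariance_fun_sum_fun_sum (X := U) (Y := U') hU hU']
  rw [Finset.sum_eq_zero (f := fun e => cov[U e, fun ω => S.E u ω y j; S.μ])
      fun e _ => by rw [covariance_const_mul_left, covariance_comm, hS.cov_E_F u hu t ht, mul_zero],
    Finset.sum_eq_zero (f := fun e => cov[fun ω => S.E t ω x i, U' e; S.μ])
      fun e _ => by rw [covariance_const_mul_right, hS.cov_E_F t ht u hu, mul_zero]]
  simp only [add_zero]
  refine Finset.sum_congr rfl fun e _ => Finset.sum_congr rfl fun f _ => ?_
  rw [covariance_const_mul_left, covariance_const_mul_right]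
  ring

end Covariances
end Model

/-! ### Mean square errors of the sample second moments -/

open scoped Matrix.Norms.Frobenius Kronecker

theorem covariance_eq_integral_mul {Ω : Type*} [MeasurableSpace Ω] {μ : Measure Ω} {U V : Ω → ℝ}
    (hU : ∫ ω, U ω ∂μ = 0) (hV : ∫ ω, V ω ∂μ = 0) : cov[U, V; μ] = ∫ ω, U ω * V ω ∂μ := by
  simp [covariance, hU, hV]

theorem frobenius_norm_sq_kronecker {ι κ ι' κ' : Type*} [Fintype ι] [Fintype κ] [Fintype ι']
    [Fintype κ'] (M : Matrix ι κ ℝ) (N : Matrix ι' κ' ℝ) :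
    ‖M ⊗ₖ N‖ ^ 2 = ‖M‖ ^ 2 * ‖N‖ ^ 2 := by
  simp only [frobenius_norm_sq, Matrix.kroneckerMap_apply, Fintype.sum_prod_type, mul_pow,
    Finset.sum_mul_sum]

theorem frobenius_norm_sq_le_card_mul {ι κ : Type*} [Fintype ι] [Fintype κ] {M : Matrix ι κ ℝ}
    {c : ℝ} (hM : ∀ i j, |M i j| ≤ c) :
    ‖M‖ ^ 2 ≤ Fintype.card ι * Fintype.card κ * c ^ 2 := by
  rw [frobenius_norm_sq, mul_assoc, ← nsmul_eq_mul, ← nsmul_eq_mul, Fintype.card, Fintype.card]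
  exact Finset.sum_le_card_nsmul _ _ _ fun i _ => Finset.sum_le_card_nsmul _ _ _ fun j _ =>
    sq_le_sq.2 ((hM i j).trans (le_abs_self c))

theorem MeanLe.norm_sq {Ω ι κ : Type*} [MeasurableSpace Ω] {μ : Measure Ω} [Fintype ι]
    [Fintype κ] {V : Ω → Matrix ι κ ℝ} {c : ι → κ → ℝ}
    (h : ∀ i j, MeanLe μ (fun ω => V ω i j ^ 2) (c i j)) :
    MeanLe μ (fun ω => ‖V ω‖ ^ 2) (∑ i, ∑ j, c i j) := by
  simp only [frobenius_norm_sq]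
  exact MeanLe.sum fun i _ => MeanLe.sum fun j _ => h i j

theorem abs_avg_le {T h : ℕ} (hh : h < T) {f : ℤ → ℝ} {c : ℝ}
    (hf : ∀ t ∈ Finset.Icc (1 : ℤ) (T - h), |f t| ≤ c) :
    |((T : ℝ) - h)⁻¹ * ∑ t ∈ Finset.Icc (1 : ℤ) (T - h), f t| ≤ c := by
  have hpos : 0 < (T : ℝ) - h := sub_pos.2 (by exact_mod_cast hh)
  have hcard : ((Finset.Icc (1 : ℤ) (T - h)).card : ℝ) = T - h := by
    rw [Int.card_Icc, show (T : ℤ) - h + 1 - 1 = ((T - h : ℕ) : ℤ) by omega, Int.toNat_natCast,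
      Nat.cast_sub hh.le]
  rw [abs_mul, abs_of_pos (inv_pos.2 hpos), inv_mul_le_iff₀ hpos, ← hcard, ← nsmul_eq_mul]
  exact (Finset.abs_sum_le_sum_abs _ _).trans (Finset.sum_le_card_nsmul _ _ _ hf)

namespace Model

variable {k r m : ℕ} {Ω : Type*} [mΩ : MeasurableSpace Ω] (S : Model k r m Ω)

/-- The vectorization of `W_t`. -/
def vecW (t : ℤ) (ω : Ω) (e : Fin S.p × Fin S.q) : ℝ := S.W t ω e.1 e.2

/-- The averaged autocovariance of `vec W_t` at lag `h`: the analogue of `Sigmaf`. -/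
def lagCov (h : ℕ) : Matrix (Fin S.p × Fin S.q) (Fin S.p × Fin S.q) ℝ :=
  avgLagCov S.μ S.T h S.vecW S.vecW

/-- The error of the (infeasible) sample autocovariance of `vec W_t` at lag `h`. -/
def lagErr (h : ℕ) (ω : Ω) : Matrix (Fin S.p × Fin S.q) (Fin S.p × Fin S.q) ℝ :=
  avgLagProd S.T h (fun t => S.vecW t ω) (fun t => S.vecW t ω) - S.lagCov h

/-- The squared sample covariances of the entries of `W_t` and of `X_t` in the same column, summed
up: through them the noise enters the least squares estimator. -/
def crossErr (ω : Ω) : ℝ :=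
  ∑ x, ∑ g, ∑ l, ((S.T : ℝ)⁻¹ * ∑ t ∈ S.times, S.W t ω x g * S.X t ω l g) ^ 2

/-- The squared errors of the sample second moments of the regressors, summed up. -/
def regErr (ω : Ω) : ℝ :=
  ∑ l, ∑ l', ∑ g, ((S.T : ℝ)⁻¹ * ∑ t ∈ S.times, S.X t ω l g * S.X t ω l' g -
    (S.T : ℝ)⁻¹ * ∑ t ∈ S.times, ∫ ω, S.X t ω l g * S.X t ω l' g ∂S.μ) ^ 2

/-- The sum of the squared scales of the entries of `W_t`. -/
def scaleSq : ℝ := ∑ x, ∑ i, S.scale x i ^ 2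

variable {S}

theorem mem_times_of_mem_Icc {h : ℕ} {t : ℤ} (ht : t ∈ Finset.Icc (1 : ℤ) (S.T - h)) :
    t ∈ S.times ∧ t + h ∈ S.times := by
  rw [Finset.mem_Icc] at ht
  simp only [times, Finset.mem_Icc]
  omega

theorem meanLe_avg {f : ℤ → Ω → ℝ} {c : ℝ} (hT : 1 ≤ S.T)
    (hf : ∀ t ∈ S.times, MeanLe S.μ (f t) c) :
    MeanLe S.μ (fun ω => (S.T : ℝ)⁻¹ * ∑ t ∈ S.times, f t ω) c := by
  refine ((MeanLe.sum hf).const_mul (by positivity)).mono (le_of_eq ?_)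
  have hT₀ : (S.T : ℝ) ≠ 0 := by exact_mod_cast (by omega : S.T ≠ 0)
  rw [Finset.sum_const, nsmul_eq_mul, times, Int.card_Icc, add_sub_cancel_right,
    Int.toNat_natCast, inv_mul_cancel_left₀ hT₀]

section Population

variable {s D : ℝ} {h : ℕ}

theorem lagCov_apply (hs : 2 ≤ s) (hM : S.MomentsLe s D) (hS : S.Standing) (hh : 1 ≤ h)
    (e f : Fin S.p × Fin S.q) :
    S.lagCov h e f = ∑ a : Fin k × Fin r, ∑ b : Fin k × Fin r,
      (S.R e.1 a.1 * S.C e.2 a.2) * (S.R f.1 b.1 * S.C f.2 b.2) * S.Sigmaf h a b := by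
  have hcov : ∀ t ∈ Finset.Icc (1 : ℤ) (S.T - h),
      cov[fun ω => S.vecW t ω e, fun ω => S.vecW (t + h) ω f; S.μ] =
        ∑ a : Fin k × Fin r, ∑ b : Fin k × Fin r,
          (S.R e.1 a.1 * S.C e.2 a.2) * (S.R f.1 b.1 * S.C f.2 b.2) *
            cov[fun ω => S.F t ω a.1 a.2, fun ω => S.F (t + h) ω b.1 b.2; S.μ] := fun t ht =>
    hM.cov_W_W hs hS (mem_times_of_mem_Icc ht).1 (mem_times_of_mem_Icc ht).2 (by omega) _ _ _ _
  simp only [lagCov, Sigmaf, avgLagCov, Matrix.of_apply]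
  rw [Finset.sum_congr rfl hcov, Finset.sum_comm, Finset.mul_sum]
  refine Finset.sum_congr rfl fun a _ => ?_
  rw [Finset.sum_comm, Finset.mul_sum]
  refine Finset.sum_congr rfl fun b _ => ?_
  rw [← Finset.mul_sum]
  ring

theorem lagCov_eq_kronecker (hs : 2 ≤ s) (hM : S.MomentsLe s D) (hS : S.Standing) (hh : 1 ≤ h) :
    S.lagCov h = (S.R ⊗ₖ S.C) * S.Sigmaf h * (S.R ⊗ₖ S.C)ᵀ := by
  ext e f
  rw [lagCov_apply hs hM hS hh, Finset.sum_comm]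
  simp only [Matrix.mul_apply, Matrix.transpose_apply, Matrix.kroneckerMap_apply, Finset.sum_mul]
  refine Finset.sum_congr rfl fun b _ => Finset.sum_congr rfl fun a _ => ?_
  ring

theorem colLagCov_W (hs : 2 ≤ s) (hM : S.MomentsLe s D) (hS : S.Standing) (hh : 1 ≤ h)
    (i j : Fin S.q) :
    colLagCov S.μ S.T h S.W i j = loadedCov S.R S.C (colLagCov S.μ S.T h S.F) i j := by
  ext x y
  rw [loadedCov_apply]
  exact lagCov_apply hs hM hS hh (x, i) (y, j)

theorem colLagCov_W_transpose (hs : 2 ≤ s) (hM : S.MomentsLe s D) (hS : S.Standing) (hh : 1 ≤ h)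
    (x y : Fin S.p) :
    colLagCov S.μ S.T h (fun t ω => (S.W t ω)ᵀ) x y =
      loadedCov S.C S.R (colLagCov S.μ S.T h fun t ω => (S.F t ω)ᵀ) x y := by
  ext i j
  rw [loadedCov_apply]
  refine (lagCov_apply hs hM hS hh (x, i) (y, j)).trans <|
    Fintype.sum_equiv (Equiv.prodComm _ _) _ _ fun a =>
      Fintype.sum_equiv (Equiv.prodComm _ _) _ _ fun b => ?_
  simp only [Equiv.prodComm_apply, Prod.fst_swap, Prod.snd_swap]
  rw [mul_comm (S.C i a.2), mul_comm (S.C j b.2)]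
  rfl

theorem abs_Sigmaf_le (hs : 2 ≤ s) (hM : S.MomentsLe s D) (hh : h < S.T) (a b : Fin k × Fin r) :
    |S.Sigmaf h a b| ≤ 1 + D :=
  abs_avg_le hh fun t ht =>
    ((hM t (mem_times_of_mem_Icc ht).1).1 a.1 a.2).abs_cov_le
      ((hM _ (mem_times_of_mem_Icc ht).2).1 b.1 b.2) hs (S.measurable_F _ _ _)
      (S.measurable_F _ _ _)

theorem norm_lagCov_sq_le (hs : 2 ≤ s) (hM : S.MomentsLe s D) (hS : S.Standing) (hh : 1 ≤ h)
    (hhT : h < S.T) :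
    ‖S.lagCov h‖ ^ 2 ≤ (k * r * (1 + D) * (‖S.R‖ ^ 2 * ‖S.C‖ ^ 2)) ^ 2 := by
  have hSigma := frobenius_norm_sq_le_card_mul (abs_Sigmaf_le hs hM hhT)
  simp only [Fintype.card_prod, Fintype.card_fin, Nat.cast_mul] at hSigma
  have hmul : ‖S.lagCov h‖ ≤ ‖S.R ⊗ₖ S.C‖ * ‖S.Sigmaf h‖ * ‖S.R ⊗ₖ S.C‖ := by
    rw [lagCov_eq_kronecker hs hM hS hh, ← Matrix.frobenius_norm_transpose (S.R ⊗ₖ S.C)]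
    refine (Matrix.frobenius_norm_mul _ _).trans ?_
    rw [Matrix.frobenius_norm_transpose]
    gcongr
    exact Matrix.frobenius_norm_mul _ _
  calc ‖S.lagCov h‖ ^ 2 ≤ (‖S.R ⊗ₖ S.C‖ * ‖S.Sigmaf h‖ * ‖S.R ⊗ₖ S.C‖) ^ 2 := by gcongr
    _ = (‖S.R ⊗ₖ S.C‖ ^ 2) ^ 2 * ‖S.Sigmaf h‖ ^ 2 := by ring
    _ ≤ (‖S.R‖ ^ 2 * ‖S.C‖ ^ 2) ^ 2 * (k * r * (k * r) * (1 + D) ^ 2) := by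
      rw [frobenius_norm_sq_kronecker]
      gcongr
    _ = _ := by ring

end Population

section Errors

variable {γ D B : ℝ}

theorem meanLe_norm_lagErr_sq (hγ : 2 < γ) (hM : S.MomentsLe (2 * γ) D) (hS : S.Standing)
    (hmix : MixingSumLe S.μ S.obsSigma γ B) (hT : 1 ≤ S.T) {h : ℕ} (hhT : 2 * h ≤ S.T) :
    MeanLe S.μ (fun ω => ‖S.lagErr h ω‖ ^ 2)
      (S.scaleSq ^ 2 * (2 * varConst (2 * D) h B / S.T)) := by
  have hlagCov : ∀ e f, S.lagCov h e f = ((S.T : ℝ) - h)⁻¹ *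
      ∑ t ∈ Finset.Icc (1 : ℤ) (S.T - h),
        ∫ ω, S.W t ω e.1 e.2 * S.W (t + h) ω f.1 f.2 ∂S.μ := fun e f => by
    rw [lagCov, avgLagCov, Matrix.of_apply]
    congr 1
    exact Finset.sum_congr rfl fun t ht => covariance_eq_integral_mul
      (hM.integral_W (by linarith) hS (mem_times_of_mem_Icc ht).1 _ _)
      (hM.integral_W (by linarith) hS (mem_times_of_mem_Icc ht).2 _ _)
  refine (MeanLe.norm_sq (c := fun e f => S.scale e.1 e.2 ^ 2 * S.scale f.1 f.2 ^ 2 *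
    (2 * varConst (2 * D) h B / S.T)) fun e f => ?_).mono (le_of_eq ?_)
  · simp only [lagErr, Matrix.sub_apply, hlagCov]
    exact meanLe_sq_avg_mul_sub_avg_integral_mul S.obsSigma_le hγ hmix hT hhT
      (fun t => S.measurable_obsSigma_W t e.1 e.2) (fun t => S.measurable_obsSigma_W t f.1 f.2)
      (S.scale_pos e.1 e.2) (S.scale_pos f.1 f.2) (fun t ht => hM.W (by linarith) ht e.1 e.2)
      (fun t ht => hM.W (by linarith) ht f.1 f.2)
  · simp only [← Finset.sum_mul, ← Finset.mul_sum, scaleSq, Fintype.sum_prod_type, sq]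

theorem meanLe_crossErr (hγ : 2 < γ) (hM : S.MomentsLe (2 * γ) D) (hS : S.Standing)
    (hmix : MixingSumLe S.μ S.obsSigma γ B) (hT : 1 ≤ S.T) :
    MeanLe S.μ S.crossErr (m * S.scaleSq * (2 * varConst (2 * D) 0 B / S.T)) := by
  have hWX : ∀ x g l, ∑ t ∈ Finset.Icc (1 : ℤ) S.T, ∫ ω, S.W t ω x g * S.X t ω l g ∂S.μ = 0 :=
    fun x g l => Finset.sum_eq_zero fun t ht => by
      have hcov := hM.cov_W_X (by linarith) hS ht x g l
      rwa [covariance_eq_sub (hM.memLp_W (by linarith) ht x g) (hM.memLp_X (by linarith) ht l g),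
        hM.integral_W (by linarith) hS ht, zero_mul, sub_zero] at hcov
  refine (MeanLe.sum fun x _ => MeanLe.sum fun g _ => MeanLe.sum (c := fun l =>
    S.scale x g ^ 2 * 1 ^ 2 * (2 * varConst (2 * D) 0 B / S.T)) fun l _ => ?_).mono (le_of_eq ?_)
  · have hbound := meanLe_sq_avg_mul_sub_avg_integral_mul (h := 0) S.obsSigma_le hγ hmix hT
      (by omega) (fun t => S.measurable_obsSigma_W t x g) (fun t => S.measurable_obsSigma_X t l g)
      (S.scale_pos x g) one_pos (fun t ht => hM.W (by linarith) ht x g)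
      (fun t ht => by simpa only [div_one] using (hM t ht).2.1 l g)
    simpa only [times, Nat.cast_zero, sub_zero, add_zero, hWX, mul_zero] using hbound
  · simp only [one_pow, mul_one, Finset.sum_const, Finset.card_univ, Fintype.card_fin,
      nsmul_eq_mul, ← Finset.mul_sum, ← Finset.sum_mul, scaleSq, mul_assoc]

theorem meanLe_regErr (hγ : 2 < γ) (hM : S.MomentsLe (2 * γ) D)
    (hmix : MixingSumLe S.μ S.obsSigma γ B) (hT : 1 ≤ S.T) :
    MeanLe S.μ S.regErr (m * m * S.q * (2 * varConst (2 * D) 0 B / S.T)) := by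
  refine (MeanLe.sum fun l _ => MeanLe.sum fun l' _ => MeanLe.sum (c := fun g =>
    1 ^ 2 * 1 ^ 2 * (2 * varConst (2 * D) 0 B / S.T)) fun g _ => ?_).mono (le_of_eq ?_)
  · have hbound := meanLe_sq_avg_mul_sub_avg_integral_mul (h := 0) S.obsSigma_le hγ hmix hT
      (by omega) (fun t => S.measurable_obsSigma_X t l g)
      (fun t => S.measurable_obsSigma_X t l' g) one_pos one_pos
      (fun t ht => by simpa only [div_one] using (hM t ht).2.1 l g)
      (fun t ht => by simpa only [div_one] using (hM t ht).2.1 l' g)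
    simpa only [times, Nat.cast_zero, sub_zero, add_zero] using hbound
  · simp only [one_pow, one_mul, Finset.sum_const, Finset.card_univ, Fintype.card_fin,
      nsmul_eq_mul, mul_assoc]

theorem meanLe_avg_norm_X_sq {s : ℝ} (hs : 2 ≤ s) (hM : S.MomentsLe s D) (hT : 1 ≤ S.T) :
    MeanLe S.μ (fun ω => (S.T : ℝ)⁻¹ * ∑ t ∈ S.times, ‖S.X t ω‖ ^ 2) (m * S.q * (1 + D)) := by
  refine meanLe_avg hT fun t ht => (MeanLe.norm_sq fun l g =>
    ((hM t ht).2.1 l g).meanLe_sq hs (S.measurable_X t l g)).mono (le_of_eq ?_)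
  simp only [Finset.sum_const, Finset.card_univ, Fintype.card_fin, nsmul_eq_mul, mul_assoc]

theorem meanLe_avg_norm_W_sq {s : ℝ} (hs : 2 ≤ s) (hM : S.MomentsLe s D) (hT : 1 ≤ S.T) :
    MeanLe S.μ (fun ω => (S.T : ℝ)⁻¹ * ∑ t ∈ S.times, ‖S.W t ω‖ ^ 2) (S.scaleSq * (1 + D)) := by
  refine meanLe_avg hT fun t ht => (MeanLe.norm_sq (c := fun x g => S.scale x g ^ 2 * (1 + D))
    fun x g => ?_).mono (le_of_eq ?_)
  · have hmean := ((hM.W (by linarith) ht x g).meanLe_sq hs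
      ((S.measurable_W t x g).div_const _)).const_mul (sq_nonneg (S.scale x g))
    simpa only [← mul_pow, mul_div_cancel₀ _ (S.scale_pos x g).ne'] using hmean
  · simp only [← Finset.sum_mul, scaleSq]

end Errors

end Model

/-! ### Deterministic error bounds -/

section LaggedProducts

variable {α β : Type*} {T h : ℕ}

theorem inv_sub_le_two_mul_inv (hT : 1 ≤ T) (hhT : 2 * h ≤ T) :
    ((T : ℝ) - h)⁻¹ ≤ 2 * (T : ℝ)⁻¹ := by
  have hT₀ : (0 : ℝ) < T := by exact_mod_cast hT
  have hhT' : (2 * h : ℝ) ≤ T := by exact_mod_cast hhT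
  calc ((T : ℝ) - h)⁻¹ ≤ ((T : ℝ) / 2)⁻¹ := inv_anti₀ (half_pos hT₀) (by linarith)
    _ = 2 * (T : ℝ)⁻¹ := by rw [inv_div, div_eq_mul_inv]

theorem sum_Icc_sub_le {f : ℤ → ℝ} (hf : ∀ t, 0 ≤ f t) :
    ∑ t ∈ Finset.Icc (1 : ℤ) (T - h), f t ≤ ∑ t ∈ Finset.Icc (1 : ℤ) T, f t :=
  Finset.sum_le_sum_of_subset_of_nonneg (Finset.Icc_subset_Icc_right (by omega)) fun t _ _ => hf t

theorem sum_Icc_sub_add_le {f : ℤ → ℝ} (hf : ∀ t, 0 ≤ f t) :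
    ∑ t ∈ Finset.Icc (1 : ℤ) (T - h), f (t + h) ≤ ∑ t ∈ Finset.Icc (1 : ℤ) T, f t := by
  calc ∑ t ∈ Finset.Icc (1 : ℤ) (T - h), f (t + h)
      = ∑ t ∈ (Finset.Icc (1 : ℤ) (T - h)).map (addRightEmbedding (h : ℤ)), f t :=
        (Finset.sum_map _ (addRightEmbedding (h : ℤ)) f).symm
    _ ≤ ∑ t ∈ Finset.Icc (1 : ℤ) T, f t := by
        rw [Finset.map_add_right_Icc]
        exact Finset.sum_le_sum_of_subset_of_nonneg
          (Finset.Icc_subset_Icc (by omega) (by omega)) fun t _ _ => hf t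

theorem avg_mul_sq_le {ι : Type*} (s : Finset ι) (c : ℝ) (u v : ι → ℝ) :
    (c * ∑ t ∈ s, u t * v t) ^ 2 ≤ (c * ∑ t ∈ s, u t ^ 2) * (c * ∑ t ∈ s, v t ^ 2) := by
  calc (c * ∑ t ∈ s, u t * v t) ^ 2 = c ^ 2 * (∑ t ∈ s, u t * v t) ^ 2 := mul_pow _ _ 2
    _ ≤ c ^ 2 * ((∑ t ∈ s, u t ^ 2) * ∑ t ∈ s, v t ^ 2) :=
      mul_le_mul_of_nonneg_left (Finset.sum_mul_sq_le_sq_mul_sq s u v) (sq_nonneg c)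
    _ = _ := by ring

/-- The average of `|u_t|²` over `t = 1, …, T`. -/
def avgSq [Fintype α] (T : ℕ) (u : ℤ → α → ℝ) : ℝ :=
  (T : ℝ)⁻¹ * ∑ t ∈ Finset.Icc (1 : ℤ) T, ∑ e, u t e ^ 2

theorem avgSq_nonneg [Fintype α] (T : ℕ) (u : ℤ → α → ℝ) : 0 ≤ avgSq T u := by
  unfold avgSq
  positivity

theorem norm_avgLagProd_sq_le [Fintype α] [Fintype β] (hT : 1 ≤ T) (hhT : 2 * h ≤ T)
    (u : ℤ → α → ℝ) (v : ℤ → β → ℝ) :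
    ‖avgLagProd T h u v‖ ^ 2 ≤ 4 * (avgSq T u * avgSq T v) := by
  have hinv₀ : 0 ≤ ((T : ℝ) - h)⁻¹ :=
    inv_nonneg.2 (sub_nonneg.2 (by exact_mod_cast (by omega : h ≤ T)))
  have hu := sum_Icc_sub_le (T := T) (h := h) (f := fun t => ∑ e, u t e ^ 2)
    fun t => by positivity
  have hv := sum_Icc_sub_add_le (T := T) (h := h) (f := fun t => ∑ f, v t f ^ 2)
    fun t => by positivity
  set I := Finset.Icc (1 : ℤ) (T - h)
  calc ‖avgLagProd T h u v‖ ^ 2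
      ≤ ∑ e, ∑ f, (((T : ℝ) - h)⁻¹ * ∑ t ∈ I, u t e ^ 2) *
          (((T : ℝ) - h)⁻¹ * ∑ t ∈ I, v (t + h) f ^ 2) := by
        rw [frobenius_norm_sq]
        exact Finset.sum_le_sum fun e _ => Finset.sum_le_sum fun f _ => avg_mul_sq_le I _ _ _
    _ = (((T : ℝ) - h)⁻¹ * ∑ t ∈ I, ∑ e, u t e ^ 2) *
          (((T : ℝ) - h)⁻¹ * ∑ t ∈ I, ∑ f, v (t + h) f ^ 2) := by
        rw [← Finset.sum_mul_sum, ← Finset.mul_sum, ← Finset.mul_sum, Finset.sum_comm,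
          Finset.sum_comm (s := Finset.univ)]
    _ ≤ (2 * (T : ℝ)⁻¹ * ∑ t ∈ Finset.Icc (1 : ℤ) T, ∑ e, u t e ^ 2) *
          (2 * (T : ℝ)⁻¹ * ∑ t ∈ Finset.Icc (1 : ℤ) T, ∑ f, v t f ^ 2) := by
        have hinv := inv_sub_le_two_mul_inv hT hhT
        gcongr
    _ = 4 * (avgSq T u * avgSq T v) := by simp only [avgSq]; ring

theorem avgLagProd_sub_sub (v g : ℤ → α → ℝ) :
    avgLagProd T h (fun t => v t - g t) (fun t => v t - g t) =
      avgLagProd T h v v - avgLagProd T h g v - avgLagProd T h v g + avgLagProd T h g g := by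
  ext e f
  simp only [avgLagProd, Matrix.of_apply, Matrix.add_apply, Matrix.sub_apply, Pi.sub_apply]
  rw [← mul_sub, ← mul_sub, ← mul_add, ← Finset.sum_sub_distrib, ← Finset.sum_sub_distrib,
    ← Finset.sum_add_distrib]
  congr 1
  exact Finset.sum_congr rfl fun t _ => by ring

theorem norm_sub_sub_add_sq_le {E : Type*} [SeminormedAddCommGroup E] (a b c d : E) :
    ‖a - b - c + d‖ ^ 2 ≤ 4 * (‖a‖ ^ 2 + ‖b‖ ^ 2 + ‖c‖ ^ 2 + ‖d‖ ^ 2) := by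
  have htri : ‖a - b - c + d‖ ≤ ‖a‖ + ‖b‖ + ‖c‖ + ‖d‖ := by
    linarith [norm_add_le (a - b - c) d, norm_sub_le (a - b) c, norm_sub_le a b]
  calc ‖a - b - c + d‖ ^ 2 ≤ (‖a‖ + ‖b‖ + ‖c‖ + ‖d‖) ^ 2 := by gcongr
    _ ≤ _ := by
      linarith [sq_nonneg (‖a‖ - ‖b‖), sq_nonneg (‖a‖ - ‖c‖), sq_nonneg (‖a‖ - ‖d‖),
        sq_nonneg (‖b‖ - ‖c‖), sq_nonneg (‖b‖ - ‖d‖), sq_nonneg (‖c‖ - ‖d‖)]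

theorem norm_avgLagProd_sub_sub_sq_le [Fintype α] (hT : 1 ≤ T) (hhT : 2 * h ≤ T)
    {v g : ℤ → α → ℝ} {d u : ℝ} (hg : avgSq T g ≤ d) (hv : avgSq T v ≤ u) (Γ : Matrix α α ℝ) :
    ‖avgLagProd T h (fun t => v t - g t) (fun t => v t - g t) - Γ‖ ^ 2 ≤
      4 * (‖avgLagProd T h v v - Γ‖ ^ 2 + (8 * (d * u) + 4 * (d * d))) := by
  have hg₀ := avgSq_nonneg T g
  have hv₀ := avgSq_nonneg T v
  have hd₀ : 0 ≤ d := hg₀.trans hg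
  have hgv : avgSq T g * avgSq T v ≤ d * u := by gcongr
  have hgg : avgSq T g * avgSq T g ≤ d * d := by gcongr
  have hsplit : avgLagProd T h (fun t => v t - g t) (fun t => v t - g t) - Γ =
      avgLagProd T h v v - Γ - avgLagProd T h g v - avgLagProd T h v g + avgLagProd T h g g := by
    rw [avgLagProd_sub_sub]
    abel
  rw [hsplit]
  linarith [norm_sub_sub_add_sq_le (avgLagProd T h v v - Γ) (avgLagProd T h g v)
    (avgLagProd T h v g) (avgLagProd T h g g), norm_avgLagProd_sq_le hT hhT g v,
    norm_avgLagProd_sq_le hT hhT v g, norm_avgLagProd_sq_le hT hhT g g]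

end LaggedProducts

section SampleM

variable {a b k r T h₀ : ℕ} {Ω : Type*} [MeasurableSpace Ω] {μ : Measure Ω}
  {w : ℤ → Matrix (Fin a) (Fin b) ℝ} {W : ℤ → Ω → Matrix (Fin a) (Fin b) ℝ}

theorem sum_norm_sq_columns (G : Matrix (Fin a × Fin b) (Fin a × Fin b) ℝ) :
    ∑ i, ∑ j, ‖Matrix.of fun x y => G (x, i) (y, j)‖ ^ 2 = ‖G‖ ^ 2 := by
  simp only [frobenius_norm_sq, Fintype.sum_prod_type, Matrix.of_apply]
  rw [Finset.sum_congr rfl fun i _ => Finset.sum_comm, Finset.sum_comm]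
  exact Finset.sum_congr rfl fun x _ => Finset.sum_congr rfl fun i _ => Finset.sum_comm

theorem frobenius_norm_submatrix_equiv {ι κ ι' κ' : Type*} [Fintype ι] [Fintype κ] [Fintype ι']
    [Fintype κ'] (M : Matrix ι κ ℝ) (e : ι' ≃ ι) (f : κ' ≃ κ) : ‖M.submatrix e f‖ = ‖M‖ := by
  rw [← sq_eq_sq₀ (norm_nonneg _) (norm_nonneg _), frobenius_norm_sq, frobenius_norm_sq]
  exact Fintype.sum_equiv e _ _ fun i => Fintype.sum_equiv f _ _ fun j => rfl

theorem norm_sampleM_sub_popM_le {εS εP : ℝ} (hεS : 0 ≤ εS) (hεP : 0 ≤ εP)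
    (hpop : ∑ h ∈ Finset.Icc 1 h₀, ‖avgLagCov μ T h (fun t ω (e : Fin a × Fin b) => W t ω e.1 e.2)
      (fun t ω (e : Fin a × Fin b) => W t ω e.1 e.2)‖ ^ 2 ≤ εP ^ 2)
    (herr : ∑ h ∈ Finset.Icc 1 h₀, ‖avgLagProd T h (fun t (e : Fin a × Fin b) => w t e.1 e.2)
      (fun t (e : Fin a × Fin b) => w t e.1 e.2) -
        avgLagCov μ T h (fun t ω (e : Fin a × Fin b) => W t ω e.1 e.2)
          (fun t ω (e : Fin a × Fin b) => W t ω e.1 e.2)‖ ^ 2 ≤ εS ^ 2) :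
    ‖sampleM T h₀ w - popM μ T h₀ W‖ ≤ εS ^ 2 + 2 * εS * εP := by
  simp only [← sum_norm_sq_columns] at hpop herr
  have hbound := norm_sum_mul_transpose_sub_le
    (Finset.Icc 1 h₀ ×ˢ (Finset.univ : Finset (Fin b × Fin b)))
    (fun e => colLagCov μ T e.1 W e.2.1 e.2.2)
    (fun e => avgLagProd T e.1 (fun t x => w t x e.2.1) (fun t x => w t x e.2.2)) hεS hεP
    (by rw [Finset.sum_product]; simpa only [Fintype.sum_prod_type] using! hpop)
    (by rw [Finset.sum_product]; simpa only [Fintype.sum_prod_type] using! herr)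
  rw [Finset.sum_product, Finset.sum_product] at hbound
  simpa only [Fintype.sum_prod_type] using! hbound

theorem subspaceDist_le_of_loadedCov (hk : 1 ≤ k) {L : Matrix (Fin a) (Fin k) ℝ}
    {N : Matrix (Fin b) (Fin r) ℝ} {Φ : ℤ → Ω → Matrix (Fin k) (Fin r) ℝ}
    (hW : ∀ h ∈ Finset.Icc 1 h₀, ∀ i j,
      colLagCov μ T h W i j = loadedCov L N (colLagCov μ T h Φ) i j)
    {c s : ℝ} (hc₀ : 0 ≤ c) (hc : c ≤ nthEig (popM μ T h₀ Φ) (k - 1)) (hs : 0 < s)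
    (hsc : s ≤ c * (singVal L (k - 1) ^ 2) ^ 2 * (singVal N (r - 1) ^ 2) ^ 2)
    {Q Q' : Matrix (Fin a) (Fin k) ℝ} (hQ : IsLeadingEigenvectors (popM μ T h₀ W) Q)
    (hQ' : IsLeadingEigenvectors (sampleM T h₀ w) Q') :
    subspaceDist Q' Q ≤ 2 / s * ‖sampleM T h₀ w - popM μ T h₀ W‖ := by
  have hL : 0 < singVal L (k - 1) := by
    refine ((Matrix.toEuclideanLin L).singularValues_nonneg _).lt_of_ne fun h₀ => ?_
    rw [singVal, ← h₀] at hsc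
    simp only [ne_eq, OfNat.ofNat_ne_zero, not_false_eq_true, zero_pow, mul_zero, zero_mul] at hsc
    exact hs.not_ge hsc
  exact subspaceDist_le hk (popM_isHermitian μ T h₀ W) (rank_popM_le hW) hs
    (fun j hj => hsc.trans (le_nthEig_popM hW hL hc₀ hc hj)) (sampleM_isHermitian T h₀ w) hQ hQ'

end SampleM

section Quadratic

variable {ι : Type*} [Fintype ι]

theorem sq_mul_le_dotProduct_vecMul {M : Matrix ι ι ℝ} {κ : ℝ} (hκ : 0 ≤ κ)
    (hM : ∀ z, κ * (z ⬝ᵥ z) ≤ z ⬝ᵥ (M *ᵥ z)) (d : ι → ℝ) :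
    κ ^ 2 * (d ⬝ᵥ d) ≤ (d ᵥ* M) ⬝ᵥ (d ᵥ* M) := by
  have hd₀ : 0 ≤ d ⬝ᵥ d := dotProduct_star_self_nonneg _
  have hcs : (d ᵥ* M ⬝ᵥ d) ^ 2 ≤ (d ᵥ* M ⬝ᵥ d ᵥ* M) * (d ⬝ᵥ d) := by
    simpa only [dotProduct, ← sq] using Finset.sum_mul_sq_le_sq_mul_sq Finset.univ (d ᵥ* M) d
  have hMd := hM d
  rw [Matrix.dotProduct_mulVec] at hMd
  rcases hd₀.eq_or_lt with h₀ | hpos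
  · rw [← h₀, mul_zero]
    exact dotProduct_star_self_nonneg _
  · refine le_of_mul_le_mul_right ?_ hpos
    calc κ ^ 2 * (d ⬝ᵥ d) * (d ⬝ᵥ d) = (κ * (d ⬝ᵥ d)) ^ 2 := by ring
      _ ≤ (d ᵥ* M ⬝ᵥ d) ^ 2 := by gcongr
      _ ≤ (d ᵥ* M ⬝ᵥ d ᵥ* M) * (d ⬝ᵥ d) := hcs

theorem isUnit_det_of_mul_dotProduct_le [DecidableEq ι] {M : Matrix ι ι ℝ} {κ : ℝ} (hκ : 0 < κ)
    (hM : ∀ z, κ * (z ⬝ᵥ z) ≤ z ⬝ᵥ (M *ᵥ z)) : IsUnit M.det := by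
  rw [isUnit_iff_ne_zero]
  intro hdet
  obtain ⟨v, hv, hMv⟩ := Matrix.exists_mulVec_eq_zero_iff.2 hdet
  have hvv : κ * (v ⬝ᵥ v) ≤ 0 := by simpa only [hMv, dotProduct_zero] using hM v
  exact hv (dotProduct_self_eq_zero.1 <| le_antisymm
    (nonpos_of_mul_nonpos_right hvv hκ) (dotProduct_star_self_nonneg _))

theorem dotProduct_mulVec_self_le (M : Matrix ι ι ℝ) (z : ι → ℝ) :
    z ⬝ᵥ (M *ᵥ z) ≤ ‖M‖ * (z ⬝ᵥ z) := by
  have htrace : z ⬝ᵥ (M *ᵥ z) = (Mᵀ * Matrix.vecMulVec z z).trace := by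
    simp only [Matrix.trace, Matrix.diag_apply, Matrix.mul_apply, Matrix.vecMulVec_apply,
      Matrix.transpose_apply, dotProduct, Matrix.mulVec, Finset.mul_sum]
    rw [Finset.sum_comm]
    exact Finset.sum_congr rfl fun j _ => Finset.sum_congr rfl fun i _ => by ring
  have hnorm : ‖Matrix.vecMulVec z z‖ = z ⬝ᵥ z := by
    refine (sq_eq_sq₀ (norm_nonneg _) (dotProduct_star_self_nonneg z)).1 ?_
    rw [frobenius_norm_sq, sq (_ ⬝ᵥ z), star_trivial, dotProduct, Finset.sum_mul_sum]
    exact Finset.sum_congr rfl fun i _ => Finset.sum_congr rfl fun j _ => by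
      rw [Matrix.vecMulVec_apply]; ring
  rw [htrace, ← hnorm]
  exact trace_transpose_mul_le M _

theorem sub_mul_dotProduct_le {M N : Matrix ι ι ℝ} {κ ε : ℝ}
    (hN : ∀ z, κ * (z ⬝ᵥ z) ≤ z ⬝ᵥ (N *ᵥ z)) (hMN : ‖M - N‖ ≤ ε) (z : ι → ℝ) :
    (κ - ε) * (z ⬝ᵥ z) ≤ z ⬝ᵥ (M *ᵥ z) := by
  have hz₀ : 0 ≤ z ⬝ᵥ z := dotProduct_star_self_nonneg _
  have hdiff := dotProduct_mulVec_self_le (N - M) z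
  rw [Matrix.sub_mulVec, dotProduct_sub, norm_sub_rev] at hdiff
  linarith [hN z, mul_le_mul_of_nonneg_right hMN hz₀]

end Quadratic

namespace Model

variable {k r m : ℕ} {Ω : Type*} [MeasurableSpace Ω] (S : Model k r m Ω)

/-- The sample second moment `T⁻¹ ∑ X_t X_t'` of the regressors. -/
def regMoment (ω : Ω) : Matrix (Fin m) (Fin m) ℝ :=
  (S.T : ℝ)⁻¹ • ∑ t ∈ S.times, S.X t ω * (S.X t ω)ᵀ

/-- The sample cross moment `T⁻¹ ∑ W_t X_t'` of the noise and the regressors. -/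
def crossMoment (ω : Ω) : Matrix (Fin S.p) (Fin m) ℝ :=
  (S.T : ℝ)⁻¹ • ∑ t ∈ S.times, S.W t ω * (S.X t ω)ᵀ

/-- The error of the sample lag-`h` covariance of the vectorized residuals `Ŵ_t`. -/
def residErr (h : ℕ) (ω : Ω) : Matrix (Fin S.p × Fin S.q) (Fin S.p × Fin S.q) ℝ :=
  avgLagProd S.T h (fun t e => S.What ω t e.1 e.2) (fun t e => S.What ω t e.1 e.2) - S.lagCov h

variable {S} {ω : Ω}

theorem Ahat_sub_mul_regMoment (hdet : IsUnit (S.regMoment ω).det) :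
    (S.Ahat ω - S.A) * S.regMoment ω = S.crossMoment ω := by
  have hY : (S.T : ℝ)⁻¹ • ∑ t ∈ S.times, S.Y t ω * (S.X t ω)ᵀ =
      S.A * S.regMoment ω + S.crossMoment ω := by
    rw [regMoment, crossMoment, Matrix.mul_smul, Matrix.mul_sum, ← smul_add,
      ← Finset.sum_add_distrib]
    congr 1
    exact Finset.sum_congr rfl fun t _ => by rw [Y_eq, Matrix.add_mul, Matrix.mul_assoc]
  rw [Ahat, hY, ← regMoment, Matrix.sub_mul, Matrix.nonsing_inv_mul_cancel_right _ _ hdet,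
    add_sub_cancel_left]

theorem norm_crossMoment_sq_le : ‖S.crossMoment ω‖ ^ 2 ≤ S.q * S.crossErr ω := by
  rw [crossErr, frobenius_norm_sq, Finset.mul_sum]
  refine Finset.sum_le_sum fun x _ => ?_
  rw [Finset.sum_comm, Finset.mul_sum]
  refine Finset.sum_le_sum fun l _ => ?_
  have hentry : S.crossMoment ω x l =
      ∑ g, (S.T : ℝ)⁻¹ * ∑ t ∈ S.times, S.W t ω x g * S.X t ω l g := by
    simp only [crossMoment, Matrix.smul_apply, Matrix.sum_apply, Matrix.mul_apply,
      Matrix.transpose_apply, smul_eq_mul]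
    rw [Finset.sum_comm, Finset.mul_sum]
  rw [hentry]
  simpa only [Finset.card_univ, Fintype.card_fin] using
    sq_sum_le_card_mul_sum_sq (s := Finset.univ) (f := fun g : Fin S.q =>
      (S.T : ℝ)⁻¹ * ∑ t ∈ S.times, S.W t ω x g * S.X t ω l g)

theorem sq_mul_norm_Ahat_sub_sq_le {κ : ℝ} (hκ : 0 < κ)
    (hX : ∀ z, κ * (z ⬝ᵥ z) ≤ z ⬝ᵥ (S.regMoment ω *ᵥ z)) :
    κ ^ 2 * ‖S.Ahat ω - S.A‖ ^ 2 ≤ S.q * S.crossErr ω := by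
  refine le_trans ?_ norm_crossMoment_sq_le
  rw [← Ahat_sub_mul_regMoment (isUnit_det_of_mul_dotProduct_le hκ hX), frobenius_norm_sq,
    frobenius_norm_sq, Finset.mul_sum]
  refine Finset.sum_le_sum fun x _ => ?_
  have hrow := sq_mul_le_dotProduct_vecMul hκ.le hX ((S.Ahat ω - S.A) x)
  simpa only [dotProduct, ← sq] using! hrow

theorem norm_regMoment_sub_sq_le {s D : ℝ} (hs : 2 ≤ s) (hM : S.MomentsLe s D) (ω : Ω) :
    ‖S.regMoment ω - (S.T : ℝ)⁻¹ • ∑ t ∈ S.times, S.P t‖ ^ 2 ≤ S.q * S.regErr ω := by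
  rw [regErr, frobenius_norm_sq, Finset.mul_sum]
  refine Finset.sum_le_sum fun l _ => ?_
  rw [Finset.mul_sum]
  refine Finset.sum_le_sum fun l' _ => ?_
  have hentry : (S.regMoment ω - (S.T : ℝ)⁻¹ • ∑ t ∈ S.times, S.P t) l l' =
      ∑ g, ((S.T : ℝ)⁻¹ * ∑ t ∈ S.times, S.X t ω l g * S.X t ω l' g -
        (S.T : ℝ)⁻¹ * ∑ t ∈ S.times, ∫ ω, S.X t ω l g * S.X t ω l' g ∂S.μ) := by
    rw [Finset.sum_sub_distrib, ← Finset.mul_sum, ← Finset.mul_sum]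
    simp only [regMoment, Matrix.sub_apply, Matrix.smul_apply, Matrix.sum_apply, smul_eq_mul]
    congr 2 <;> rw [Finset.sum_comm]
    · simp only [Matrix.mul_apply, Matrix.transpose_apply]
    refine Finset.sum_congr rfl fun t ht => ?_
    simp only [P, Matrix.of_apply, Matrix.mul_apply, Matrix.transpose_apply]
    exact integral_finsetSum _ fun g _ =>
      (hM.memLp_X hs ht l g).integrable_mul (hM.memLp_X hs ht l' g)
  rw [hentry]
  simpa only [Finset.card_univ, Fintype.card_fin] using
    sq_sum_le_card_mul_sum_sq (s := Finset.univ) (f := fun g : Fin S.q =>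
      (S.T : ℝ)⁻¹ * ∑ t ∈ S.times, S.X t ω l g * S.X t ω l' g -
        (S.T : ℝ)⁻¹ * ∑ t ∈ S.times, ∫ ω, S.X t ω l g * S.X t ω l' g ∂S.μ)

theorem What_eq (t : ℤ) : S.What ω t = S.W t ω - (S.Ahat ω - S.A) * S.X t ω := by
  rw [What, Y_eq, Matrix.sub_mul]
  abel

theorem avgSq_vec {a b : ℕ} (T : ℕ) (u : ℤ → Matrix (Fin a) (Fin b) ℝ) :
    avgSq T (fun t (e : Fin a × Fin b) => u t e.1 e.2) =
      (T : ℝ)⁻¹ * ∑ t ∈ Finset.Icc (1 : ℤ) T, ‖u t‖ ^ 2 := by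
  simp only [avgSq, Fintype.sum_prod_type, frobenius_norm_sq]

theorem norm_residErr_sq_le (hT : 1 ≤ S.T) {h : ℕ} (hhT : 2 * h ≤ S.T) {d u : ℝ}
    (hd : ‖S.Ahat ω - S.A‖ ^ 2 * ((S.T : ℝ)⁻¹ * ∑ t ∈ S.times, ‖S.X t ω‖ ^ 2) ≤ d)
    (hu : (S.T : ℝ)⁻¹ * ∑ t ∈ S.times, ‖S.W t ω‖ ^ 2 ≤ u) :
    ‖S.residErr h ω‖ ^ 2 ≤ 4 * (‖S.lagErr h ω‖ ^ 2 + (8 * (d * u) + 4 * (d * d))) := by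
  have hg : avgSq S.T (fun t (e : Fin S.p × Fin S.q) =>
      ((S.Ahat ω - S.A) * S.X t ω) e.1 e.2) ≤ d := by
    refine le_trans ?_ hd
    rw [avgSq_vec, mul_left_comm, Finset.mul_sum _ _ (‖S.Ahat ω - S.A‖ ^ 2)]
    refine mul_le_mul_of_nonneg_left (Finset.sum_le_sum fun t _ => ?_) (by positivity)
    rw [← mul_pow]
    exact pow_le_pow_left₀ (norm_nonneg _) (Matrix.frobenius_norm_mul _ _) 2
  have hv : avgSq S.T (fun t => S.vecW t ω) ≤ u := (avgSq_vec S.T fun t => S.W t ω).trans_le hu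
  have hresid : (fun t (e : Fin S.p × Fin S.q) => S.What ω t e.1 e.2) =
      fun t => S.vecW t ω - fun e => ((S.Ahat ω - S.A) * S.X t ω) e.1 e.2 := by
    funext t e
    rw [What_eq]
    rfl
  rw [residErr, hresid]
  exact norm_avgLagProd_sub_sub_sq_le hT hhT hg hv (S.lagCov h)

end Model

/-! ### The rate on the event of small errors -/

theorem subspaceDist_le_one {a k r : ℕ} (O₁ : Matrix (Fin a) (Fin k) ℝ)
    (O₂ : Matrix (Fin a) (Fin r) ℝ) : subspaceDist O₁ O₂ ≤ 1 := by
  have htrace : (O₁ * O₁ᵀ * (O₂ * O₂ᵀ)).trace = ‖O₁ᵀ * O₂‖ ^ 2 := by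
    rw [frobenius_norm_sq_eq_trace, Matrix.transpose_mul, Matrix.transpose_transpose,
      Matrix.mul_assoc, Matrix.trace_mul_comm, Matrix.trace_mul_comm (O₂ᵀ * O₁)]
    simp only [Matrix.mul_assoc]
  refine Real.sqrt_le_one.2 (sub_le_self 1 ?_)
  rw [htrace]
  positivity

theorem le_one_add_mul_of_le_div {d s x η a b : ℝ} (hs : 0 < s) (hx : 0 < x) (ha : 0 ≤ a)
    (hb : 0 ≤ b) (hη : 0 ≤ η) (hd₁ : d ≤ 1)
    (hd : d ≤ 2 / (s * x ^ 2) * ((a * (x * η)) ^ 2 + 2 * (a * (x * η)) * (b * x))) :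
    d ≤ (1 + 2 / s * (a ^ 2 + 2 * a * b)) * η := by
  rcases le_total η 1 with hη₁ | hη₁
  · calc d ≤ 2 / (s * x ^ 2) * ((a * (x * η)) ^ 2 + 2 * (a * (x * η)) * (b * x)) := hd
      _ = 2 / s * (a ^ 2 * (η * η) + 2 * a * b * η) := by field_simp
      _ ≤ 2 / s * (a ^ 2 * (η * 1) + 2 * a * b * η) := by gcongr
      _ = 0 * η + 2 / s * (a ^ 2 + 2 * a * b) * η := by ring
      _ ≤ 1 * η + 2 / s * (a ^ 2 + 2 * a * b) * η := by gcongr; exact zero_le_one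
      _ = (1 + 2 / s * (a ^ 2 + 2 * a * b)) * η := by ring
  · have hconst : 0 ≤ 2 / s * (a ^ 2 + 2 * a * b) := by positivity
    nlinarith

theorem subspaceDist_le_mul_of_sum_sq_le {a b k r T h₀ : ℕ} {Ω : Type*} [MeasurableSpace Ω]
    {μ : Measure Ω} {w : ℤ → Matrix (Fin a) (Fin b) ℝ} {W : ℤ → Ω → Matrix (Fin a) (Fin b) ℝ}
    {Φ : ℤ → Ω → Matrix (Fin k) (Fin r) ℝ} {L : Matrix (Fin a) (Fin k) ℝ}
    {N : Matrix (Fin b) (Fin r) ℝ} (hk : 1 ≤ k)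
    (hW : ∀ h ∈ Finset.Icc 1 h₀, ∀ i j,
      colLagCov μ T h W i j = loadedCov L N (colLagCov μ T h Φ) i j)
    {c σ x η α β : ℝ} (hc₀ : 0 < c) (hc : c ≤ nthEig (popM μ T h₀ Φ) (k - 1)) (hσ : 0 < σ)
    (hx : 0 < x) (hLN : σ * x ≤ singVal L (k - 1) ^ 2 * singVal N (r - 1) ^ 2)
    (hα : 0 ≤ α) (hβ : 0 ≤ β) (hη : 0 ≤ η)
    (hpop : ∑ h ∈ Finset.Icc 1 h₀, ‖avgLagCov μ T h (fun t ω (e : Fin a × Fin b) => W t ω e.1 e.2)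
      (fun t ω (e : Fin a × Fin b) => W t ω e.1 e.2)‖ ^ 2 ≤ (β * x) ^ 2)
    (herr : ∑ h ∈ Finset.Icc 1 h₀, ‖avgLagProd T h (fun t (e : Fin a × Fin b) => w t e.1 e.2)
      (fun t (e : Fin a × Fin b) => w t e.1 e.2) -
        avgLagCov μ T h (fun t ω (e : Fin a × Fin b) => W t ω e.1 e.2)
          (fun t ω (e : Fin a × Fin b) => W t ω e.1 e.2)‖ ^ 2 ≤ (α * (x * η)) ^ 2)
    {Q Q' : Matrix (Fin a) (Fin k) ℝ} (hQ : IsLeadingEigenvectors (popM μ T h₀ W) Q)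
    (hQ' : IsLeadingEigenvectors (sampleM T h₀ w) Q') :
    subspaceDist Q' Q ≤ (1 + 2 / (c * σ ^ 2) * (α ^ 2 + 2 * α * β)) * η := by
  have hs : c * σ ^ 2 * x ^ 2 ≤ c * (singVal L (k - 1) ^ 2) ^ 2 * (singVal N (r - 1) ^ 2) ^ 2 := by
    rw [mul_assoc, mul_assoc, ← mul_pow, ← mul_pow]
    gcongr
  refine le_one_add_mul_of_le_div (by positivity) hx hα hβ hη (subspaceDist_le_one _ _) ?_
  refine (subspaceDist_le_of_loadedCov hk hW hc₀.le hc (by positivity) hs hQ hQ').trans ?_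
  gcongr
  exact norm_sampleM_sub_popM_le (by positivity) (by positivity) hpop herr

/-- The constants in the conditions of the theorem: the order `γ` and the bound `D` of the moments,
the bound `B` of the mixing coefficients, the lower bounds `c` of the second moments of the
regressors, `cF` of the lagged autocovariances of the factors and `σ` of the loadings, and the
upper bound `L` of the loadings. -/
structure Constants where
  (γ D B c cF σ L : ℝ)
  two_lt_γ : 2 < γ
  D_nonneg : 0 ≤ D
  c_pos : 0 < c
  cF_pos : 0 < cF
  σ_pos : 0 < σ
  L_nonneg : 0 ≤ L

namespace Model

variable {k r m h₀ : ℕ} {Ω : Type*} [MeasurableSpace Ω] (S : Model k r m Ω)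

/-- The conditions of the theorem for a single model, with explicit constants; `x` is the strength
of the factors. -/
structure Regular (h₀ : ℕ) (κ : Constants) (x : ℝ) : Prop where
  standing : S.Standing
  moments : S.MomentsLe (2 * κ.γ) κ.D
  mixing : MixingSumLe S.μ S.obsSigma κ.γ κ.B
  p_pos : 0 < S.p
  q_pos : 0 < S.q
  two_mul_lt_T : 2 * h₀ < S.T
  le_avg_P : ∀ z, 2 * (κ.c * S.q) * (z ⬝ᵥ z) ≤
    z ⬝ᵥ (((S.T : ℝ)⁻¹ • ∑ t ∈ S.times, S.P t) *ᵥ z)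
  le_nthEig_rows : κ.cF ≤ nthEig (popM S.μ S.T h₀ S.F) (k - 1)
  le_nthEig_cols : κ.cF ≤ nthEig (popM S.μ S.T h₀ fun t ω => (S.F t ω)ᵀ) (r - 1)
  strength_pos : 0 < x
  strength_le : x ≤ S.p * S.q
  le_singVal : κ.σ * x ≤ singVal S.R (k - 1) ^ 2 * singVal S.C (r - 1) ^ 2
  norm_sq_le : k * r * (‖S.R‖ ^ 2 * ‖S.C‖ ^ 2) ≤ κ.L * x

/-- The sum of all estimation errors, each divided by its order in probability. -/
def totalErr (h₀ : ℕ) (ω : Ω) : ℝ :=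
  S.T / (S.p * S.q) ^ 2 * ∑ h ∈ Finset.Icc 1 h₀, ‖S.lagErr h ω‖ ^ 2 +
    S.T / (S.p * S.q) * S.crossErr ω + S.T / S.q * S.regErr ω +
      (S.q : ℝ)⁻¹ * ((S.T : ℝ)⁻¹ * ∑ t ∈ S.times, ‖S.X t ω‖ ^ 2) +
        (S.p * S.q : ℝ)⁻¹ * ((S.T : ℝ)⁻¹ * ∑ t ∈ S.times, ‖S.W t ω‖ ^ 2)

/-- Each estimation error is at most `K` times its order in probability. -/
structure SmallErrors (h₀ : ℕ) (K : ℝ) (ω : Ω) : Prop where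
  lagErr_le : ∑ h ∈ Finset.Icc 1 h₀, ‖S.lagErr h ω‖ ^ 2 ≤ K * ((S.p * S.q) ^ 2 / S.T)
  crossErr_le : S.crossErr ω ≤ K * (S.p * S.q / S.T)
  regErr_le : S.regErr ω ≤ K * (S.q / S.T)
  avg_X_le : (S.T : ℝ)⁻¹ * ∑ t ∈ S.times, ‖S.X t ω‖ ^ 2 ≤ K * S.q
  avg_W_le : (S.T : ℝ)⁻¹ * ∑ t ∈ S.times, ‖S.W t ω‖ ^ 2 ≤ K * (S.p * S.q)

/-- The rate of convergence when the factors have strength `x`. -/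
def rate (x : ℝ) : ℝ := S.p * S.q / (x * √S.T)

theorem rate_nonneg {x : ℝ} (hx : 0 ≤ x) : 0 ≤ S.rate x := by
  unfold rate
  positivity

theorem mul_rate_sq {x : ℝ} (hx : 0 < x) : (x * S.rate x) ^ 2 = (S.p * S.q) ^ 2 / S.T := by
  rw [rate, ← mul_div_assoc, mul_div_mul_left _ _ hx.ne', div_pow, Real.sq_sqrt (Nat.cast_nonneg _)]

variable {S} {κ : Constants} {x K : ℝ} {ω : Ω}

theorem crossErr_nonneg : 0 ≤ S.crossErr ω := by
  unfold crossErr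
  positivity

theorem regErr_nonneg : 0 ≤ S.regErr ω := by
  unfold regErr
  positivity

theorem totalErr_nonneg : 0 ≤ S.totalErr h₀ ω := by
  have hcross := S.crossErr_nonneg (ω := ω)
  have hreg := S.regErr_nonneg (ω := ω)
  unfold totalErr
  positivity

theorem smallErrors_of_totalErr_le (hp : 0 < S.p) (hq : 0 < S.q) (hT : 0 < S.T)
    (hK : S.totalErr h₀ ω ≤ K) : S.SmallErrors h₀ K ω := by
  have hcross := S.crossErr_nonneg (ω := ω)
  have hreg := S.regErr_nonneg (ω := ω)
  have hlag₁ : 0 ≤ S.T / (S.p * S.q : ℝ) ^ 2 * ∑ h ∈ Finset.Icc 1 h₀, ‖S.lagErr h ω‖ ^ 2 := by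
    positivity
  have hcross₁ : 0 ≤ S.T / (S.p * S.q) * S.crossErr ω := by positivity
  have hreg₁ : 0 ≤ S.T / S.q * S.regErr ω := by positivity
  have hX₁ : 0 ≤ (S.q : ℝ)⁻¹ * ((S.T : ℝ)⁻¹ * ∑ t ∈ S.times, ‖S.X t ω‖ ^ 2) := by positivity
  have hW₁ : 0 ≤ (S.p * S.q : ℝ)⁻¹ * ((S.T : ℝ)⁻¹ * ∑ t ∈ S.times, ‖S.W t ω‖ ^ 2) := by positivity
  have hpos : ∀ {y z : ℝ}, 0 < y → y⁻¹ * z ≤ K → z ≤ K * y := fun hy h => by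
    rwa [inv_mul_eq_div, div_le_iff₀ hy] at h
  unfold totalErr at hK
  constructor
  all_goals
    refine hpos (by positivity) ?_
    try rw [inv_div]
    linarith

theorem Regular.scaleSq_le (h : S.Regular h₀ κ x) :
    S.scaleSq ≤ 2 * (1 + κ.L) * (S.p * S.q) := by
  have hscale : S.scaleSq ≤ _ := S.sum_scale_sq_le
  linarith [h.norm_sq_le, mul_le_mul_of_nonneg_left h.strength_le κ.L_nonneg]

theorem SmallErrors.nonneg (hω : S.SmallErrors h₀ K ω) (hq : 0 < S.q) : 0 ≤ K := by
  have hX : 0 ≤ (S.T : ℝ)⁻¹ * ∑ t ∈ S.times, ‖S.X t ω‖ ^ 2 := by positivity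
  exact nonneg_of_mul_nonneg_left (hX.trans hω.avg_X_le) (by positivity)

namespace Regular

theorem mul_dotProduct_le_regMoment (hS : S.Regular h₀ κ x) (hω : S.SmallErrors h₀ K ω)
    (hK : K ≤ κ.c ^ 2 * S.T) (z : Fin m → ℝ) :
    κ.c * S.q * (z ⬝ᵥ z) ≤ z ⬝ᵥ (S.regMoment ω *ᵥ z) := by
  have hq := hS.q_pos
  have hT : 0 < S.T := by linarith [hS.two_mul_lt_T]
  have hc := κ.c_pos
  have herr : ‖S.regMoment ω - (S.T : ℝ)⁻¹ • ∑ t ∈ S.times, S.P t‖ ≤ κ.c * S.q := by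
    refine le_of_sq_le_sq ?_ (by positivity)
    calc _ ≤ S.q * S.regErr ω :=
          norm_regMoment_sub_sq_le (by linarith [κ.two_lt_γ]) hS.moments ω
      _ ≤ S.q * (κ.c ^ 2 * S.T * (S.q / S.T)) := by
        gcongr
        exact hω.regErr_le.trans (by gcongr)
      _ = (κ.c * S.q) ^ 2 := by field_simp
  have hquad := sub_mul_dotProduct_le hS.le_avg_P herr z
  rwa [two_mul, add_sub_cancel_right] at hquad

theorem norm_Ahat_sub_sq_le (hS : S.Regular h₀ κ x) (hω : S.SmallErrors h₀ K ω)
    (hK : K ≤ κ.c ^ 2 * S.T) : ‖S.Ahat ω - S.A‖ ^ 2 ≤ K / κ.c ^ 2 * (S.p / S.T) := by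
  have hq := hS.q_pos
  have hc := κ.c_pos
  refine le_of_mul_le_mul_left ?_ (by positivity : 0 < (κ.c * S.q) ^ 2)
  calc _ ≤ S.q * S.crossErr ω :=
        sq_mul_norm_Ahat_sub_sq_le (by positivity) (hS.mul_dotProduct_le_regMoment hω hK)
    _ ≤ S.q * (K * (S.p * S.q / S.T)) := by gcongr; exact hω.crossErr_le
    _ = (κ.c * S.q) ^ 2 * (K / κ.c ^ 2 * (S.p / S.T)) := by field_simp

end Regular

/-- The factor of `(p q)² / T` in the bound for the residual autocovariances on the event that the
estimation errors are at most `K` times their orders. -/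
def residConst (κ : Constants) (h₀ : ℕ) (K : ℝ) : ℝ :=
  4 * (K + h₀ * (8 * (K ^ 2 / κ.c ^ 2 * K) + 4 * (K ^ 2 / κ.c ^ 2) ^ 2))

/-- The factor of the strength of the factors in the bound for the autocovariances of `vec W_t`. -/
def popConst (κ : Constants) (h₀ : ℕ) : ℝ := √h₀ * ((1 + κ.D) * κ.L)

/-- The factor of the rate of convergence in the bound for the distances, on the event that the
estimation errors are at most `K` times their orders. -/
def distConst (κ : Constants) (h₀ : ℕ) (K : ℝ) : ℝ :=
  1 + 2 / (κ.cF * κ.σ ^ 2) *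
    (√(residConst κ h₀ K) ^ 2 + 2 * √(residConst κ h₀ K) * popConst κ h₀)

namespace Regular

theorem sum_norm_residErr_sq_le (hS : S.Regular h₀ κ x) (hω : S.SmallErrors h₀ K ω)
    (hK : K ≤ κ.c ^ 2 * S.T) :
    ∑ h ∈ Finset.Icc 1 h₀, ‖S.residErr h ω‖ ^ 2 ≤
      (√(residConst κ h₀ K) * (x * S.rate x)) ^ 2 := by
  have hT : 1 ≤ S.T := by linarith [hS.two_mul_lt_T]
  have hK₀ := hω.nonneg hS.q_pos
  set d : ℝ := K ^ 2 / κ.c ^ 2 * (S.p * S.q / S.T)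
  have hd : ‖S.Ahat ω - S.A‖ ^ 2 * ((S.T : ℝ)⁻¹ * ∑ t ∈ S.times, ‖S.X t ω‖ ^ 2) ≤ d := by
    calc _ ≤ K / κ.c ^ 2 * (S.p / S.T) * (K * S.q) :=
          mul_le_mul (hS.norm_Ahat_sub_sq_le hω hK) hω.avg_X_le (by positivity) (by positivity)
      _ = d := by ring
  have hdd : d * d ≤ (K ^ 2 / κ.c ^ 2) ^ 2 * ((S.p * S.q) ^ 2 / S.T) := by
    have hT₁ : (S.T : ℝ) ≤ S.T ^ 2 := le_self_pow₀ (by exact_mod_cast hT) two_ne_zero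
    calc d * d = (K ^ 2 / κ.c ^ 2) ^ 2 * ((S.p * S.q) ^ 2 / S.T ^ 2) := by ring
      _ ≤ (K ^ 2 / κ.c ^ 2) ^ 2 * ((S.p * S.q) ^ 2 / S.T) := by gcongr
  have hresid : 0 ≤ residConst κ h₀ K := by
    unfold residConst
    positivity
  rw [mul_pow, Real.sq_sqrt hresid, mul_rate_sq S hS.strength_pos]
  calc _ ≤ ∑ h ∈ Finset.Icc 1 h₀, 4 * (‖S.lagErr h ω‖ ^ 2 +
          (8 * (d * (K * (S.p * S.q))) + 4 * (d * d))) :=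
        Finset.sum_le_sum fun h hh => norm_residErr_sq_le hT
          (by linarith [(Finset.mem_Icc.1 hh).2, hS.two_mul_lt_T]) hd hω.avg_W_le
    _ = 4 * (∑ h ∈ Finset.Icc 1 h₀, ‖S.lagErr h ω‖ ^ 2 +
          h₀ * (8 * (d * (K * (S.p * S.q))) + 4 * (d * d))) := by
      rw [← Finset.mul_sum, Finset.sum_add_distrib, Finset.sum_const, Nat.card_Icc,
        add_tsub_cancel_right, nsmul_eq_mul]
    _ ≤ 4 * (K * ((S.p * S.q) ^ 2 / S.T) + h₀ * (8 * (d * (K * (S.p * S.q))) +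
          4 * ((K ^ 2 / κ.c ^ 2) ^ 2 * ((S.p * S.q) ^ 2 / S.T)))) := by
      gcongr
      exact hω.lagErr_le
    _ = residConst κ h₀ K * ((S.p * S.q) ^ 2 / S.T) := by
      unfold residConst
      ring

theorem sum_norm_lagCov_sq_le (hS : S.Regular h₀ κ x) :
    ∑ h ∈ Finset.Icc 1 h₀, ‖S.lagCov h‖ ^ 2 ≤ (popConst κ h₀ * x) ^ 2 := by
  have hD := κ.D_nonneg
  calc _ ≤ ∑ h ∈ Finset.Icc 1 h₀, ((1 + κ.D) * (κ.L * x)) ^ 2 := by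
        refine Finset.sum_le_sum fun h hh => (norm_lagCov_sq_le (by linarith [κ.two_lt_γ])
          hS.moments hS.standing (Finset.mem_Icc.1 hh).1
          (by linarith [(Finset.mem_Icc.1 hh).2, hS.two_mul_lt_T])).trans ?_
        refine pow_le_pow_left₀ (by positivity) ?_ 2
        calc _ = (1 + κ.D) * (k * r * (‖S.R‖ ^ 2 * ‖S.C‖ ^ 2)) := by ring
          _ ≤ _ := mul_le_mul_of_nonneg_left hS.norm_sq_le (by positivity)
    _ = √h₀ ^ 2 * ((1 + κ.D) * (κ.L * x)) ^ 2 := by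
      rw [Finset.sum_const, Nat.card_Icc, add_tsub_cancel_right, nsmul_eq_mul,
        Real.sq_sqrt (Nat.cast_nonneg _)]
    _ = (popConst κ h₀ * x) ^ 2 := by
      unfold popConst
      ring

theorem popConst_nonneg (κ : Constants) (h₀ : ℕ) : 0 ≤ popConst κ h₀ := by
  have hD := κ.D_nonneg
  have hL := κ.L_nonneg
  unfold popConst
  positivity

theorem subspaceDist_M₁_le (hk : 1 ≤ k) (hS : S.Regular h₀ κ x) (hω : S.SmallErrors h₀ K ω)
    (hK : K ≤ κ.c ^ 2 * S.T) {Q Q' : Matrix (Fin S.p) (Fin k) ℝ}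
    (hQ : IsLeadingEigenvectors (S.M₁ h₀) Q) (hQ' : IsLeadingEigenvectors (S.M₁hat h₀ ω) Q') :
    subspaceDist Q' Q ≤ distConst κ h₀ K * S.rate x :=
  subspaceDist_le_mul_of_sum_sq_le hk
    (fun _ hh => colLagCov_W (by linarith [κ.two_lt_γ]) hS.moments hS.standing
      (Finset.mem_Icc.1 hh).1)
    κ.cF_pos hS.le_nthEig_rows κ.σ_pos hS.strength_pos hS.le_singVal (Real.sqrt_nonneg _)
    (popConst_nonneg κ h₀) (S.rate_nonneg hS.strength_pos.le) hS.sum_norm_lagCov_sq_le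
    (hS.sum_norm_residErr_sq_le hω hK) hQ hQ'

theorem subspaceDist_M₂_le (hr : 1 ≤ r) (hS : S.Regular h₀ κ x) (hω : S.SmallErrors h₀ K ω)
    (hK : K ≤ κ.c ^ 2 * S.T) {Q Q' : Matrix (Fin S.q) (Fin r) ℝ}
    (hQ : IsLeadingEigenvectors (S.M₂ h₀) Q) (hQ' : IsLeadingEigenvectors (S.M₂hat h₀ ω) Q') :
    subspaceDist Q' Q ≤ distConst κ h₀ K * S.rate x := by
  have hswap : ∀ M : Matrix (Fin S.p × Fin S.q) (Fin S.p × Fin S.q) ℝ,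
      ‖M.submatrix Prod.swap Prod.swap‖ = ‖M‖ := fun M =>
    frobenius_norm_submatrix_equiv M (Equiv.prodComm _ _) (Equiv.prodComm _ _)
  refine subspaceDist_le_mul_of_sum_sq_le hr
    (fun _ hh => colLagCov_W_transpose (by linarith [κ.two_lt_γ]) hS.moments hS.standing
      (Finset.mem_Icc.1 hh).1)
    κ.cF_pos hS.le_nthEig_cols κ.σ_pos hS.strength_pos (hS.le_singVal.trans_eq (mul_comm _ _))
    (Real.sqrt_nonneg _) (popConst_nonneg κ h₀) (S.rate_nonneg hS.strength_pos.le) ?_ ?_ hQ hQ'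
  · simpa only [← hswap] using! hS.sum_norm_lagCov_sq_le
  · simpa only [← hswap] using! hS.sum_norm_residErr_sq_le hω hK

end Regular

/-- The bound for the mean of `totalErr`, with `2 * (1 + κ.L)` in the place of
`scaleSq / (p * q)`. -/
def meanConst (κ : Constants) (m h₀ : ℕ) : ℝ :=
  (2 * (1 + κ.L)) ^ 2 * ∑ h ∈ Finset.Icc 1 h₀, 2 * varConst (2 * κ.D) h κ.B +
    m * (2 * (1 + κ.L)) * (2 * varConst (2 * κ.D) 0 κ.B) +
      m * m * (2 * varConst (2 * κ.D) 0 κ.B) + m * (1 + κ.D) + 2 * (1 + κ.L) * (1 + κ.D)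

theorem Regular.meanLe_totalErr (hS : S.Regular h₀ κ x) :
    MeanLe S.μ (S.totalErr h₀) (meanConst κ m h₀) := by
  have hγ := κ.two_lt_γ
  have hp := hS.p_pos
  have hq := hS.q_pos
  have hT : 1 ≤ S.T := by linarith [hS.two_mul_lt_T]
  have hD := κ.D_nonneg
  have hvar : ∀ h, 0 ≤ varConst (2 * κ.D) h κ.B := fun h =>
    varConst_nonneg (by positivity) h hS.mixing.nonneg
  have hscale := hS.scaleSq_le
  have hscale₀ : 0 ≤ S.scaleSq :=
    Finset.sum_nonneg fun _ _ => Finset.sum_nonneg fun _ _ => sq_nonneg _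
  refine ((((((MeanLe.sum fun h hh => meanLe_norm_lagErr_sq hγ hS.moments hS.standing hS.mixing hT
    (by linarith [(Finset.mem_Icc.1 hh).2, hS.two_mul_lt_T])).const_mul (by positivity)).add
    ((meanLe_crossErr hγ hS.moments hS.standing hS.mixing hT).const_mul (by positivity))).add
    ((meanLe_regErr hγ hS.moments hS.mixing hT).const_mul (by positivity))).add
    ((meanLe_avg_norm_X_sq (by linarith) hS.moments hT).const_mul (by positivity))).add
    ((meanLe_avg_norm_W_sq (by linarith) hS.moments hT).const_mul (by positivity))).mono ?_
  rw [meanConst, ← Finset.mul_sum, ← Finset.sum_div]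
  set Λ := ∑ h ∈ Finset.Icc 1 h₀, 2 * varConst (2 * κ.D) h κ.B
  have hΛ : 0 ≤ Λ := Finset.sum_nonneg fun h _ => mul_nonneg zero_le_two (hvar h)
  have hvar₀ := hvar 0
  calc _ ≤ S.T / (S.p * S.q) ^ 2 * ((2 * (1 + κ.L) * (S.p * S.q)) ^ 2 * (Λ / S.T)) +
        S.T / (S.p * S.q) *
          (m * (2 * (1 + κ.L) * (S.p * S.q)) * (2 * varConst (2 * κ.D) 0 κ.B / S.T)) +
        S.T / S.q * (m * m * S.q * (2 * varConst (2 * κ.D) 0 κ.B / S.T)) +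
        (S.q : ℝ)⁻¹ * (m * S.q * (1 + κ.D)) +
        (S.p * S.q : ℝ)⁻¹ * (2 * (1 + κ.L) * (S.p * S.q) * (1 + κ.D)) := by gcongr
    _ = _ := by field_simp

end Model

/-! ### Asymptotics -/

theorem exists_eventually_le_mul_of_isBigO {f g : ℕ → ℝ} (h : f =O[atTop] g) (hg : ∀ n, 0 ≤ g n) :
    ∃ c, 0 < c ∧ ∀ᶠ n in atTop, f n ≤ c * g n := by
  obtain ⟨c, hc, hb⟩ := h.exists_pos
  refine ⟨c, hc, hb.bound.mono fun n hn => ?_⟩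
  rw [Real.norm_of_nonneg (hg n)] at hn
  exact (le_abs_self _).trans hn

theorem nthEig_nonneg_of_posDef {a : ℕ} {M : Matrix (Fin a) (Fin a) ℝ} (hM : M.PosDef) {j : ℕ}
    (hj : j < a) : 0 ≤ nthEig M j := by
  refine le_nthEig hM.isHermitian (L := 1) (fun x y h => by simpa using h) (fun z => ?_) hj
  simpa using hM.posSemidef.dotProduct_mulVec_nonneg z

namespace Model

theorem isHermitian_avg_P {k r m : ℕ} {Ω : Type*} [MeasurableSpace Ω] (S : Model k r m Ω) :
    ((S.T : ℝ)⁻¹ • ∑ t ∈ S.times, S.P t).IsHermitian := by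
  have hP : ∀ t, (S.P t)ᵀ = S.P t := fun t => by
    ext l l'
    simp only [P, Matrix.transpose_apply, Matrix.of_apply, Matrix.mul_apply, mul_comm]
  simp only [Matrix.IsHermitian, Matrix.conjTranspose_eq_transpose_of_trivial,
    Matrix.transpose_smul, Matrix.transpose_sum, hP]

end Model

section Sequences

variable {k r m h₀ : ℕ} {Ω : ℕ → Type*} [∀ n, MeasurableSpace (Ω n)]
  {S : ∀ n, Model k r m (Ω n)} {γ δ₁ δ₂ : ℝ}

theorem Condition2.exists_momentsLe (h : Condition2 S γ) :
    ∃ D, 0 ≤ D ∧ ∀ n, (S n).MomentsLe (2 * γ) D := by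
  obtain ⟨B, hB⟩ := h
  refine ⟨max B 0, le_max_right _ _, fun n t ht => ?_⟩
  obtain ⟨hF, hX, hE⟩ := hB n t ht
  exact ⟨fun i j => (hF i j).mono (le_max_left _ _), fun i j => (hX i j).mono (le_max_left _ _),
    fun i j => (hE i j).mono (le_max_left _ _)⟩

theorem Condition4.exists_le_nthEig_avg_P (hm : 1 ≤ m)
    (hq : Tendsto (fun n => (S n).q) atTop atTop) (h : Condition4 S) :
    ∃ c, 0 < c ∧ ∀ᶠ n in atTop,
      c * (S n).q ≤ nthEig (((S n).T : ℝ)⁻¹ • ∑ t ∈ (S n).times, (S n).P t) (m - 1) := by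
  obtain ⟨-, P, hP, hlim, hΘ⟩ := h
  obtain ⟨b, hb, hbn⟩ := exists_eventually_le_mul_of_isBigO hΘ.2
    fun n => nthEig_nonneg_of_posDef (hP n) (Nat.sub_lt hm one_pos)
  have hnorm : Tendsto (fun n => ‖((S n).T : ℝ)⁻¹ • ∑ t ∈ (S n).times, (S n).P t - P n‖ ^ 2)
      atTop (𝓝 0) := by
    simp only [frobenius_norm_sq]
    simpa using tendsto_finsetSum Finset.univ fun l _ =>
      tendsto_finsetSum Finset.univ fun l' _ => (hlim l l').pow 2
  refine ⟨(2 * b)⁻¹, by positivity, ?_⟩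
  filter_upwards [hbn, hq.eventually_ge_atTop 1,
    hnorm.eventually_le_const (by positivity : (0 : ℝ) < (2 * b)⁻¹ ^ 2)] with n hbn hqn hn
  have hqn' : (1 : ℝ) ≤ (S n).q := by exact_mod_cast hqn
  have herr := (pow_le_pow_iff_left₀ (norm_nonneg _) (by positivity) two_ne_zero).1 hn
  have heig : b⁻¹ * (S n).q ≤ nthEig (P n) (m - 1) := (inv_mul_le_iff₀ hb).2 hbn
  refine le_trans ?_ (le_nthEig (Model.isHermitian_avg_P (S n)) (L := 1)
    (fun x y h => by simpa using h) (s := nthEig (P n) (m - 1) - (2 * b)⁻¹) (fun z => ?_)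
    (Nat.sub_lt hm one_pos))
  · calc (2 * b)⁻¹ * ((S n).q : ℝ) = b⁻¹ * (S n).q - (2 * b)⁻¹ * (S n).q := by ring
      _ ≤ nthEig (P n) (m - 1) - (2 * b)⁻¹ :=
        sub_le_sub heig (le_mul_of_one_le_right (by positivity) hqn')
  · simpa using sub_mul_dotProduct_le
      (nthEig_mul_dotProduct_self_le (hP n).isHermitian) herr z

/-- The strength of the factors, that is, the order of `‖R‖² ‖C‖²`. -/
def strength (S : ∀ n, Model k r m (Ω n)) (δ₁ δ₂ : ℝ) (n : ℕ) : ℝ :=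
  ((S n).p : ℝ) ^ (1 - δ₁) * ((S n).q : ℝ) ^ (1 - δ₂)

theorem strength_pos {n : ℕ} (hp : 0 < (S n).p) (hq : 0 < (S n).q) : 0 < strength S δ₁ δ₂ n := by
  unfold strength
  positivity

theorem strength_le {n : ℕ} (hδ₁ : 0 ≤ δ₁) (hδ₂ : 0 ≤ δ₂) (hp : 0 < (S n).p) (hq : 0 < (S n).q) :
    strength S δ₁ δ₂ n ≤ (S n).p * (S n).q := by
  have hp₁ : (1 : ℝ) ≤ (S n).p := by exact_mod_cast hp
  have hq₁ : (1 : ℝ) ≤ (S n).q := by exact_mod_cast hq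
  exact mul_le_mul
    ((Real.rpow_le_rpow_of_exponent_le hp₁ (by linarith)).trans_eq (Real.rpow_one _))
    ((Real.rpow_le_rpow_of_exponent_le hq₁ (by linarith)).trans_eq (Real.rpow_one _))
    (by positivity) (by positivity)

theorem rate_strength {n : ℕ} (hp : 0 < (S n).p) (hq : 0 < (S n).q) :
    (S n).rate (strength S δ₁ δ₂ n) =
      ((S n).p : ℝ) ^ δ₁ * ((S n).q : ℝ) ^ δ₂ * ((S n).T : ℝ) ^ (-(1 / 2 : ℝ)) := by
  have hsplit : ∀ {y : ℕ} (δ : ℝ), 0 < y → (y : ℝ) ^ (1 - δ) * (y : ℝ) ^ δ = y := fun δ hy => by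
    rw [← Real.rpow_add (by exact_mod_cast hy), sub_add_cancel, Real.rpow_one]
  have hx : 0 < strength S δ₁ δ₂ n := strength_pos hp hq
  calc (S n).rate (strength S δ₁ δ₂ n)
      = strength S δ₁ δ₂ n * (((S n).p : ℝ) ^ δ₁ * ((S n).q : ℝ) ^ δ₂) /
          (strength S δ₁ δ₂ n * √(S n).T) := by
        rw [Model.rate, strength, mul_mul_mul_comm, hsplit δ₁ hp, hsplit δ₂ hq]
    _ = ((S n).p : ℝ) ^ δ₁ * ((S n).q : ℝ) ^ δ₂ * (√(S n).T)⁻¹ := by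
      rw [mul_div_mul_left _ _ hx.ne', div_eq_mul_inv]
    _ = _ := by rw [Real.sqrt_eq_rpow, Real.rpow_neg (Nat.cast_nonneg _)]

theorem exists_eventually_strength_le
    (hR : (fun n => ((S n).p : ℝ) ^ (1 - δ₁)) =O[atTop] fun n => singVal (S n).R (k - 1) ^ 2)
    (hC : (fun n => ((S n).q : ℝ) ^ (1 - δ₂)) =O[atTop] fun n => singVal (S n).C (r - 1) ^ 2) :
    ∃ σ, 0 < σ ∧ ∀ᶠ n in atTop, σ * strength S δ₁ δ₂ n ≤
      singVal (S n).R (k - 1) ^ 2 * singVal (S n).C (r - 1) ^ 2 := by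
  obtain ⟨c, hc, hle⟩ := exists_eventually_le_mul_of_isBigO (hR.mul hC) fun n => by positivity
  exact ⟨c⁻¹, inv_pos.2 hc, hle.mono fun n hn => (inv_mul_le_iff₀ hc).2 hn⟩

theorem exists_eventually_norm_sq_le
    (hR : (fun n => specNorm (S n).R ^ 2) =O[atTop] fun n => ((S n).p : ℝ) ^ (1 - δ₁))
    (hC : (fun n => specNorm (S n).C ^ 2) =O[atTop] fun n => ((S n).q : ℝ) ^ (1 - δ₂)) :
    ∃ L, 0 ≤ L ∧ ∀ᶠ n in atTop,
      k * r * (‖(S n).R‖ ^ 2 * ‖(S n).C‖ ^ 2) ≤ L * strength S δ₁ δ₂ n := by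
  obtain ⟨c, hc, hle⟩ := exists_eventually_le_mul_of_isBigO (hR.mul hC) fun n => by positivity
  refine ⟨(k * r) ^ 2 * c, by positivity, hle.mono fun n hn => ?_⟩
  calc _ ≤ k * r * ((k * specNorm (S n).R ^ 2) * (r * specNorm (S n).C ^ 2)) := by
        gcongr <;> exact frobenius_norm_sq_le_specNorm_sq _
    _ = (k * r) ^ 2 * (specNorm (S n).R ^ 2 * specNorm (S n).C ^ 2) := by ring
    _ ≤ (k * r) ^ 2 * (c * strength S δ₁ δ₂ n) := mul_le_mul_of_nonneg_left hn (by positivity)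
    _ = _ := by ring

theorem exists_eventually_regular (hp : ∀ᶠ n in atTop, 0 < (S n).p)
    (hq : ∀ᶠ n in atTop, 0 < (S n).q) (hT : Tendsto (fun n => (S n).T) atTop atTop)
    (hS : ∀ n, (S n).Standing) (hmix : Condition1 S γ) (hmom : Condition2 S γ)
    (hF : ∃ c : ℝ, 0 < c ∧ ∀ᶠ n in atTop,
      c ≤ nthEig (popM (S n).μ (S n).T h₀ (S n).F) (k - 1) ∧
        c ≤ nthEig (popM (S n).μ (S n).T h₀ fun t ω => ((S n).F t ω)ᵀ) (r - 1))
    (hP : ∃ c : ℝ, 0 < c ∧ ∀ᶠ n in atTop,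
      c * (S n).q ≤ nthEig (((S n).T : ℝ)⁻¹ • ∑ t ∈ (S n).times, (S n).P t) (m - 1))
    (hδ₁ : 0 ≤ δ₁) (hδ₂ : 0 ≤ δ₂)
    (hR : (fun n => specNorm (S n).R ^ 2) =O[atTop] fun n => ((S n).p : ℝ) ^ (1 - δ₁))
    (hR' : (fun n => ((S n).p : ℝ) ^ (1 - δ₁)) =O[atTop] fun n => singVal (S n).R (k - 1) ^ 2)
    (hC : (fun n => specNorm (S n).C ^ 2) =O[atTop] fun n => ((S n).q : ℝ) ^ (1 - δ₂))
    (hC' : (fun n => ((S n).q : ℝ) ^ (1 - δ₂)) =O[atTop] fun n => singVal (S n).C (r - 1) ^ 2) :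
    ∃ κ : Constants, ∀ᶠ n in atTop, (S n).Regular h₀ κ (strength S δ₁ δ₂ n) := by
  obtain ⟨hγ, B, hB⟩ := hmix
  obtain ⟨D, hD, hmom⟩ := hmom.exists_momentsLe
  obtain ⟨cF, hcF, hF⟩ := hF
  obtain ⟨c, hc, hP⟩ := hP
  obtain ⟨σ, hσ, hsing⟩ := exists_eventually_strength_le hR' hC'
  obtain ⟨L, hL, hnorm⟩ := exists_eventually_norm_sq_le hR hC
  refine ⟨⟨γ, D, B, c / 2, cF, σ, L, hγ, hD, half_pos hc, hcF, hσ, hL⟩, ?_⟩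
  filter_upwards [hp, hq, hT.eventually_gt_atTop (2 * h₀), hF, hP, hsing, hnorm]
    with n hp hq hT hF hP hsing hnorm
  refine ⟨hS n, hmom n, hB n, hp, hq, hT, fun z => ?_, hF.1, hF.2, strength_pos hp hq,
    strength_le hδ₁ hδ₂ hp hq, hsing, hnorm⟩
  calc _ = c * (S n).q * (z ⬝ᵥ z) := by ring
    _ ≤ nthEig (((S n).T : ℝ)⁻¹ • ∑ t ∈ (S n).times, (S n).P t) (m - 1) * (z ⬝ᵥ z) :=
      mul_le_mul_of_nonneg_right hP (by rw [← norm_toLp_sq]; positivity)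
    _ ≤ _ := nthEig_mul_dotProduct_self_le (Model.isHermitian_avg_P (S n)) z

theorem isBigOInProb_of_le_rate {κ : Constants} {Z : ∀ n, Ω n → ℝ}
    (hT : Tendsto (fun n => (S n).T) atTop atTop)
    (hS : ∀ᶠ n in atTop, (S n).Regular h₀ κ (strength S δ₁ δ₂ n))
    (hZ : ∀ K : ℝ, ∀ᶠ n in atTop, ∀ ω, (S n).SmallErrors h₀ K ω → K ≤ κ.c ^ 2 * (S n).T →
      |Z n ω| ≤ Model.distConst κ h₀ K * (S n).rate (strength S δ₁ δ₂ n)) :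
    IsBigOInProb (fun n => (S n).μ) Z fun n =>
      ((S n).p : ℝ) ^ δ₁ * ((S n).q : ℝ) ^ δ₂ * ((S n).T : ℝ) ^ (-(1 / 2 : ℝ)) := by
  refine isBigOInProb_of_meanLe (fun n ω => Model.totalErr_nonneg (S := S n) (h₀ := h₀))
    (hS.mono fun n hn => hn.meanLe_totalErr) fun K => ⟨Model.distConst κ h₀ K, ?_⟩
  have hKT : Tendsto (fun n => κ.c ^ 2 * ((S n).T : ℝ)) atTop atTop :=
    (tendsto_natCast_atTop_atTop.comp hT).const_mul_atTop (pow_pos κ.c_pos 2)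
  filter_upwards [hS, hZ K, hKT.eventually_ge_atTop K] with n hS hZ hK ω hω
  rw [← rate_strength hS.p_pos hS.q_pos]
  exact hZ ω (Model.smallErrors_of_totalErr_le hS.p_pos hS.q_pos
    (pos_of_gt hS.two_mul_lt_T) hω) hK

end Sequences

end MatFactor

end

theorem theorem5_general {k r m h₀ : ℕ} (hk : 1 ≤ k) (hr : 1 ≤ r) {γ δ₁ δ₂ : ℝ}
    {Ω : ℕ → Type*} [∀ n, MeasurableSpace (Ω n)] {S : ∀ n, MatFactor.Model k r m (Ω n)}
    (hT : Tendsto (fun n => (S n).T) atTop atTop)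
    (hS : ∀ n, (S n).Standing) (hmix : MatFactor.Condition1 S γ) (hmom : MatFactor.Condition2 S γ)
    (hF : ∃ c : ℝ, 0 < c ∧ ∀ᶠ n in atTop,
      c ≤ MatFactor.nthEig (MatFactor.popM (S n).μ (S n).T h₀ (S n).F) (k - 1) ∧
        c ≤ MatFactor.nthEig (MatFactor.popM (S n).μ (S n).T h₀ fun t ω => ((S n).F t ω)ᵀ) (r - 1))
    (hP : ∃ c : ℝ, 0 < c ∧ ∀ᶠ n in atTop,
      c * (S n).q ≤ MatFactor.nthEig (((S n).T : ℝ)⁻¹ • ∑ t ∈ (S n).times, (S n).P t) (m - 1))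
    (hδ₁ : 0 ≤ δ₁) (hδ₂ : 0 ≤ δ₂)
    (hR : (fun n => MatFactor.specNorm (S n).R ^ 2) =O[atTop] fun n => ((S n).p : ℝ) ^ (1 - δ₁))
    (hR' : (fun n => ((S n).p : ℝ) ^ (1 - δ₁)) =O[atTop]
      fun n => MatFactor.singVal (S n).R (k - 1) ^ 2)
    (hC : (fun n => MatFactor.specNorm (S n).C ^ 2) =O[atTop] fun n => ((S n).q : ℝ) ^ (1 - δ₂))
    (hC' : (fun n => ((S n).q : ℝ) ^ (1 - δ₂)) =O[atTop]
      fun n => MatFactor.singVal (S n).C (r - 1) ^ 2)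
    {Q₁ : ∀ n, Matrix (Fin (S n).p) (Fin k) ℝ} {Q₂ : ∀ n, Matrix (Fin (S n).q) (Fin r) ℝ}
    {Q₁hat : ∀ n, Ω n → Matrix (Fin (S n).p) (Fin k) ℝ}
    {Q₂hat : ∀ n, Ω n → Matrix (Fin (S n).q) (Fin r) ℝ}
    (hQ₁ : ∀ᶠ n in atTop, MatFactor.IsLeadingEigenvectors ((S n).M₁ h₀) (Q₁ n))
    (hQ₂ : ∀ᶠ n in atTop, MatFactor.IsLeadingEigenvectors ((S n).M₂ h₀) (Q₂ n))
    (hQ₁hat : ∀ᶠ n in atTop, ∀ ω,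
      MatFactor.IsLeadingEigenvectors ((S n).M₁hat h₀ ω) (Q₁hat n ω))
    (hQ₂hat : ∀ᶠ n in atTop, ∀ ω,
      MatFactor.IsLeadingEigenvectors ((S n).M₂hat h₀ ω) (Q₂hat n ω)) :
    MatFactor.IsBigOInProb (fun n => (S n).μ)
        (fun n ω => MatFactor.subspaceDist (Q₁hat n ω) (Q₁ n))
        (fun n => ((S n).p : ℝ) ^ δ₁ * ((S n).q : ℝ) ^ δ₂ * ((S n).T : ℝ) ^ (-(1 / 2 : ℝ))) ∧
      MatFactor.IsBigOInProb (fun n => (S n).μ)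
        (fun n ω => MatFactor.subspaceDist (Q₂hat n ω) (Q₂ n))
        (fun n => ((S n).p : ℝ) ^ δ₁ * ((S n).q : ℝ) ^ δ₂ * ((S n).T : ℝ) ^ (-(1 / 2 : ℝ))) := by
  have hp : ∀ᶠ n in atTop, 0 < (S n).p := hQ₁.mono fun n h =>
    hk.trans (MatFactor.card_le_of_transpose_mul_self h.1)
  have hq : ∀ᶠ n in atTop, 0 < (S n).q := hQ₂.mono fun n h =>
    hr.trans (MatFactor.card_le_of_transpose_mul_self h.1)
  obtain ⟨κ, hreg⟩ := MatFactor.exists_eventually_regular hp hq hT hS hmix hmom hF hP hδ₁ hδ₂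
    hR hR' hC hC'
  constructor
  · refine MatFactor.isBigOInProb_of_le_rate hT hreg fun K => ?_
    filter_upwards [hreg, hQ₁, hQ₁hat] with n hn hQ hQ' ω hω hK
    exact (abs_of_nonneg (Real.sqrt_nonneg _)).trans_le
      (hn.subspaceDist_M₁_le hk hω hK hQ (hQ' ω))
  · refine MatFactor.isBigOInProb_of_le_rate hT hreg fun K => ?_
    filter_upwards [hreg, hQ₂, hQ₂hat] with n hn hQ hQ' ω hω hK
    exact (abs_of_nonneg (Real.sqrt_nonneg _)).trans_le
      (hn.subspaceDist_M₂_le hr hω hK hQ (hQ' ω))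

theorem theorem5 {k r m h₀ : ℕ} (hk : 1 ≤ k) (hr : 1 ≤ r) (hm : 1 ≤ m) (γ δ₁ δ₂ : ℝ)
    {Ω : ℕ → Type*} [∀ n, MeasurableSpace (Ω n)] (S : ∀ n, MatFactor.Model k r m (Ω n))
    (hp : Tendsto (fun n => (S n).p) atTop atTop)
    (hq : Tendsto (fun n => (S n).q) atTop atTop)
    (hT : Tendsto (fun n => (S n).T) atTop atTop)
    (hS : ∀ n, (S n).Standing)
    (h1 : MatFactor.Condition1 S γ)
    (h2 : MatFactor.Condition2 S γ)
    (h3 : MatFactor.Condition3 S h₀)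
    (h4 : MatFactor.Condition4 S)
    (h5 : MatFactor.Condition5 S)
    (h6 : MatFactor.Condition6 S δ₁ δ₂)
    (h7 : MatFactor.Condition7 S h₀)
    (hrate : Tendsto
      (fun n => ((S n).p : ℝ) ^ δ₁ * ((S n).q : ℝ) ^ δ₂ * ((S n).T : ℝ) ^ (-(1 / 2 : ℝ)))
      atTop (𝓝 0))
    (Q₁ : ∀ n, Matrix (Fin (S n).p) (Fin k) ℝ) (Q₂ : ∀ n, Matrix (Fin (S n).q) (Fin r) ℝ)
    (Q₁hat : ∀ n, Ω n → Matrix (Fin (S n).p) (Fin k) ℝ)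
    (Q₂hat : ∀ n, Ω n → Matrix (Fin (S n).q) (Fin r) ℝ)
    (hQ₁ : ∀ᶠ n in atTop, MatFactor.IsLeadingEigenvectors ((S n).M₁ h₀) (Q₁ n))
    (hQ₂ : ∀ᶠ n in atTop, MatFactor.IsLeadingEigenvectors ((S n).M₂ h₀) (Q₂ n))
    (hQ₁hat : ∀ᶠ n in atTop, ∀ ω,
      MatFactor.IsLeadingEigenvectors ((S n).M₁hat h₀ ω) (Q₁hat n ω))
    (hQ₂hat : ∀ᶠ n in atTop, ∀ ω,
      MatFactor.IsLeadingEigenvectors ((S n).M₂hat h₀ ω) (Q₂hat n ω)) :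
    MatFactor.IsBigOInProb (fun n => (S n).μ)
        (fun n ω => MatFactor.subspaceDist (Q₁hat n ω) (Q₁ n))
        (fun n => ((S n).p : ℝ) ^ δ₁ * ((S n).q : ℝ) ^ δ₂ * ((S n).T : ℝ) ^ (-(1 / 2 : ℝ))) ∧
      MatFactor.IsBigOInProb (fun n => (S n).μ)
        (fun n ω => MatFactor.subspaceDist (Q₂hat n ω) (Q₂ n))
        (fun n => ((S n).p : ℝ) ^ δ₁ * ((S n).q : ℝ) ^ δ₂ * ((S n).T : ℝ) ^ (-(1 / 2 : ℝ))) := by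
  obtain ⟨hδ₁, -, hδ₂, -, hR, hR', hC, hC'⟩ := h6
  exact theorem5_general hk hr hT hS h1 h2 h3.2 (h4.exists_le_nthEig_avg_P hm hq) hδ₁ hδ₂
    hR.1 hR'.2 hC.1 hC'.2 hQ₁ hQ₂ hQ₁hat hQ₂hat
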